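/- **Theorem 3.5 (uniqueness and continuous dependence).** Let $B,T>0$, $\mathcal S=\mathbb R\times(0,B)$, $\mathcal S_T=\mathcal S\times(0,T)$, and let $b>0$ satisfy $6b-40b^3\ge 0$. Write $(\cdot,\cdot)$ and $\|\cdot\|$ for the inner product and the norm of $L^2(\mathcal S)$. An *initial datum* is a function $u_0$ on $\mathcal S$ with $u_0(x,0)=u_0(x,B)=0$ for all $x\in\mathbb R$ and $$J_0=\|u_0\|^2+\big(e^{2bx},\,u_0^2+|\nabla u_0|^2+|\nabla u_{0x}|^2+u_0^2u_{0x}^2+|\Delta u_{0x}|^2+|\partial_x^5u_0|^2\big)<\infty .$$ A *regular solution* with initial datum $u_0$ is a function $u(x,y,t)$ on $\mathcal S_T$ such that $$u\in L^\infty(0,T;L^2(\mathcal S)),\quad u_x\in L^2(0,T;L^2(\mathcal S)),$$ $$e^{bx}u,\ e^{bx}u_x\in L^\infty(0,T;H^2(\mathcal S))\cap L^2(0,T;H^3(\mathcal S)),$$ $$e^{bx}u_t\in L^\infty(0,T;L^2(\mathcal S))\cap L^2(0,T;H^1(\mathcal S)),$$ $$e^{bx}u_{xxt}\in L^2(0,T;L^2(\mathcal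 S)),\quad e^{bx}\partial_x^5u\in L^2(0,T;H^1(\mathcal S)),$$ such that for a.e. $t\in(0,T)$ and all $\phi\in L^2(\mathcal S)$ $$\big(e^{bx}[u_t-u_{xx}+u_{xxx}+uu_x+u_{xyy}-\partial_x^5u],\,\phi\big)(t)=0,$$ such that $u(x,0,t)=u(x,B,t)=0$ for all $x\in\mathbb R$ and a.e. $t\in(0,T)$, and such that $u(\cdot,\cdot,0)=u_0$. All derivatives are weak derivatives; boundary values are those of the version that is continuous on the closed strip, and $u(\cdot,\cdot,t)$, for a given $t\in[0,T]$, is the value at $t$ of the version of $u$ for which $t\mapsto e^{bx}u(\cdot,\cdot,t)$ is continuous from $[0,T]$ to $L^2(\mathcal S)$. 1. If $u_1$ and $u_2$ are regular solutions with the same initial datum, then $u_1=u_2$ a.e. in $\mathcal S_T$. 2. For every $M\ge 0$ there is a constant $C=C(b,T,M)$, independent of $B$, such that, if $u_1,u_2$ are regular solutions with initial data $u_{01},u_{02}$ satisfying $\|u_{01}\|\le M$ and $\|u_{02}\|\le M$, then $$(e^{2bx},(u_1-u_2)^2)(t)\le C\,(e^{2bx},(u_{01}-u_{02})^2)\qquad\text{for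 all }t\in(0,T).$$ -/

import Mathlib

open MeasureTheory Set Filter Topology
open scoped ENNReal NNReal ContDiff

namespace KawaharaBurgers

/-! ## Weak derivatives -/

/-- The iterated directional derivative of `φ` along the vectors of a list. -/
noncomputable def dirDeriv {E : Type*} [NormedAddCommGroup E] [NormedSpace ℝ E] :
    List E → (E → ℝ) → E → ℝ
  | [], φ => φ
  | v :: L, φ => fun p => fderiv ℝ (dirDeriv L φ) p v

/-- `g` is the weak (distributional) derivative of `f`, along the vectors of the list `L`, on the
open set `Ω`. -/
def HasWeakDeriv {E : Type*} [NormedAddCommGroup E] [NormedSpace ℝ E] [MeasureSpace E]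
    (Ω : Set E) (L : List E) (f g : E → ℝ) : Prop :=
  LocallyIntegrableOn f Ω volume ∧ LocallyIntegrableOn g Ω volume ∧
    ∀ φ : E → ℝ, ContDiff ℝ ∞ φ → HasCompactSupport φ → tsupport φ ⊆ Ω →
      ∫ p in Ω, f p * dirDeriv L φ p = (-1) ^ L.length * ∫ p in Ω, g p * φ p

/-! ## The strip; points of space are `(x, y)`, points of space-time are `((x, y), t)` -/

/-- The strip `ℝ × (0, B)`. -/
def strip (B : ℝ) : Set (ℝ × ℝ) := univ ×ˢ Ioo 0 B

/-- The space-time cylinder over the strip, for times in `(0, T)`. -/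
def cylinder (B T : ℝ) : Set ((ℝ × ℝ) × ℝ) := strip B ×ˢ Ioo 0 T

/-- The coordinate directions of `x`, `y` in space. -/
def sx : ℝ × ℝ := (1, 0)
def sy : ℝ × ℝ := (0, 1)

/-- The coordinate directions of `x`, `y`, `t` in space-time. -/
def ex : (ℝ × ℝ) × ℝ := ((1, 0), 0)
def ey : (ℝ × ℝ) × ℝ := ((0, 1), 0)
def et : (ℝ × ℝ) × ℝ := ((0, 0), 1)

/-- The function `e^{bx} f` on space-time. -/
noncomputable def weighted (b : ℝ) (f : (ℝ × ℝ) × ℝ → ℝ) : (ℝ × ℝ) × ℝ → ℝ :=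
  fun p => Real.exp (b * p.1.1) * f p

/-! ## Function spaces -/

/-- `f ∈ L^p(0, T; L²(strip))`. -/
def MemLpL2 (B T : ℝ) (p : ℝ≥0∞) (f : (ℝ × ℝ) × ℝ → ℝ) : Prop :=
  AEStronglyMeasurable f (volume.restrict (cylinder B T)) ∧
    eLpNorm (fun t : ℝ => eLpNorm (fun z : ℝ × ℝ => f (z, t)) 2 (volume.restrict (strip B)))
      p (volume.restrict (Ioo 0 T)) < ⊤

/-- `f ∈ L^p(0, T; H^k(strip))`: all the weak spatial derivatives of order at most `k` are in
`L^p(0, T; L²(strip))`. -/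
def MemLpH (B T : ℝ) (p : ℝ≥0∞) (k : ℕ) (f : (ℝ × ℝ) × ℝ → ℝ) : Prop :=
  MemLpL2 B T p f ∧
    ∀ i j : ℕ, i + j ≤ k → ∃ g : (ℝ × ℝ) × ℝ → ℝ,
      HasWeakDeriv (cylinder B T) (List.replicate i ex ++ List.replicate j ey) f g ∧
        MemLpL2 B T p g

/-- The function `f` of `(x, y)` (given up to null sets) has a version that is continuous on the
closed strip and equals zero on both boundary lines `y = 0` and `y = B`. -/
def VanishesOnBoundary (B : ℝ) (f : ℝ × ℝ → ℝ) : Prop :=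
  ∃ v : ℝ × ℝ → ℝ, ContinuousOn v (univ ×ˢ Icc 0 B) ∧ v =ᵐ[volume.restrict (strip B)] f ∧
    ∀ x : ℝ, v (x, 0) = 0 ∧ v (x, B) = 0

/-- `U` is the version of `u` that is continuous in time, on the closed interval `[0, T]`, with
values in `L²(strip; e^{2bx} dx dy)`. -/
def IsTimeContinuousVersion (b B T : ℝ) (u : (ℝ × ℝ) × ℝ → ℝ) (U : ℝ → ℝ × ℝ → ℝ) : Prop :=
  (∀ t ∈ Icc 0 T, MemLp (fun z : ℝ × ℝ => Real.exp (b * z.1) * U t z) 2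
      (volume.restrict (strip B))) ∧
  (∀ s ∈ Icc 0 T, Tendsto
      (fun t => eLpNorm (fun z : ℝ × ℝ => Real.exp (b * z.1) * (U t z - U s z)) 2
        (volume.restrict (strip B)))
      (𝓝[Icc 0 T] s) (𝓝 0)) ∧
  (∀ᵐ t ∂(volume.restrict (Ioo 0 T)),
      U t =ᵐ[volume.restrict (strip B)] fun z => u (z, t))

/-- The squared weighted norm `(e^{2bx}, f²)`, that is `∫ e^{2bx} f² dx dy` over the strip. -/
noncomputable def weightedSq (b B : ℝ) (f : ℝ × ℝ → ℝ) : ℝ≥0∞ :=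
  ∫⁻ z in strip B, ENNReal.ofReal (Real.exp (2 * b * z.1) * f z ^ 2)

/-! ## Initial data and regular solutions -/

/-- Initial data: `u₀` is zero on the boundary lines and `J₀ < ∞`, where `J₀` is
`‖u₀‖² + (e^{2bx}, u₀² + |∇u₀|² + |∇u₀ₓ|² + u₀² u₀ₓ² + |Δu₀ₓ|² + |∂ₓ⁵u₀|²)`. -/
def IsInitialDatum (b B : ℝ) (u₀ : ℝ × ℝ → ℝ) : Prop :=
  VanishesOnBoundary B u₀ ∧
  ∃ dx dy dxx dxy dxxx dxyy dx5 : ℝ × ℝ → ℝ,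
    HasWeakDeriv (strip B) [sx] u₀ dx ∧
    HasWeakDeriv (strip B) [sy] u₀ dy ∧
    HasWeakDeriv (strip B) [sx, sx] u₀ dxx ∧
    HasWeakDeriv (strip B) [sx, sy] u₀ dxy ∧
    HasWeakDeriv (strip B) [sx, sx, sx] u₀ dxxx ∧
    HasWeakDeriv (strip B) [sx, sy, sy] u₀ dxyy ∧
    HasWeakDeriv (strip B) [sx, sx, sx, sx, sx] u₀ dx5 ∧
    ∫⁻ z in strip B, ENNReal.ofReal (u₀ z ^ 2 + Real.exp (2 * b * z.1) *
      (u₀ z ^ 2 + (dx z ^ 2 + dy z ^ 2) + (dxx z ^ 2 + dxy z ^ 2) + u₀ z ^ 2 * dx z ^ 2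
        + (dxxx z + dxyy z) ^ 2 + dx5 z ^ 2)) < ⊤

/-- `u` is a regular solution, on the strip of width `B` and the time interval `(0, T)`, of
`u_t - u_xx + u u_x + u_xxx + u_xyy - ∂ₓ⁵u = 0`, `u(x, 0, t) = u(x, B, t) = 0`,
`u(x, y, 0) = u₀(x, y)`. -/
def IsRegularSolution (b B T : ℝ) (u₀ : ℝ × ℝ → ℝ) (u : (ℝ × ℝ) × ℝ → ℝ) : Prop :=
  ∃ ut ux uxx uxxx uxyy ux5 uxxt : (ℝ × ℝ) × ℝ → ℝ,
    -- the weak derivatives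
    HasWeakDeriv (cylinder B T) [et] u ut ∧
    HasWeakDeriv (cylinder B T) [ex] u ux ∧
    HasWeakDeriv (cylinder B T) [ex, ex] u uxx ∧
    HasWeakDeriv (cylinder B T) [ex, ex, ex] u uxxx ∧
    HasWeakDeriv (cylinder B T) [ex, ey, ey] u uxyy ∧
    HasWeakDeriv (cylinder B T) [ex, ex, ex, ex, ex] u ux5 ∧
    HasWeakDeriv (cylinder B T) [ex, ex, et] u uxxt ∧
    -- the regularity class
    MemLpL2 B T ∞ u ∧ MemLpL2 B T 2 ux ∧
    MemLpH B T ∞ 2 (weighted b u) ∧ MemLpH B T 2 3 (weighted b u) ∧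
    MemLpH B T ∞ 2 (weighted b ux) ∧ MemLpH B T 2 3 (weighted b ux) ∧
    MemLpL2 B T ∞ (weighted b ut) ∧ MemLpH B T 2 1 (weighted b ut) ∧
    MemLpL2 B T 2 (weighted b uxxt) ∧
    MemLpH B T 2 1 (weighted b ux5) ∧
    -- the equation
    (∀ᵐ t ∂(volume.restrict (Ioo 0 T)), ∀ φ : ℝ × ℝ → ℝ,
      MemLp φ 2 (volume.restrict (strip B)) →
      ∫ z in strip B, Real.exp (b * z.1) *
        (ut (z, t) - uxx (z, t) + uxxx (z, t) + u (z, t) * ux (z, t) + uxyy (z, t) - ux5 (z, t))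
          * φ z = 0) ∧
    -- the boundary condition
    (∀ᵐ t ∂(volume.restrict (Ioo 0 T)), VanishesOnBoundary B fun z => u (z, t)) ∧
    -- the initial condition
    (∃ U : ℝ → ℝ × ℝ → ℝ, IsTimeContinuousVersion b B T u U ∧
      U 0 =ᵐ[volume.restrict (strip B)] u₀)

end KawaharaBurgers

/-! The difference `w = u₁ - u₂` satisfies the linear part of the equation with forcing `-(s w)ₓ/2`,
where `s = u₁ + u₂`. Multiplying by `2 e^{2bx} w` and integrating by parts turns the linear part
into the dissipation `(2 + 6b - 40b³)‖e^{bx}wₓ‖² + 10b‖e^{bx}wₓₓ‖² + 2b‖e^{bx}w_y‖²` plus multiples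
of `‖e^{bx}w‖²` (`SliceRegular.linear_energy`). The hypothesis on `b` is exactly what keeps the part
beyond `2‖e^{bx}wₓ‖²` from having a bad sign.

The cubic terms are `∫ e^{2bx} s w²` and `∫ e^{2bx} s w wₓ`. Only the `L²` norm of `s` is available
uniformly in time, so the other two factors need an anisotropic bound: `w` vanishes for `y = 0` and
`y = B`, hence is bounded in `y` by a function of `x`, and the remaining factor is bounded in `x` by
a function of `y`; a product of such majorants integrates to a product of one-dimensional integrals
(`lintegral_trilinear_le`). Neither step produces a constant depending on `B`. Young's inequality
absorbs everything into the dissipation, and Gronwall gives the estimate with rate `growthRate b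
(2M)` (`SliceRegular.difference_estimate`, `IsSolutionJet.weightedDist_le`). Uniqueness is the case
of equal data.

The constant may depend on the data only through `M`, so `‖u(t)‖ ≤ ‖u₀‖` is needed in the unweighted
norm, whereas the higher derivatives are square integrable only with weight `e^{bx}`. The weight `1`
is therefore approximated by the logistic functions `σ(2b(x+n))`, which are at most a multiple of
`e^{2bx}`. All their derivatives are bounded by multiples of `σ(1-σ)`, so the energy inequality
leaves an error `C ∫∫ σ(1-σ) u²`, which tends to zero as `n → ∞` (`SliceRegular.logistic_estimate`,
`IsSolutionJet.l2_le`).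

To make these computations legitimate for weak derivatives, a weak directional derivative is shown
to give absolute continuity on almost every line (`HasWeakDeriv.ae_shift`,
`HasWeakDeriv.ae_hasACDeriv`). Integrations by parts are then one-dimensional, combined with Fubini.
In the time direction the same fact yields a version that is a primitive of `u_t` pointwise in
space, and it agrees with the `L²`-continuous version at every time
(`IsTimeContinuousVersion.ae_eq`). -/

namespace KawaharaBurgers

/-! ## Absolutely continuous functions of one variable -/

/-- `F` is a primitive of the (locally integrable) function `g` on the interval `I`. -/
def IsPrimitiveOn (I : Set ℝ) (F g : ℝ → ℝ) : Prop :=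
  ∀ a ∈ I, ∀ b ∈ I, IntervalIntegrable g volume a b ∧ F b - F a = ∫ x in a..b, g x

/-- `f` agrees a.e. on `I` with a primitive of `g`. -/
def HasACDeriv (I : Set ℝ) (f g : ℝ → ℝ) : Prop :=
  ∃ F : ℝ → ℝ, F =ᵐ[volume.restrict I] f ∧ IsPrimitiveOn I F g

section OneVariable

variable {I : Set ℝ} {F G f f' g g' h k : ℝ → ℝ}

theorem ae_uIoc_of_ae_restrict (hI : I.OrdConnected) {p : ℝ → Prop}
    (hp : ∀ᵐ x ∂volume.restrict I, p x) {a b : ℝ} (ha : a ∈ I) (hb : b ∈ I) :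
    ∀ᵐ x, x ∈ uIoc a b → p x := by
  have := ae_restrict_of_ae_restrict_of_subset (uIoc_subset_uIcc.trans (hI.uIcc_subset ha hb)) hp
  exact (ae_restrict_iff' measurableSet_uIoc).1 this

theorem IsPrimitiveOn.congr_ae (hI : I.OrdConnected) (h : IsPrimitiveOn I F f)
    (hfg : f =ᵐ[volume.restrict I] g) : IsPrimitiveOn I F g := by
  intro a ha b hb
  have h1 := ae_uIoc_of_ae_restrict hI hfg ha hb
  refine ⟨(h a ha b hb).1.congr_ae ((ae_restrict_iff' measurableSet_uIoc).2 h1), ?_⟩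
  rw [(h a ha b hb).2]
  exact intervalIntegral.integral_congr_ae h1

theorem IsPrimitiveOn.eq_add (h : IsPrimitiveOn I F f) {a x : ℝ} (ha : a ∈ I) (hx : x ∈ I) :
    F x = F a + ∫ t in a..x, f t := by
  rw [← (h a ha x hx).2]; ring

/-- A primitive on `I` is unconstrained outside `I`. Absolute continuity and almost everywhere
differentiability are therefore proved for this globally defined expression, with which the
primitive coincides on `I`. -/
theorem absolutelyContinuousOnInterval_add_integral {a b c : ℝ}
    (h : IntervalIntegrable f volume a b) :
    AbsolutelyContinuousOnInterval (fun x => c + ∫ t in a..x, f t) a b := by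
  have h1 := h.absolutelyContinuousOnInterval_intervalIntegral left_mem_uIcc
  have h2 : AbsolutelyContinuousOnInterval (fun _ : ℝ => c) a b :=
    ((LipschitzWith.const c).lipschitzOnWith).absolutelyContinuousOnInterval
  exact h2.add h1

theorem ae_deriv_add_integral {a b c : ℝ} (h : IntervalIntegrable f volume a b) :
    ∀ᵐ x, x ∈ uIcc a b → deriv (fun x => c + ∫ t in a..x, f t) x = f x := by
  filter_upwards [h.ae_hasDerivAt_integral] with x hx hxI
  exact ((hx hxI a left_mem_uIcc).const_add c).deriv

theorem IsPrimitiveOn.continuousOn_uIcc (hI : I.OrdConnected) (h : IsPrimitiveOn I F f) {a b : ℝ}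
    (ha : a ∈ I) (hb : b ∈ I) : ContinuousOn F (uIcc a b) := by
  refine (absolutelyContinuousOnInterval_add_integral (c := F a)
    (h a ha b hb).1).continuousOn.congr fun x hx => ?_
  exact h.eq_add ha (hI.uIcc_subset ha hb hx)

theorem IsPrimitiveOn.continuousOn (hI : I.OrdConnected) (hIo : IsOpen I) (h : IsPrimitiveOn I F f) :
    ContinuousOn F I := by
  intro x hx
  obtain ⟨a, b, hxab, hab⟩ := (mem_nhds_iff_exists_Ioo_subset.1 (hIo.mem_nhds hx))
  obtain ⟨a', ha'⟩ := exists_between hxab.1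
  obtain ⟨b', hb'⟩ := exists_between hxab.2
  have h1 := h.continuousOn_uIcc hI (hab ⟨ha'.1, ha'.2.trans hxab.2⟩)
    (hab ⟨hxab.1.trans hb'.1, hb'.2⟩)
  refine (h1.continuousAt ?_).continuousWithinAt
  rw [uIcc_of_le (ha'.2.trans hb'.1).le]
  exact Icc_mem_nhds ha'.2 hb'.1

theorem IsPrimitiveOn.mul (hI : I.OrdConnected) (hF : IsPrimitiveOn I F f)
    (hG : IsPrimitiveOn I G g) : IsPrimitiveOn I (fun x => F x * G x)
      (fun x => f x * G x + F x * g x) := by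
  intro a ha b hb
  have hFi := (hF a ha b hb).1
  have hGi := (hG a ha b hb).1
  refine ⟨(hFi.mul_continuousOn (hG.continuousOn_uIcc hI ha hb)).add
    (hGi.continuousOn_mul (hF.continuousOn_uIcc hI ha hb)), ?_⟩
  have key := (absolutelyContinuousOnInterval_add_integral (c := F a) hFi).integral_deriv_mul_eq_sub
    (absolutelyContinuousOnInterval_add_integral (c := G a) hGi)
  rw [← hF.eq_add ha hb, ← hG.eq_add ha hb, ← hF.eq_add ha ha, ← hG.eq_add ha ha] at key
  rw [← key]
  apply intervalIntegral.integral_congr_ae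
  filter_upwards [ae_deriv_add_integral (c := F a) hFi, ae_deriv_add_integral (c := G a) hGi]
    with x h1 h2 hx
  have hx' := uIoc_subset_uIcc hx
  rw [h1 hx', h2 hx', ← hF.eq_add ha (hI.uIcc_subset ha hb hx'),
    ← hG.eq_add ha (hI.uIcc_subset ha hb hx')]

theorem IsPrimitiveOn.add (hF : IsPrimitiveOn I F f) (hG : IsPrimitiveOn I G g) :
    IsPrimitiveOn I (fun x => F x + G x) (fun x => f x + g x) := by
  intro a ha b hb
  refine ⟨(hF a ha b hb).1.add (hG a ha b hb).1, ?_⟩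
  rw [intervalIntegral.integral_add (hF a ha b hb).1 (hG a ha b hb).1, ← (hF a ha b hb).2,
    ← (hG a ha b hb).2]
  ring

theorem IsPrimitiveOn.const_mul (c : ℝ) (hF : IsPrimitiveOn I F f) :
    IsPrimitiveOn I (fun x => c * F x) (fun x => c * f x) := by
  intro a ha b hb
  refine ⟨(hF a ha b hb).1.const_mul c, ?_⟩
  rw [intervalIntegral.integral_const_mul, ← (hF a ha b hb).2]
  ring

theorem IsPrimitiveOn.of_hasDerivAt (h : ∀ x, HasDerivAt F (f x) x) (hf : Continuous f) :
    IsPrimitiveOn I F f := fun _ _ _ _ =>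
  ⟨hf.intervalIntegrable _ _, (intervalIntegral.integral_eq_sub_of_hasDerivAt (fun x _ => h x)
    (hf.intervalIntegrable _ _)).symm⟩

/-- A primitive with arbitrarily small values is bounded by the `L¹` norm of its derivative. -/
theorem IsPrimitiveOn.enorm_le (hI : I.OrdConnected) (hF : IsPrimitiveOn I F f)
    (hsmall : ∀ ε > 0, ∃ a ∈ I, |F a| < ε) {x : ℝ} (hx : x ∈ I) :
    ‖F x‖ₑ ≤ ∫⁻ t in I, ‖f t‖ₑ := by
  refine ENNReal.le_of_forall_pos_le_add fun ε hε _ => ?_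
  obtain ⟨a, ha, hFa⟩ := hsmall ε hε
  have hle : ‖∫ t in a..x, f t‖ₑ ≤ ∫⁻ t in I, ‖f t‖ₑ := by
    have h1 : ‖∫ t in a..x, f t‖ₑ = ‖∫ t in uIoc a x, f t‖ₑ := by
      rw [← ofReal_norm, ← ofReal_norm, intervalIntegral.norm_integral_eq_norm_integral_uIoc]
    rw [h1]
    refine (enorm_integral_le_lintegral_enorm _).trans ?_
    exact lintegral_mono_set (uIoc_subset_uIcc.trans (hI.uIcc_subset ha hx))
  rw [hF.eq_add ha hx]
  refine (enorm_add_le _ _).trans ?_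
  rw [add_comm]
  gcongr
  rw [Real.enorm_eq_ofReal_abs]
  exact ENNReal.ofReal_le_of_le_toReal (by simpa using hFa.le)

/-- Integrability of `f` gives `F` limits at both infinities. Neighbourhoods of infinity have
infinite measure, so integrability of `F` forces both limits to be zero. -/
theorem IsPrimitiveOn.integral_eq_zero_of_integrable (hF : IsPrimitiveOn univ F f)
    (hFi : Integrable F) (hfi : Integrable f) : ∫ x, f x = 0 := by
  have hconv : ∀ (l : Filter ℝ) (u : ℝ), Tendsto (fun x => ∫ t in 0..x, f t) l (𝓝 u) →
      (∀ s ∈ l, volume s = ⊤) → F 0 + u = 0 := by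
    intro l u hu hl
    have h1 : Tendsto F l (𝓝 (F 0 + u)) := by
      refine (hu.const_add (F 0)).congr fun x => ?_
      exact (hF.eq_add (mem_univ _) (mem_univ _)).symm
    exact IntegrableAtFilter.eq_zero_of_tendsto ⟨univ, univ_mem, hFi.integrableOn⟩ hl h1
  have h1 := intervalIntegral_tendsto_integral_Ioi 0 hfi.integrableOn (tendsto_id (α := ℝ))
  have h2 := intervalIntegral_tendsto_integral_Iic 0 hfi.integrableOn (tendsto_id (α := ℝ))
  have h2' : Tendsto (fun x => ∫ t in 0..x, f t) atBot (𝓝 (-∫ t in Iic 0, f t)) := by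
    refine h2.neg.congr fun x => ?_
    rw [intervalIntegral.integral_symm]; simp
  have e1 := hconv _ _ h1 fun s hs => by
    obtain ⟨b, hb⟩ := mem_atTop_sets.1 hs
    rw [← top_le_iff, ← Real.volume_Ici (a := b)]
    exact measure_mono hb
  have e2 := hconv _ _ h2' fun s hs => by
    obtain ⟨b, hb⟩ := mem_atBot_sets.1 hs
    rw [← top_le_iff, ← Real.volume_Iic (a := b)]
    exact measure_mono hb
  rw [← intervalIntegral.integral_Iic_add_Ioi (b := 0) hfi.integrableOn hfi.integrableOn]
  linarith

theorem exists_abs_lt_of_integrable (hF : Integrable F) {ε : ℝ} (hε : 0 < ε) :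
    ∃ a ∈ (univ : Set ℝ), |F a| < ε := by
  by_contra! hcon
  have : Integrable (fun _ : ℝ => ε) := hF.norm.mono' (by fun_prop)
    (ae_of_all _ fun x => by simpa [abs_of_pos hε] using hcon x (mem_univ _))
  rw [integrable_const_iff] at this
  rcases this with h | h
  · exact hε.ne' h
  · exact absurd h.measure_univ_lt_top (by simp)

/-! ### Absolutely continuous functions up to null sets, and sup bounds -/

theorem HasACDeriv.mul (hI : I.OrdConnected) (hf : HasACDeriv I f f') (hg : HasACDeriv I g g') :
    HasACDeriv I (fun x => f x * g x) (fun x => f' x * g x + f x * g' x) := by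
  obtain ⟨F, hF, hFp⟩ := hf
  obtain ⟨G, hG, hGp⟩ := hg
  refine ⟨_, ?_, (hFp.mul hI hGp).congr_ae hI ?_⟩
  · filter_upwards [hF, hG] with x h1 h2; rw [h1, h2]
  · filter_upwards [hF, hG] with x h1 h2; rw [h1, h2]

theorem HasACDeriv.add (hf : HasACDeriv I f f') (hg : HasACDeriv I g g') :
    HasACDeriv I (fun x => f x + g x) (fun x => f' x + g' x) := by
  obtain ⟨F, hF, hFp⟩ := hf
  obtain ⟨G, hG, hGp⟩ := hg
  refine ⟨_, ?_, hFp.add hGp⟩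
  filter_upwards [hF, hG] with x h1 h2; rw [h1, h2]

theorem HasACDeriv.const_mul (c : ℝ) (hf : HasACDeriv I f f') :
    HasACDeriv I (fun x => c * f x) (fun x => c * f' x) := by
  obtain ⟨F, hF, hFp⟩ := hf
  refine ⟨_, ?_, hFp.const_mul c⟩
  filter_upwards [hF] with x h1; rw [h1]

theorem HasACDeriv.of_hasDerivAt (h : ∀ x, HasDerivAt f (f' x) x) (hf : Continuous f') :
    HasACDeriv I f f' := ⟨f, ae_eq_refl _, .of_hasDerivAt h hf⟩

theorem HasACDeriv.congr (hI : I.OrdConnected) (h : HasACDeriv I f f')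
    (h1 : f =ᵐ[volume.restrict I] g) (h2 : f' =ᵐ[volume.restrict I] g') : HasACDeriv I g g' := by
  obtain ⟨F, hF, hFp⟩ := h
  exact ⟨F, hF.trans h1, hFp.congr_ae hI h2⟩

theorem HasACDeriv.integral_eq_zero (h : HasACDeriv univ f f') (hf : Integrable f)
    (hf' : Integrable f') : ∫ x, f' x = 0 := by
  obtain ⟨F, hF, hFp⟩ := h
  rw [Measure.restrict_univ] at hF
  exact hFp.integral_eq_zero_of_integrable (hf.congr hF.symm) hf'

/-- The one-dimensional Agmon inequality on the line. -/
theorem HasACDeriv.enorm_sq_le (h : HasACDeriv univ f f') (hf : MemLp f 2 volume) :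
    ∀ᵐ x, ‖f x‖ₑ ^ 2 ≤ 2 * ∫⁻ t, ‖f t‖ₑ * ‖f' t‖ₑ := by
  obtain ⟨F, hF, hFp⟩ := h
  rw [Measure.restrict_univ] at hF
  have hFi : Integrable (fun x => F x * F x) := by
    have := hf.integrable_sq.congr (g := fun x => F x * F x)
      (by filter_upwards [hF] with x hx; rw [hx, sq])
    exact this
  -- `F²` is integrable on the line, hence takes arbitrarily small values, and its derivative is
  -- `2FF'`.
  have key := fun x : ℝ => (hFp.mul ordConnected_univ hFp).enorm_le ordConnected_univ
    (fun ε hε => exists_abs_lt_of_integrable hFi hε) (mem_univ x)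
  filter_upwards [hF] with x hx
  rw [← hx, sq, ← enorm_mul]
  refine (key x).trans ?_
  rw [Measure.restrict_univ, ← lintegral_const_mul' _ _ (by simp)]
  refine lintegral_mono_ae ?_
  filter_upwards [hF] with t ht
  have : f' t * F t + F t * f' t = 2 * (f t * f' t) := by rw [ht]; ring
  rw [this, enorm_mul, enorm_mul]
  gcongr
  rw [Real.enorm_eq_ofReal_abs]; norm_num

/-- `f` agrees a.e. on `(0, B)` with a function that is continuous on `[0, B]` and vanishes at both
ends. -/
def VanishesAtEnds (B : ℝ) (f : ℝ → ℝ) : Prop :=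
  ∃ v : ℝ → ℝ, ContinuousOn v (Icc 0 B) ∧ v =ᵐ[volume.restrict (Ioo 0 B)] f ∧ v 0 = 0 ∧ v B = 0

/-- The representative continuous up to the ends and the primitive are continuous and almost
everywhere equal on the open interval, hence equal there. The boundary values become one-sided
limits of the primitive. -/
theorem VanishesAtEnds.exists_primitive {B : ℝ} (hB : 0 < B) (hv : VanishesAtEnds B f)
    (h : HasACDeriv (Ioo 0 B) f f') :
    ∃ F, F =ᵐ[volume.restrict (Ioo 0 B)] f ∧ IsPrimitiveOn (Ioo 0 B) F f' ∧
      Tendsto F (𝓝[>] 0) (𝓝 0) ∧ Tendsto F (𝓝[<] B) (𝓝 0) := by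
  obtain ⟨v, hvc, hvf, hv0, hvB⟩ := hv
  obtain ⟨F, hF, hFp⟩ := h
  have hEq : EqOn v F (Ioo 0 B) := Measure.eqOn_open_of_ae_eq (hvf.trans hF.symm) isOpen_Ioo
    (hvc.mono Ioo_subset_Icc_self) (hFp.continuousOn ordConnected_Ioo isOpen_Ioo)
  refine ⟨F, hF, hFp, ?_, ?_⟩
  · have h1 : Tendsto v (𝓝[>] 0) (𝓝 0) := by
      have := (hvc 0 (left_mem_Icc.2 hB.le)).tendsto
      rw [hv0] at this
      rw [← nhdsWithin_Ioo_eq_nhdsGT hB]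
      exact this.mono_left (nhdsWithin_mono _ Ioo_subset_Icc_self)
    refine h1.congr' ?_
    filter_upwards [Ioo_mem_nhdsGT hB] with x hx using hEq hx
  · have h1 : Tendsto v (𝓝[<] B) (𝓝 0) := by
      have := (hvc B (right_mem_Icc.2 hB.le)).tendsto
      rw [hvB] at this
      rw [← nhdsWithin_Ioo_eq_nhdsLT hB]
      exact this.mono_left (nhdsWithin_mono _ Ioo_subset_Icc_self)
    refine h1.congr' ?_
    filter_upwards [Ioo_mem_nhdsLT hB] with x hx using hEq hx

/-- The one-dimensional Agmon inequality for functions that vanish at the ends. -/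
theorem VanishesAtEnds.enorm_sq_le {B : ℝ} (hB : 0 < B) (hv : VanishesAtEnds B f)
    (h : HasACDeriv (Ioo 0 B) f f') :
    ∀ᵐ x ∂volume.restrict (Ioo 0 B),
      ‖f x‖ₑ ^ 2 ≤ 2 * ∫⁻ t in Ioo 0 B, ‖f t‖ₑ * ‖f' t‖ₑ := by
  obtain ⟨F, hF, hFp, hF0, -⟩ := hv.exists_primitive hB h
  have hsmall : ∀ ε > 0, ∃ a ∈ Ioo 0 B, |F a * F a| < ε := by
    intro ε hε
    have h1 : Tendsto (fun x => |F x * F x|) (𝓝[>] 0) (𝓝 0) := by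
      simpa using (hF0.mul hF0).abs
    obtain ⟨a, ha, ha'⟩ := ((h1.eventually_lt_const hε).and (Ioo_mem_nhdsGT hB)).exists
    exact ⟨a, ha', ha⟩
  filter_upwards [hF, ae_restrict_mem measurableSet_Ioo] with x hx hxI
  rw [← hx, sq, ← enorm_mul]
  refine ((hFp.mul ordConnected_Ioo hFp).enorm_le ordConnected_Ioo hsmall hxI).trans ?_
  rw [← lintegral_const_mul' _ _ (by simp)]
  refine lintegral_mono_ae ?_
  filter_upwards [hF] with t ht
  have : f' t * F t + F t * f' t = 2 * (f t * f' t) := by rw [ht]; ring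
  rw [this, enorm_mul, enorm_mul]
  gcongr
  rw [Real.enorm_eq_ofReal_abs]; norm_num

/-- Integration by parts on `(0, B)` when one factor vanishes at both ends. -/
theorem VanishesAtEnds.integral_eq_zero {B : ℝ} (hB : 0 < B) (hv : VanishesAtEnds B f)
    (hf : HasACDeriv (Ioo 0 B) f f') (hg : HasACDeriv (Ioo 0 B) g g')
    (hg' : IntegrableOn g' (Ioo 0 B))
    (hi : IntegrableOn (fun x => f' x * g x + f x * g' x) (Ioo 0 B)) :
    ∫ x in Ioo 0 B, (f' x * g x + f x * g' x) = 0 := by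
  obtain ⟨F, hF, hFp, hF0, hFB⟩ := hv.exists_primitive hB hf
  obtain ⟨G, hG, hGp⟩ := hg
  set h := fun x => f' x * g x + f x * g' x with hh
  have hFG : IsPrimitiveOn (Ioo 0 B) (fun x => F x * G x) h :=
    (hFp.mul ordConnected_Ioo hGp).congr_ae ordConnected_Ioo (by
      filter_upwards [hF, hG] with x h1 h2; rw [h1, h2])
  have hm : B / 2 ∈ Ioo 0 B := ⟨by linarith, by linarith⟩
  -- Integrability of `g'` bounds `G`, so `F G` tends to zero at both ends with no boundary
  -- condition on `G`.
  obtain ⟨K, hK⟩ : ∃ K, ∀ x ∈ Ioo 0 B, ‖G x‖ ≤ K := by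
    refine ⟨‖G (B / 2)‖ + ∫ x in Ioo 0 B, ‖g' x‖, fun x hx => ?_⟩
    rw [hGp.eq_add hm hx]
    refine (norm_add_le _ _).trans ?_
    gcongr
    rw [intervalIntegral.norm_integral_eq_norm_integral_uIoc]
    refine (norm_integral_le_integral_norm _).trans ?_
    exact setIntegral_mono_set hg'.norm (ae_of_all _ fun _ => norm_nonneg _)
      (uIoc_subset_uIcc.trans (ordConnected_Ioo.uIcc_subset hm hx)).eventuallyLE
  have hlim : ∀ l : Filter ℝ, Tendsto F l (𝓝 0) → Ioo 0 B ∈ l →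
      Tendsto (fun x => F x * G x) l (𝓝 0) := fun l hl hI => by
    refine hl.zero_mul_isBoundedUnder_le ⟨K, ?_⟩
    rw [eventually_map]
    filter_upwards [hI] with x hx using hK x hx
  have hint : IntervalIntegrable h volume 0 B := by
    rw [intervalIntegrable_iff_integrableOn_Ioo_of_le hB.le]; exact hi
  have hprim : ContinuousOn (fun x => ∫ t in 0..x, h t) (Icc 0 B) := by
    have := intervalIntegral.continuousOn_primitive_interval (μ := volume) (a := 0) (b := B)
      (f := h) (by rw [uIcc_of_le hB.le, integrableOn_Icc_iff_integrableOn_Ioo]; exact hi)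
    rwa [uIcc_of_le hB.le] at this
  -- This constant is computed at both ends: it is `0` in the limit at `0` and `-∫ h` in the limit
  -- at `B`.
  have hconst : ∀ x ∈ Ioo 0 B, F x * G x - ∫ t in 0..x, h t =
      F (B / 2) * G (B / 2) - ∫ t in 0..(B / 2), h t := by
    intro x hx
    have h1 := (hFG _ hm _ hx).2
    have h2 : ∀ y ∈ Ioo 0 B, IntervalIntegrable h volume 0 y := fun y hy =>
      hint.mono_set (by
        rw [uIcc_of_le hB.le, uIcc_of_le hy.1.le]; exact Icc_subset_Icc_right hy.2.le)
    have h3 := intervalIntegral.integral_interval_sub_left (h2 x hx) (h2 _ hm)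
    linarith
  set c := F (B / 2) * G (B / 2) - ∫ t in 0..(B / 2), h t with hc
  have hval : ∀ (l : Filter ℝ) [l.NeBot] (u : ℝ), Tendsto F l (𝓝 0) → Ioo 0 B ∈ l →
      Tendsto (fun x => ∫ t in 0..x, h t) l (𝓝 u) → c = 0 - u := by
    intro l _ u h1 h2 h3
    have h4 := (hlim l h1 h2).sub h3
    refine tendsto_nhds_unique (tendsto_const_nhds.congr' ?_) h4
    filter_upwards [h2] with x hx using (hconst x hx).symm
  have c0 := hval (𝓝[>] 0) 0 hF0 (Ioo_mem_nhdsGT hB) (by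
    have := (hprim 0 (left_mem_Icc.2 hB.le)).tendsto
    rw [intervalIntegral.integral_same] at this
    rw [← nhdsWithin_Ioo_eq_nhdsGT hB]
    exact this.mono_left (nhdsWithin_mono _ Ioo_subset_Icc_self))
  have cB := hval (𝓝[<] B) _ hFB (Ioo_mem_nhdsLT hB) (by
    have := (hprim B (right_mem_Icc.2 hB.le)).tendsto
    rw [← nhdsWithin_Ioo_eq_nhdsLT hB]
    exact this.mono_left (nhdsWithin_mono _ Ioo_subset_Icc_self))
  have hI : ∫ t in 0..B, h t = ∫ t in Ioo 0 B, h t := by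
    rw [intervalIntegral.integral_of_le hB.le, integral_Ioc_eq_integral_Ioo]
  rw [← hI]
  linarith

end OneVariable

end KawaharaBurgers

namespace KawaharaBurgers

/-! ## Weak derivatives and translations -/

section Shift

theorem exists_isCompact_segments_subset {E : Type*} [NormedAddCommGroup E] [NormedSpace ℝ E]
    {Ω K : Set E} {v : E} {a : ℝ}
    (hconv : Convex ℝ Ω) (hK : IsCompact K)
    (hK1 : K ⊆ Ω) (hK2 : ∀ p ∈ K, p + a • v ∈ Ω) :
    ∃ K' : Set E, IsCompact K' ∧ K' ⊆ Ω ∧ ∀ p ∈ K, ∀ s ∈ uIcc 0 a, p + s • v ∈ K' := by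
  refine ⟨(fun q : E × ℝ => q.1 + q.2 • v) '' (K ×ˢ uIcc 0 a),
    (hK.prod isCompact_uIcc).image (by fun_prop), ?_, fun p hp s hs => ⟨(p, s), ⟨hp, hs⟩, rfl⟩⟩
  rintro _ ⟨⟨p, s⟩, ⟨hp, hs⟩, rfl⟩
  have hseg : s ∈ segment ℝ 0 a := by rwa [segment_eq_uIcc]
  obtain ⟨α, β, hα, hβ, hαβ, rfl⟩ := hseg
  have := hconv (hK1 hp) (hK2 p hp) hα hβ hαβ
  convert! this using 1
  simp only [smul_eq_mul, mul_zero, zero_add, smul_add, smul_smul]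
  rw [← add_assoc, ← add_smul, hαβ, one_smul]

variable {E : Type*} [NormedAddCommGroup E] [NormedSpace ℝ E] [FiniteDimensional ℝ E]
  [MeasureSpace E] [BorelSpace E] [(volume : Measure E).IsAddHaarMeasure]

theorem integral_intervalIntegral_comm {E : Type*} [MeasureSpace E] [SFinite (volume : Measure E)]
    {H : E → ℝ → ℝ} {a : ℝ}
    (hH : Integrable (Function.uncurry H) (volume.prod (volume.restrict (uIoc 0 a)))) :
    ∫ p, ∫ s in 0..a, H p s = ∫ s in 0..a, ∫ p, H p s := by
  simp only [intervalIntegral.intervalIntegral_eq_integral_uIoc]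
  rw [integral_smul, integral_integral_swap hH]

instance (a b : ℝ) : IsFiniteMeasure (volume.restrict (uIoc a b)) := ⟨by simp [uIoc]⟩

/-- The shear `(s, p) ↦ (s, p + s • v)` preserves the product measure. -/
theorem integrable_comp_add_smul {g : E → ℝ} (hg : Integrable g) (v : E) (a : ℝ) :
    Integrable (fun q : E × ℝ => g (q.1 + q.2 • v))
      (volume.prod (volume.restrict (uIoc 0 a))) := by
  have hmp : MeasurePreserving (fun q : ℝ × E => (q.1, q.2 + q.1 • v))
      ((volume.restrict (uIoc 0 a)).prod volume) ((volume.restrict (uIoc 0 a)).prod volume) := by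
    refine (MeasurePreserving.id _).skew_product (g := fun s p => p + s • v) ?_ ?_
    · exact Continuous.measurable (by fun_prop)
    · exact ae_of_all _ fun s => (measurePreserving_add_right volume (s • v)).map_eq
  have h1 : Integrable (fun q : ℝ × E => g q.2) ((volume.restrict (uIoc 0 a)).prod volume) :=
    hg.comp_snd _
  exact (hmp.integrable_comp_of_integrable h1).swap

/-- Testing the weak derivative with the translates `φ(· - s • v)` and integrating in `s` from `0`
to `a` gives, by Fubini, the integrated form of the identity against `φ`. Convexity keeps the
segment from `p` to `p + a • v` inside `Ω`, which makes the translated test functions admissible. -/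
theorem HasWeakDeriv.ae_shift {Ω : Set E} (hΩ : IsOpen Ω) (hconv : Convex ℝ Ω) {v : E}
    {f g : E → ℝ} (h : HasWeakDeriv Ω [v] f g) (a : ℝ) :
    ∀ᵐ p : E, p ∈ Ω → p + a • v ∈ Ω →
      f (p + a • v) = f p + ∫ s in 0..a, g (p + s • v) := by
  obtain ⟨hf, hg, hw⟩ := h
  set Ω' := Ω ∩ (fun p => p + a • v) ⁻¹' Ω with hΩ'
  have hΩo : IsOpen Ω' := hΩ.inter (hΩ.preimage (by fun_prop))
  -- Local integrability only controls compact subsets of `Ω`. Truncating `f` and `g` to a compact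
  -- set that contains all segments starting in `K` makes them integrable on the whole space without
  -- changing the identity on `K`.
  have hcpt : ∀ K ⊆ Ω', IsCompact K → ∃ K' : Set E, IsCompact K' ∧ K' ⊆ Ω ∧
      ∀ p ∈ K, ∀ s ∈ uIcc 0 a, p + s • v ∈ K' := fun K hK hKc =>
    exists_isCompact_segments_subset hconv hKc (fun p hp => (hK hp).1)
      (fun p hp => (hK hp).2)
  have hint : ∀ {u : E → ℝ}, LocallyIntegrableOn u Ω → ∀ {K' : Set E}, IsCompact K' → K' ⊆ Ω →
      Integrable (K'.indicator u) := fun hu K' hK' hK'Ω =>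
    (integrable_indicator_iff hK'.measurableSet).2 (hu.integrableOn_compact_subset hK'Ω hK')
  have hswapI : ∀ {u : E → ℝ}, Integrable u → Integrable (fun p => ∫ s in 0..a, u (p + s • v)) := by
    intro u hu
    simp only [intervalIntegral.intervalIntegral_eq_integral_uIoc]
    exact (integrable_comp_add_smul hu v a).integral_prod_left.smul (if (0 : ℝ) ≤ a then (1 : ℝ) else -1)
  have hloc : LocallyIntegrableOn
      (fun p => f (p + a • v) - (f p + ∫ s in 0..a, g (p + s • v))) Ω' := by
    rw [locallyIntegrableOn_iff hΩo.isLocallyClosed]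
    intro K hKΩ hK
    obtain ⟨K', hK', hK'Ω, hKK'⟩ := hcpt K hKΩ hK
    have h1 := ((hint hf hK' hK'Ω).comp_add_right (a • v)).sub
      ((hint hf hK' hK'Ω).add (hswapI (hint hg hK' hK'Ω)))
    refine (h1.integrableOn (s := K)).congr_fun (fun p hp => ?_) hK.measurableSet
    have e0 : p ∈ K' := by simpa using hKK' p hp 0 left_mem_uIcc
    have e1 : p + a • v ∈ K' := hKK' p hp a right_mem_uIcc
    have e2 : ∫ s in 0..a, K'.indicator g (p + s • v) = ∫ s in 0..a, g (p + s • v) :=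
      intervalIntegral.integral_congr fun s hs => indicator_of_mem (hKK' p hp s hs) g
    simp [indicator_of_mem e0, indicator_of_mem e1, e2]
  have key : ∀ φ : E → ℝ, ContDiff ℝ ∞ φ → HasCompactSupport φ → tsupport φ ⊆ Ω' →
      ∫ p, φ p • (f (p + a • v) - (f p + ∫ s in 0..a, g (p + s • v))) = 0 := by
    intro φ hφ hφc hφs
    obtain ⟨K', hK', hK'Ω, hKK'⟩ := hcpt _ hφs hφc
    set f0 := K'.indicator f with hf0
    set g0 := K'.indicator g with hg0
    have hf0i : Integrable f0 := hint hf hK' hK'Ω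
    have hg0i : Integrable g0 := hint hg hK' hK'Ω
    have hφcont : Continuous φ := hφ.continuous
    obtain ⟨Cφ, hCφ⟩ := hφc.exists_bound_of_continuous hφcont
    have hd : Continuous (fun p => fderiv ℝ φ p v) :=
      (hφ.continuous_fderiv (by simp)).clm_apply continuous_const
    have hdc : HasCompactSupport (fun p => fderiv ℝ φ p v) := hφc.fderiv_apply ℝ v
    obtain ⟨Cd, hCd⟩ := hdc.exists_bound_of_continuous hd
    -- reduction to the truncated functions
    have hred : ∀ p, φ p • (f (p + a • v) - (f p + ∫ s in 0..a, g (p + s • v))) =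
        φ p * f0 (p + a • v) - φ p * f0 p - φ p * ∫ s in 0..a, g0 (p + s • v) := by
      intro p
      by_cases hp : p ∈ tsupport φ
      · have e0 : p ∈ K' := by simpa using hKK' p hp 0 left_mem_uIcc
        have e1 : p + a • v ∈ K' := hKK' p hp a right_mem_uIcc
        have e2 : ∫ s in 0..a, g0 (p + s • v) = ∫ s in 0..a, g (p + s • v) :=
          intervalIntegral.integral_congr fun s hs => indicator_of_mem (hKK' p hp s hs) g
        rw [e2, hf0, indicator_of_mem e0, indicator_of_mem e1, smul_eq_mul]
        ring
      · simp [image_eq_zero_of_notMem_tsupport hp]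
    simp only [hred]
    have i1 : Integrable (fun p => φ p * f0 (p + a • v)) :=
      (hf0i.comp_add_right (a • v)).bdd_mul hφcont.aestronglyMeasurable (ae_of_all _ hCφ)
    have i2 : Integrable (fun p => φ p * f0 p) :=
      hf0i.bdd_mul hφcont.aestronglyMeasurable (ae_of_all _ hCφ)
    have i3 : Integrable (fun p => φ p * ∫ s in 0..a, g0 (p + s • v)) :=
      (hswapI hg0i).bdd_mul hφcont.aestronglyMeasurable (ae_of_all _ hCφ)
    have i12 : Integrable (fun p => φ p * f0 (p + a • v) - φ p * f0 p) := i1.sub i2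
    rw [integral_sub i12 i3, integral_sub i1 i2]
    have t1 : ∫ p, φ p * f0 (p + a • v) = ∫ p, φ (p - a • v) * f0 p := by
      rw [← integral_add_right_eq_self (fun p => φ (p - a • v) * f0 p) (a • v)]
      simp
    -- the weak derivative tested with translates
    have hweak : ∀ s ∈ uIcc 0 a, ∫ p, φ (p - s • v) * g0 p =
        -∫ p, f0 p * fderiv ℝ φ (p - s • v) v := by
      intro s hs
      set ψ : E → ℝ := fun p => φ (p - s • v) with hψ
      have hψd : ContDiff ℝ ∞ ψ := hφ.comp (contDiff_id.sub contDiff_const)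
      have hψs : tsupport ψ ⊆ K' := by
        have hsup : Function.support ψ ⊆ (fun p => p + s • v) '' tsupport φ := by
          intro p hp
          exact ⟨p - s • v, subset_tsupport φ hp, by simp⟩
        have hc : IsCompact ((fun p => p + s • v) '' tsupport φ) :=
          IsCompact.image hφc (by fun_prop)
        refine (closure_minimal hsup hc.isClosed).trans ?_
        rintro _ ⟨q, hq, rfl⟩
        exact hKK' q hq s hs
      have hψc : HasCompactSupport ψ := HasCompactSupport.of_support_subset_isCompact hK'
        ((subset_tsupport ψ).trans hψs)
      have hψf : ∀ p, fderiv ℝ ψ p = fderiv ℝ φ (p - s • v) := fun p => by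
        rw [hψ, fderiv_comp_sub]
      have := hw ψ hψd hψc (hψs.trans hK'Ω)
      simp only [dirDeriv, List.length_singleton, pow_one, neg_mul, one_mul, hψf] at this
      have e1 : ∫ p in Ω, f p * fderiv ℝ φ (p - s • v) v =
          ∫ p, f0 p * fderiv ℝ φ (p - s • v) v := by
        rw [← integral_indicator hΩ.measurableSet]
        congr 1; ext p
        by_cases hp : p ∈ K'
        · rw [indicator_of_mem (hK'Ω hp), hf0, indicator_of_mem hp]
        · rw [hf0, indicator_of_notMem hp, zero_mul]
          have h0 : fderiv ℝ φ (p - s • v) v = 0 := by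
            rw [← hψf, image_eq_zero_of_notMem_tsupport
              (fun h => hp (hψs (tsupport_fderiv_subset ℝ h)))]
            rfl
          simp [h0]
      have e2 : ∫ p in Ω, g p * ψ p = ∫ p, φ (p - s • v) * g0 p := by
        rw [← integral_indicator hΩ.measurableSet]
        congr 1; ext p
        by_cases hp : p ∈ K'
        · rw [indicator_of_mem (hK'Ω hp), hg0, indicator_of_mem hp, mul_comm]
        · rw [hg0, indicator_of_notMem hp, mul_zero]
          have h0 : ψ p = 0 := image_eq_zero_of_notMem_tsupport (fun h => hp (hψs h))
          simp [h0]
      rw [e1, e2] at this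
      linarith
    have t2 : ∫ p, φ p * ∫ s in 0..a, g0 (p + s • v) =
        ∫ p, (φ (p - a • v) - φ p) * f0 p := by
      have j1 : Integrable (Function.uncurry fun p s => φ p * g0 (p + s • v))
          (volume.prod (volume.restrict (uIoc 0 a))) := by
        refine (integrable_comp_add_smul hg0i v a).bdd_mul (c := Cφ)
          (hφcont.comp continuous_fst).aestronglyMeasurable (ae_of_all _ fun q => hCφ q.1)
      have j2 : Integrable (Function.uncurry fun p s => f0 p * -fderiv ℝ φ (p - s • v) v)
          (volume.prod (volume.restrict (uIoc 0 a))) := by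
        have : Integrable (fun q : E × ℝ => f0 q.1) (volume.prod (volume.restrict (uIoc 0 a))) :=
          hf0i.comp_fst _
        refine this.mul_bdd (c := Cd) ?_ (ae_of_all _ fun q => ?_)
        · exact (hd.comp (f := fun q : E × ℝ => q.1 - q.2 • v)
            (by fun_prop)).neg.aestronglyMeasurable
        · rw [norm_neg]; exact hCd _
      calc ∫ p, φ p * ∫ s in 0..a, g0 (p + s • v)
          = ∫ p, ∫ s in 0..a, φ p * g0 (p + s • v) := by
            simp only [intervalIntegral.integral_const_mul]
        _ = ∫ s in 0..a, ∫ p, φ p * g0 (p + s • v) := integral_intervalIntegral_comm j1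
        _ = ∫ s in 0..a, ∫ p, f0 p * -fderiv ℝ φ (p - s • v) v := by
            refine intervalIntegral.integral_congr fun s hs => ?_
            have : ∫ p, φ p * g0 (p + s • v) = ∫ p, φ (p - s • v) * g0 p := by
              rw [← integral_add_right_eq_self (fun p => φ (p - s • v) * g0 p) (s • v)]
              simp
            simp only [this, hweak s hs, mul_neg, integral_neg]
        _ = ∫ p, ∫ s in 0..a, f0 p * -fderiv ℝ φ (p - s • v) v :=
            (integral_intervalIntegral_comm j2).symm
        _ = ∫ p, (φ (p - a • v) - φ p) * f0 p := by
            congr 1; ext p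
            rw [intervalIntegral.integral_const_mul, mul_comm]
            congr 1
            -- The integrand in `s` is an exact derivative, so the inner integral collapses to the
            -- difference of `φ` at the two ends.
            have hder : ∀ s ∈ uIcc 0 a, HasDerivAt (fun s : ℝ => φ (p - s • v))
                (-fderiv ℝ φ (p - s • v) v) s := by
              intro s _
              have h1 : HasDerivAt (fun s : ℝ => p - s • v) (-v) s := by
                simpa using ((hasDerivAt_id s).smul_const v).const_sub p
              have h2 := ((hφ.differentiable (by simp)) (p - s • v)).hasFDerivAt
              have h3 := h2.comp_hasDerivAt s h1
              rw [map_neg] at h3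
              exact h3
            rw [intervalIntegral.integral_eq_sub_of_hasDerivAt hder]
            · simp
            · exact (Continuous.neg (hd.comp (f := fun s : ℝ => p - s • v)
                (by fun_prop))).intervalIntegrable _ _
    have i4 : Integrable (fun p => φ (p - a • v) * f0 p) :=
      hf0i.bdd_mul (hφcont.comp (by fun_prop)).aestronglyMeasurable (ae_of_all _ fun p => hCφ _)
    rw [t1, t2]
    simp only [sub_mul]
    rw [integral_sub i4 i2]
    ring
  have := hΩo.ae_eq_zero_of_integral_contDiff_smul_eq_zero hloc key
  filter_upwards [this] with p hp h1 h2
  have := hp ⟨h1, h2⟩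
  linarith

theorem HasWeakDeriv.congr {E : Type*} [NormedAddCommGroup E] [NormedSpace ℝ E] [MeasureSpace E]
    {Ω : Set E} {L : List E} {f f' g g' : E → ℝ} (h : HasWeakDeriv Ω L f g)
    (hf : f =ᵐ[volume.restrict Ω] f') (hg : g =ᵐ[volume.restrict Ω] g') :
    HasWeakDeriv Ω L f' g' := by
  obtain ⟨h1, h2, h3⟩ := h
  refine ⟨h1.congr hf, h2.congr hg, fun φ hφ hc hs => ?_⟩
  have e1 : ∫ p in Ω, f' p * dirDeriv L φ p = ∫ p in Ω, f p * dirDeriv L φ p :=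
    integral_congr_ae (by filter_upwards [hf] with p hp; rw [hp])
  have e2 : ∫ p in Ω, g' p * φ p = ∫ p in Ω, g p * φ p :=
    integral_congr_ae (by filter_upwards [hg] with p hp; rw [hp])
  rw [e1, e2, h3 φ hφ hc hs]

/-! ### From weak derivatives to absolute continuity on almost every line -/

variable {Z : Type*} [MeasureSpace Z] [SigmaFinite (volume : Measure Z)]

/-- Joint measurability in the end points and the parameter makes the exceptional sets below
measurable, as is needed for exchanging almost everywhere quantifiers. -/
theorem measurable_intervalIntegral_comp {e : ℝ × Z → E} (he : Measurable e) {g : E → ℝ}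
    (hg : StronglyMeasurable g) :
    Measurable (fun q : (ℝ × ℝ) × Z => ∫ s in q.1.1..q.1.2, g (e (s, q.2))) := by
  simp only [intervalIntegral.intervalIntegral_eq_integral_uIoc, smul_eq_mul]
  refine Measurable.mul (Measurable.ite (measurableSet_le (f := fun q : (ℝ × ℝ) × Z => q.1.1)
    (g := fun q => q.1.2) (by fun_prop) (by fun_prop)) measurable_const measurable_const) ?_
  have h1 : MeasurableSet {p : ((ℝ × ℝ) × Z) × ℝ | p.2 ∈ uIoc p.1.1.1 p.1.1.2} := by
    have a1 : MeasurableSet {p : ((ℝ × ℝ) × Z) × ℝ | min p.1.1.1 p.1.1.2 < p.2} :=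
      measurableSet_lt (by fun_prop) (by fun_prop)
    have a2 : MeasurableSet {p : ((ℝ × ℝ) × Z) × ℝ | p.2 ≤ max p.1.1.1 p.1.1.2} :=
      measurableSet_le (by fun_prop) (by fun_prop)
    exact a1.inter a2
  have h2 : StronglyMeasurable (fun p : ((ℝ × ℝ) × Z) × ℝ => g (e (p.2, p.1.2))) :=
    hg.comp_measurable (he.comp (by fun_prop))
  have h3 := (h2.indicator h1).integral_prod_right' (ν := volume)
  convert! h3.measurable using 1
  ext q
  rw [← integral_indicator measurableSet_uIoc]
  rfl

/-- The shift identity holds for each `a` at almost every point. Fubini exchanges the quantifiers,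
so some base point `x₀` works for almost every line and almost every shift; the value at `x₀` is the
constant of integration `c`. -/
theorem HasWeakDeriv.exists_ae_eq_add_integral {Ω : Set E} (hΩ : IsOpen Ω) (hconv : Convex ℝ Ω)
    {v : E} {e : ℝ × Z → E} (he : MeasurePreserving e) (hev : ∀ x z a, e (x + a, z) = e (x, z) + a • v)
    {I : Set ℝ} {S : Set Z} (hI : MeasurableSet I) (hIc : I.OrdConnected) (hI0 : volume I ≠ 0) (hS : MeasurableSet S)
    (heΩ : e ⁻¹' Ω = I ×ˢ S) {f g : E → ℝ} (h : HasWeakDeriv Ω [v] f g) :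
    ∃ x₀ ∈ I, ∃ c : Z → ℝ, Measurable c ∧
      ∀ᵐ q ∂((volume.restrict I).prod (volume.restrict S)),
        f (e q) = c q.2 + ∫ s in x₀..q.1, g (e (s, q.2)) := by
  have hfm := h.1.aestronglyMeasurable
  have hgm := h.2.1.aestronglyMeasurable
  set f' := hfm.mk f with hf'
  set g' := hgm.mk g with hg'
  have hfs : StronglyMeasurable f' := hfm.stronglyMeasurable_mk
  have hgs : StronglyMeasurable g' := hgm.stronglyMeasurable_mk
  have h' : HasWeakDeriv Ω [v] f' g' := h.congr hfm.ae_eq_mk hgm.ae_eq_mk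
  -- Strongly measurable representatives are used because the quantifier exchange requires a
  -- measurable set.
  have hmeas : MeasurableSet {w : ℝ × (ℝ × Z) | w.2.1 ∈ I → w.2.2 ∈ S → w.2.1 + w.1 ∈ I →
      f' (e (w.2.1 + w.1, w.2.2)) =
        f' (e w.2) + ∫ s in w.2.1..w.2.1 + w.1, g' (e (s, w.2.2))} := by
    have m1 : MeasurableSet {w : ℝ × (ℝ × Z) | f' (e (w.2.1 + w.1, w.2.2)) =
        f' (e w.2) + ∫ s in w.2.1..w.2.1 + w.1, g' (e (s, w.2.2))} := by
      refine measurableSet_eq_fun ?_ (Measurable.add ?_ ?_)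
      · exact hfs.measurable.comp (he.measurable.comp (by fun_prop))
      · exact hfs.measurable.comp (he.measurable.comp (by fun_prop))
      · exact (measurable_intervalIntegral_comp he.measurable hgs).comp
          (g := (fun q : (ℝ × ℝ) × Z => ∫ s in q.1.1..q.1.2, g' (e (s, q.2))))
          (f := fun w : ℝ × (ℝ × Z) => ((w.2.1, w.2.1 + w.1), w.2.2)) (by fun_prop)
    have m2 : MeasurableSet {w : ℝ × (ℝ × Z) | w.2.1 ∈ I} := hI.preimage (by fun_prop)
    have m3 : MeasurableSet {w : ℝ × (ℝ × Z) | w.2.2 ∈ S} := hS.preimage (by fun_prop)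
    have m4 : MeasurableSet {w : ℝ × (ℝ × Z) | w.2.1 + w.1 ∈ I} :=
      hI.preimage (by fun_prop)
    exact m2.imp (m3.imp (m4.imp m1))
  have hmem : ∀ q : ℝ × Z, e q ∈ Ω ↔ q.1 ∈ I ∧ q.2 ∈ S := fun q => by
    rw [← mem_preimage, heΩ, mem_prod]
  have h1 : ∀ᵐ q : ℝ × Z, ∀ᵐ a : ℝ, q.1 ∈ I → q.2 ∈ S → q.1 + a ∈ I →
      f' (e (q.1 + a, q.2)) = f' (e q) + ∫ s in q.1..q.1 + a, g' (e (s, q.2)) := by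
    refine (Measure.ae_ae_comm (μ := (volume : Measure ℝ)) (ν := (volume : Measure (ℝ × Z)))
      (p := fun a q => q.1 ∈ I → q.2 ∈ S → q.1 + a ∈ I →
      f' (e (q.1 + a, q.2)) = f' (e q) + ∫ s in q.1..q.1 + a, g' (e (s, q.2))) hmeas).1 ?_
    refine ae_of_all _ fun a => ?_
    filter_upwards [he.quasiMeasurePreserving.ae (h'.ae_shift hΩ hconv a)] with q hq q1 q2 q3
    have h2 := hq ((hmem q).2 ⟨q1, q2⟩) (by
      rw [← Prod.mk.eta (p := q), ← hev]; exact (hmem _).2 ⟨q3, q2⟩)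
    rw [hev q.1 q.2 a, h2]
    congr 1
    have := intervalIntegral.integral_comp_add_left (fun s => g' (e (s, q.2))) q.1 (a := 0) (b := a)
    rw [add_zero] at this
    rw [← this]
    simp_rw [hev q.1 q.2]
  have h2 := Measure.ae_ae_of_ae_prod (μ := (volume : Measure ℝ)) (ν := (volume : Measure Z)) h1
  obtain ⟨x₀, hx₀, hx₀I⟩ : ∃ x₀, (∀ᵐ z : Z, ∀ᵐ a : ℝ, x₀ ∈ I → z ∈ S → x₀ + a ∈ I →
      f' (e (x₀ + a, z)) = f' (e (x₀, z)) + ∫ s in x₀..x₀ + a, g' (e (s, z))) ∧ x₀ ∈ I := by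
    have hne : (ae (volume.restrict I)).NeBot := by
      rwa [ae_neBot, Ne, Measure.restrict_eq_zero]
    exact ((ae_restrict_of_ae h2).and (ae_restrict_mem hI)).exists
  have h3 : ∀ᵐ z ∂(volume.restrict S), ∀ᵐ x ∂(volume.restrict I),
      f' (e (x, z)) = f' (e (x₀, z)) + ∫ s in x₀..x, g' (e (s, z)) := by
    filter_upwards [ae_restrict_of_ae hx₀, ae_restrict_mem hS] with z hz hzS
    rw [ae_restrict_iff' hI]
    have := (measurePreserving_sub_right (volume : Measure ℝ) x₀).quasiMeasurePreserving.ae hz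
    filter_upwards [this] with x hx hxI
    have hx' := hx hx₀I hzS (by simpa using hxI)
    simpa using hx'
  have heR : MeasurePreserving e ((volume.restrict I).prod (volume.restrict S))
      (volume.restrict Ω) := by
    rw [Measure.prod_restrict, ← heΩ]
    exact he.restrict_preimage hΩ.measurableSet
  have h4 : ∀ᵐ q ∂((volume.restrict I).prod (volume.restrict S)),
      f' (e q) = f' (e (x₀, q.2)) + ∫ s in x₀..q.1, g' (e (s, q.2)) := by
    have hm : MeasurableSet {w : Z × ℝ |
        f' (e (w.2, w.1)) = f' (e (x₀, w.1)) + ∫ s in x₀..w.2, g' (e (s, w.1))} := by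
      refine measurableSet_eq_fun ?_ (Measurable.add ?_ ?_)
      · exact hfs.measurable.comp (he.measurable.comp (by fun_prop))
      · exact hfs.measurable.comp (he.measurable.comp (by fun_prop))
      · exact (measurable_intervalIntegral_comp he.measurable hgs).comp
          (g := (fun q : (ℝ × ℝ) × Z => ∫ s in q.1.1..q.1.2, g' (e (s, q.2))))
          (f := fun w : Z × ℝ => ((x₀, w.2), w.1)) (by fun_prop)
    have := (Measure.ae_prod_iff_ae_ae hm).2 h3
    exact Measure.measurePreserving_swap.quasiMeasurePreserving.ae this
  have hf0 := heR.quasiMeasurePreserving.ae hfm.ae_eq_mk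
  have hg0 : ∀ᵐ q ∂((volume.restrict I).prod (volume.restrict S)), g (e q) = g' (e q) :=
    heR.quasiMeasurePreserving.ae hgm.ae_eq_mk
  have hg1 : ∀ᵐ z ∂(volume.restrict S), ∀ᵐ x ∂(volume.restrict I), g (e (x, z)) = g' (e (x, z)) :=
    Measure.ae_ae_of_ae_prod (Measure.measurePreserving_swap.quasiMeasurePreserving.ae hg0)
  have hg2 := Measure.quasiMeasurePreserving_snd (μ := volume.restrict I).ae hg1
  have hIm : ∀ᵐ q ∂((volume.restrict I).prod (volume.restrict S)), q.1 ∈ I :=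
    Measure.quasiMeasurePreserving_fst.ae (ae_restrict_mem hI)
  refine ⟨x₀, hx₀I, fun z => f' (e (x₀, z)), hfs.measurable.comp
    (he.measurable.comp (by fun_prop)), ?_⟩
  filter_upwards [h4, hf0, hg2, hIm] with q h1 h2 h3 h4
  rw [h2]
  refine h1.trans ?_
  congr 1
  exact (intervalIntegral.integral_congr_ae (ae_uIoc_of_ae_restrict hIc h3 hx₀I h4)).symm

/-- Integrability of `g` along the lines is what lets integrals based at `x₀` be subtracted, so that
the representation becomes a primitive between any two points of `I`. -/
theorem HasWeakDeriv.ae_hasACDeriv {Ω : Set E} (hΩ : IsOpen Ω) (hconv : Convex ℝ Ω)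
    {v : E} {e : ℝ × Z → E} (he : MeasurePreserving e)
    (hev : ∀ x z a, e (x + a, z) = e (x, z) + a • v)
    {I : Set ℝ} {S : Set Z} (hI : MeasurableSet I) (hIc : I.OrdConnected) (hI0 : volume I ≠ 0)
    (hS : MeasurableSet S) (heΩ : e ⁻¹' Ω = I ×ˢ S) {f g : E → ℝ} (h : HasWeakDeriv Ω [v] f g)
    (hg : ∀ᵐ z ∂(volume.restrict S), ∀ a ∈ I, ∀ b ∈ I,
      IntervalIntegrable (fun s => g (e (s, z))) volume a b) :
    ∀ᵐ z ∂(volume.restrict S), HasACDeriv I (fun x => f (e (x, z))) (fun x => g (e (x, z))) := by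
  obtain ⟨x₀, hx₀, c, -, hc⟩ := h.exists_ae_eq_add_integral hΩ hconv he hev hI hIc hI0 hS heΩ
  have h1 : ∀ᵐ z ∂(volume.restrict S), ∀ᵐ x ∂(volume.restrict I),
      f (e (x, z)) = c z + ∫ s in x₀..x, g (e (s, z)) :=
    Measure.ae_ae_of_ae_prod (Measure.measurePreserving_swap.quasiMeasurePreserving.ae hc)
  filter_upwards [h1, hg] with z hz hgz
  refine ⟨fun x => c z + ∫ s in x₀..x, g (e (s, z)), hz.mono fun x hx => hx.symm,
    fun a ha b hb => ⟨hgz a ha b hb, ?_⟩⟩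
  have := intervalIntegral.integral_interval_sub_left (hgz x₀ hx₀ b hb) (hgz x₀ hx₀ a ha)
  linarith

end Shift

end KawaharaBurgers

namespace KawaharaBurgers

/-! ## Algebra of weak derivatives -/

section WeakDeriv

variable {E : Type*} [NormedAddCommGroup E] [NormedSpace ℝ E]

theorem dirDeriv_append (L L' : List E) (φ : E → ℝ) :
    dirDeriv (L ++ L') φ = dirDeriv L (dirDeriv L' φ) := by
  induction L with
  | nil => rfl
  | cons v L ih => simp only [List.cons_append, dirDeriv, ih]

theorem contDiff_dirDeriv (L : List E) {φ : E → ℝ} (hφ : ContDiff ℝ ∞ φ) :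
    ContDiff ℝ ∞ (dirDeriv L φ) := by
  induction L with
  | nil => exact hφ
  | cons v L ih => exact (ih.fderiv_right (m := ∞) (by simp)).clm_apply contDiff_const

theorem tsupport_dirDeriv_subset (L : List E) (φ : E → ℝ) :
    tsupport (dirDeriv L φ) ⊆ tsupport φ := by
  induction L with
  | nil => exact subset_rfl
  | cons v L ih => exact (tsupport_fderiv_apply_subset ℝ v).trans ih

theorem dirDeriv_pair_comm {φ : E → ℝ} (hφ : ContDiff ℝ ∞ φ) (v w : E) :
    dirDeriv [v, w] φ = dirDeriv [w, v] φ := by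
  have h1 : ContDiff ℝ ∞ (fderiv ℝ φ) := hφ.fderiv_right (by simp)
  have key : ∀ v w : E, ∀ p, dirDeriv [v, w] φ p = fderiv ℝ (fderiv ℝ φ) p v w := by
    intro v w p
    have hd : DifferentiableAt ℝ (fderiv ℝ φ) p := (h1.differentiable (by simp)) p
    change fderiv ℝ (fun q => fderiv ℝ φ q w) p v = _
    rw [fderiv_clm_apply hd (differentiableAt_const w)]
    simp
  ext p
  rw [key, key]
  exact (hφ.contDiffAt.isSymmSndFDerivAt
    (by rw [minSmoothness_of_isRCLikeNormedField]; exact WithTop.coe_le_coe.2 le_top)) v w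

variable {Ω : Set E} {L : List E} {f f' g g' h : E → ℝ} {v w : E}

theorem test_dirDeriv (L : List E) {φ : E → ℝ} (h : HasCompactSupport φ ∧ tsupport φ ⊆ Ω) :
    HasCompactSupport (dirDeriv L φ) ∧ tsupport (dirDeriv L φ) ⊆ Ω :=
  ⟨h.1.of_isClosed_subset (isClosed_tsupport _) (tsupport_dirDeriv_subset L φ),
    (tsupport_dirDeriv_subset L φ).trans h.2⟩

variable [MeasureSpace E]

/-- The last vector of a list acts on the test function before the others, and `∂_v φ` is again a
test function. Hence on the side of `f` the derivatives along `L` are taken before the one along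
`v`. -/
theorem HasWeakDeriv.of_append (h1 : HasWeakDeriv Ω L f g) (h2 : HasWeakDeriv Ω (L ++ [v]) f h) :
    HasWeakDeriv Ω [v] g h := by
  refine ⟨h1.2.1, h2.2.1, fun φ hφ hc hs => ?_⟩
  have e1 := h1.2.2 _ (contDiff_dirDeriv [v] hφ) (test_dirDeriv [v] ⟨hc, hs⟩).1
    (test_dirDeriv [v] ⟨hc, hs⟩).2
  have e2 := h2.2.2 φ hφ hc hs
  rw [dirDeriv_append, e1, List.length_append, pow_add, mul_assoc] at e2
  exact mul_left_cancel₀ (pow_ne_zero _ (by norm_num)) e2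

theorem HasWeakDeriv.append (h1 : HasWeakDeriv Ω L f g) (h2 : HasWeakDeriv Ω [v] g h) :
    HasWeakDeriv Ω (L ++ [v]) f h := by
  refine ⟨h1.1, h2.2.1, fun φ hφ hc hs => ?_⟩
  rw [dirDeriv_append, h1.2.2 _ (contDiff_dirDeriv [v] hφ) (test_dirDeriv [v] ⟨hc, hs⟩).1
    (test_dirDeriv [v] ⟨hc, hs⟩).2, h2.2.2 φ hφ hc hs, List.length_append, pow_add, mul_assoc]

/-- Second derivatives of test functions commute. This supplies `∂ₓ(u_y)` when only `∂ᵧ(uₓ)` is at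
hand. -/
theorem HasWeakDeriv.swap (hv : HasWeakDeriv Ω [v] f g) (hw : HasWeakDeriv Ω [w] f g')
    (hvw : HasWeakDeriv Ω [w] g h) : HasWeakDeriv Ω [v] g' h := by
  refine HasWeakDeriv.of_append hw ⟨hv.1, hvw.2.1, fun φ hφ hc hs => ?_⟩
  have := (hv.append hvw).2.2 φ hφ hc hs
  simp only [List.cons_append, List.nil_append] at this ⊢
  rw [dirDeriv_pair_comm hφ, this]
  simp

theorem HasWeakDeriv.const_mul (c : ℝ) (h1 : HasWeakDeriv Ω L f g) :
    HasWeakDeriv Ω L (fun p => c * f p) (fun p => c * g p) := by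
  refine ⟨h1.1.smul c, h1.2.1.smul c, fun φ hφ hc hs => ?_⟩
  simp only [mul_assoc]
  rw [integral_const_mul, integral_const_mul, h1.2.2 φ hφ hc hs]
  ring

variable [OpensMeasurableSpace E]

theorem integrableOn_mul_test {E : Type*} [NormedAddCommGroup E] [MeasureSpace E]
    [OpensMeasurableSpace E] {Ω : Set E} {f : E → ℝ} (hf : LocallyIntegrableOn f Ω) {ψ : E → ℝ}
    (hψ : Continuous ψ) (hc : HasCompactSupport ψ) (hs : tsupport ψ ⊆ Ω) :
    IntegrableOn (fun p => f p * ψ p) Ω := by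
  have h1 : IntegrableOn f (tsupport ψ) := hf.integrableOn_compact_subset hs hc
  obtain ⟨C, hC⟩ := hc.exists_bound_of_continuous hψ
  have h2 : IntegrableOn (fun p => f p * ψ p) (tsupport ψ) :=
    h1.mul_bdd hψ.aestronglyMeasurable (ae_of_all _ hC)
  have h3 : Integrable (fun p => f p * ψ p) := by
    refine (integrableOn_iff_integrable_of_support_subset ?_).1 h2
    intro p hp
    exact subset_tsupport ψ (fun h0 => hp (by simp [h0]))
  exact h3.integrableOn

theorem HasWeakDeriv.add (h1 : HasWeakDeriv Ω L f g) (h2 : HasWeakDeriv Ω L f' g') :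
    HasWeakDeriv Ω L (fun p => f p + f' p) (fun p => g p + g' p) := by
  refine ⟨h1.1.add h2.1, h1.2.1.add h2.2.1, fun φ hφ hc hs => ?_⟩
  have hd := test_dirDeriv L ⟨hc, hs⟩
  have hdc := (contDiff_dirDeriv L hφ).continuous
  simp only [add_mul]
  rw [integral_add (integrableOn_mul_test h1.1 hdc hd.1 hd.2)
    (integrableOn_mul_test h2.1 hdc hd.1 hd.2),
    integral_add (integrableOn_mul_test h1.2.1 hφ.continuous hc hs)
    (integrableOn_mul_test h2.2.1 hφ.continuous hc hs), h1.2.2 φ hφ hc hs, h2.2.2 φ hφ hc hs]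
  ring

/-- With `a` smooth, `a φ` is an admissible test function, and expanding its derivative gives the
product rule. -/
theorem HasWeakDeriv.mul_smooth [FiniteDimensional ℝ E] (hΩ : IsOpen Ω) {a : E → ℝ}
    (ha : ContDiff ℝ ∞ a) (h1 : HasWeakDeriv Ω [v] f g) :
    HasWeakDeriv Ω [v] (fun p => a p * f p) (fun p => a p * g p + fderiv ℝ a p v * f p) := by
  have hda : Continuous (fun p => fderiv ℝ a p v) := (contDiff_dirDeriv [v] ha).continuous
  have hloc : ∀ {u k : E → ℝ}, LocallyIntegrableOn u Ω → Continuous k →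
      LocallyIntegrableOn (fun p => k p * u p) Ω := fun hu hk =>
    hu.continuousOn_mul hk.continuousOn hΩ.isLocallyClosed
  refine ⟨hloc h1.1 ha.continuous, (hloc h1.2.1 ha.continuous).add (hloc h1.1 hda),
    fun φ hφ hc hs => ?_⟩
  have hac : HasCompactSupport (fun p => a p * φ p) := hc.mul_left
  have has : tsupport (fun p => a p * φ p) ⊆ Ω := (tsupport_mul_subset_right).trans hs
  have had : ContDiff ℝ ∞ (fun p => a p * φ p) := ha.mul hφ
  have e1 := h1.2.2 _ had hac has
  have e2 : ∀ p, dirDeriv [v] (fun p => a p * φ p) p =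
      a p * dirDeriv [v] φ p + φ p * fderiv ℝ a p v := by
    intro p
    simp only [dirDeriv]
    rw [fderiv_fun_mul (ha.differentiable (by simp) p) (hφ.differentiable (by simp) p)]
    simp
  have hd := test_dirDeriv [v] ⟨hc, hs⟩
  have hdc := (contDiff_dirDeriv [v] hφ).continuous
  have i1 : IntegrableOn (fun p => f p * (a p * dirDeriv [v] φ p)) Ω :=
    integrableOn_mul_test h1.1 (ha.continuous.mul hdc) hd.1.mul_left
      (tsupport_mul_subset_right.trans hd.2)
  have i2 : IntegrableOn (fun p => f p * (φ p * fderiv ℝ a p v)) Ω :=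
    integrableOn_mul_test h1.1 (hφ.continuous.mul hda) hc.mul_right
      (tsupport_mul_subset_left.trans hs)
  have i3 : IntegrableOn (fun p => g p * (a p * φ p)) Ω :=
    integrableOn_mul_test h1.2.1 had.continuous hac has
  simp only [e2, mul_add] at e1
  rw [integral_add i1 i2] at e1
  have e3 : ∀ p, (a p * g p + fderiv ℝ a p v * f p) * φ p =
      g p * (a p * φ p) + f p * (φ p * fderiv ℝ a p v) := fun p => by ring
  have e4 : ∀ p, a p * f p * dirDeriv [v] φ p = f p * (a p * dirDeriv [v] φ p) := fun p => by ring
  simp only [e3, e4]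
  rw [integral_add i3 i2]
  simp only [List.length_singleton, pow_one] at e1 ⊢
  linarith

theorem HasWeakDeriv.sub (h1 : HasWeakDeriv Ω L f g) (h2 : HasWeakDeriv Ω L f' g') :
    HasWeakDeriv Ω L (fun p => f p - f' p) (fun p => g p - g' p) := by
  simpa [sub_eq_add_neg] using h1.add (h2.const_mul (-1))

theorem HasWeakDeriv.unique [BorelSpace E] [FiniteDimensional ℝ E] (hΩ : IsOpen Ω)
    (h1 : HasWeakDeriv Ω L f g) (h2 : HasWeakDeriv Ω L f g') : g =ᵐ[volume.restrict Ω] g' := by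
  have := hΩ.ae_eq_zero_of_integral_contDiff_smul_eq_zero (μ := volume) (h1.2.1.sub h2.2.1)
    (fun φ hφ hc hs => by
      have e1 := h1.2.2 φ hφ hc hs
      have e2 := h2.2.2 φ hφ hc hs
      rw [e1] at e2
      have e3 := mul_left_cancel₀ (pow_ne_zero _ (by norm_num)) e2
      have i1 := integrableOn_mul_test h1.2.1 hφ.continuous hc hs
      have i2 := integrableOn_mul_test h2.2.1 hφ.continuous hc hs
      rw [← setIntegral_eq_integral_of_forall_compl_eq_zero (s := Ω)]
      · have e4 : ∀ p, φ p • (g - g') p = g p * φ p - g' p * φ p := fun p => by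
          simp only [Pi.sub_apply, smul_eq_mul]; ring
        simp only [e4]
        rw [integral_sub i1 i2, e3, sub_self]
      · intro p hp
        rw [image_eq_zero_of_notMem_tsupport (fun h => hp (hs h)), zero_smul])
  rw [EventuallyEq, ae_restrict_iff' hΩ.measurableSet]
  filter_upwards [this] with p hp hpΩ
  have := hp hpΩ
  simpa [sub_eq_zero] using this

end WeakDeriv

end KawaharaBurgers

namespace KawaharaBurgers

/-! ## Measures on the strip and on the cylinder -/

/-- Lebesgue measure on the strip. -/
noncomputable abbrev stripMeasure (B : ℝ) : Measure (ℝ × ℝ) := volume.restrict (strip B)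

/-- Lebesgue measure on the cylinder. -/
noncomputable abbrev cylMeasure (B T : ℝ) : Measure ((ℝ × ℝ) × ℝ) := volume.restrict (cylinder B T)

theorem stripMeasure_eq (B : ℝ) :
    stripMeasure B = (volume : Measure ℝ).prod (volume.restrict (Ioo 0 B)) := by
  rw [stripMeasure, strip, Measure.volume_eq_prod, ← Measure.prod_restrict, Measure.restrict_univ]

theorem cylMeasure_eq (B T : ℝ) :
    cylMeasure B T = (stripMeasure B).prod (volume.restrict (Ioo 0 T)) := by
  rw [cylMeasure, cylinder, Measure.volume_eq_prod, ← Measure.prod_restrict]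

theorem isOpen_strip (B : ℝ) : IsOpen (strip B) := isOpen_univ.prod isOpen_Ioo

theorem isOpen_cylinder (B T : ℝ) : IsOpen (cylinder B T) := (isOpen_strip B).prod isOpen_Ioo

theorem convex_cylinder (B T : ℝ) : Convex ℝ (cylinder B T) :=
  (convex_univ.prod (convex_Ioo 0 B)).prod (convex_Ioo 0 T)

instance : (volume : Measure (ℝ × ℝ)).IsAddHaarMeasure := by
  rw [Measure.volume_eq_prod]; infer_instance

instance : (volume : Measure ((ℝ × ℝ) × ℝ)).IsAddHaarMeasure := by
  rw [Measure.volume_eq_prod]; infer_instance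

/-- Space-time parametrized with `x` as the first variable. -/
def ofX (q : ℝ × (ℝ × ℝ)) : (ℝ × ℝ) × ℝ := ((q.1, q.2.1), q.2.2)

/-- Space-time parametrized with `y` as the first variable. -/
def ofY (q : ℝ × (ℝ × ℝ)) : (ℝ × ℝ) × ℝ := ((q.2.1, q.1), q.2.2)

theorem measurePreserving_ofX : MeasurePreserving ofX :=
  (volume_preserving_prodAssoc (α₁ := ℝ) (β₁ := ℝ) (γ₁ := ℝ)).symm _

theorem measurePreserving_ofY : MeasurePreserving ofY := by
  have h1 : MeasurePreserving (Prod.map (Prod.swap : ℝ × ℝ → ℝ × ℝ) (id : ℝ → ℝ)) :=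
    Measure.measurePreserving_swap.prod (MeasurePreserving.id _)
  exact h1.comp measurePreserving_ofX

theorem measurePreserving_swap_time :
    MeasurePreserving (Prod.swap : ℝ × (ℝ × ℝ) → (ℝ × ℝ) × ℝ) :=
  Measure.measurePreserving_swap

theorem measurePreserving_ofX_cyl (B T : ℝ) : MeasurePreserving ofX
    ((volume : Measure ℝ).prod ((volume.restrict (Ioo 0 B)).prod (volume.restrict (Ioo 0 T))))
    (cylMeasure B T) := by
  have h := measurePreserving_ofX.restrict_preimage (isOpen_cylinder B T).measurableSet
  have e : ofX ⁻¹' cylinder B T = univ ×ˢ (Ioo 0 B ×ˢ Ioo 0 T) := by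
    ext q; simp [ofX, cylinder, strip]
  rw [e, Measure.volume_eq_prod, Measure.volume_eq_prod, ← Measure.prod_restrict,
    ← Measure.prod_restrict, Measure.restrict_univ] at h
  exact h

theorem measurePreserving_ofY_cyl (B T : ℝ) : MeasurePreserving ofY
    ((volume.restrict (Ioo 0 B)).prod ((volume : Measure ℝ).prod (volume.restrict (Ioo 0 T))))
    (cylMeasure B T) := by
  have h := measurePreserving_ofY.restrict_preimage (isOpen_cylinder B T).measurableSet
  have e : ofY ⁻¹' cylinder B T = Ioo 0 B ×ˢ (univ ×ˢ Ioo 0 T) := by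
    ext q; simp [ofY, cylinder, strip]
  rw [e, Measure.volume_eq_prod, Measure.volume_eq_prod, ← Measure.prod_restrict,
    ← Measure.prod_restrict, Measure.restrict_univ] at h
  exact h

/-! ### Slices of square integrable functions and mixed norms -/

section Slices

variable {α β : Type*} [MeasurableSpace α] [MeasurableSpace β] {μ : Measure α} {ν : Measure β}
  [SFinite μ] [SFinite ν]

theorem memLp_two_prod_left_ae {f : α × β → ℝ} (hf : MemLp f 2 (μ.prod ν)) :
    ∀ᵐ y ∂ν, MemLp (fun x => f (x, y)) 2 μ := by
  have h1 := hf.integrable_sq.prod_left_ae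
  have h2 := hf.1.prodMk_right
  filter_upwards [h1, h2] with y hy hy'
  exact (memLp_two_iff_integrable_sq hy').2 hy

theorem memLp_two_prod_right_ae {f : α × β → ℝ} (hf : MemLp f 2 (μ.prod ν)) :
    ∀ᵐ x ∂μ, MemLp (fun y => f (x, y)) 2 ν := by
  have h1 := hf.integrable_sq.prod_right_ae
  have h2 := hf.1.prodMk_left
  filter_upwards [h1, h2] with y hy hy'
  exact (memLp_two_iff_integrable_sq hy').2 hy

end Slices

variable {b B T : ℝ}

theorem eLpNorm_two_sq {α : Type*} [MeasurableSpace α] {μ : Measure α} (f : α → ℝ) :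
    eLpNorm f 2 μ ^ 2 = ∫⁻ x, ‖f x‖ₑ ^ 2 ∂μ := by
  rw [eLpNorm_eq_lintegral_rpow_enorm_toReal (by simp) (by simp), ← ENNReal.rpow_natCast,
    ← ENNReal.rpow_mul]
  simp

theorem MemLpL2.memLp_two {f : (ℝ × ℝ) × ℝ → ℝ} (hf : MemLpL2 B T 2 f) :
    MemLp f 2 (cylMeasure B T) := by
  refine ⟨hf.1, ?_⟩
  have h1 := ENNReal.pow_lt_top (n := 2) hf.2
  rw [eLpNorm_eq_lintegral_rpow_enorm_toReal (by simp) (by simp), ← ENNReal.rpow_natCast,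
    ← ENNReal.rpow_mul] at h1
  simp only [enorm_eq_self, ENNReal.toReal_ofNat, ENNReal.rpow_ofNat, Nat.cast_ofNat, one_div,
    ne_eq, OfNat.ofNat_ne_zero, not_false_eq_true, inv_mul_cancel₀, ENNReal.rpow_one,
    eLpNorm_two_sq] at h1
  have h2 : eLpNorm f 2 (cylMeasure B T) ^ 2 < ⊤ := by
    rw [eLpNorm_two_sq, cylMeasure_eq, lintegral_prod_symm]
    · exact h1
    · rw [← cylMeasure_eq]; exact (hf.1.enorm).pow_const 2
  exact (ENNReal.pow_lt_top_iff.1 h2).resolve_right two_ne_zero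

theorem MemLpL2.memLp_two_of_top {f : (ℝ × ℝ) × ℝ → ℝ} (hf : MemLpL2 B T ∞ f) :
    MemLp f 2 (cylMeasure B T) := by
  refine MemLpL2.memLp_two ⟨hf.1, ?_⟩
  have h2 := hf.2
  rw [eLpNorm_exponent_top] at h2
  rw [eLpNorm_lt_top_iff_lintegral_rpow_enorm_lt_top (by simp) (by simp)]
  calc _ ≤ ∫⁻ t in Ioo 0 T, (eLpNormEssSup (fun t : ℝ => eLpNorm (fun z : ℝ × ℝ => f (z, t)) 2
        (volume.restrict (strip B))) (volume.restrict (Ioo 0 T))) ^ (2 : ℝ) := by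
        refine lintegral_mono_ae ?_
        filter_upwards [enorm_ae_le_eLpNormEssSup (fun t : ℝ => eLpNorm (fun z : ℝ × ℝ => f (z, t))
          2 (volume.restrict (strip B))) (volume.restrict (Ioo 0 T))] with t ht
        simp only [ENNReal.toReal_ofNat]
        gcongr
    _ < ⊤ := by
        rw [lintegral_const]
        refine ENNReal.mul_lt_top (ENNReal.rpow_lt_top_of_nonneg (by norm_num) h2.ne) (by simp)

theorem MemLpL2.exists_bound {f : (ℝ × ℝ) × ℝ → ℝ} (hf : MemLpL2 B T ∞ f) :
    ∃ A : ℝ, 0 ≤ A ∧ ∀ᵐ t ∂(volume.restrict (Ioo 0 T)),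
      eLpNorm (fun z => f (z, t)) 2 (stripMeasure B) ≤ ENNReal.ofReal A := by
  have h2 := hf.2
  rw [eLpNorm_exponent_top] at h2
  refine ⟨(eLpNormEssSup (fun t : ℝ => eLpNorm (fun z : ℝ × ℝ => f (z, t)) 2
    (volume.restrict (strip B))) (volume.restrict (Ioo 0 T))).toReal, ENNReal.toReal_nonneg, ?_⟩
  filter_upwards [enorm_ae_le_eLpNormEssSup (fun t : ℝ => eLpNorm (fun z : ℝ × ℝ => f (z, t))
          2 (volume.restrict (strip B))) (volume.restrict (Ioo 0 T))] with t ht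
  rw [ENNReal.ofReal_toReal h2.ne]
  exact ht

/-! ## Functions with their derivatives -/

/-- A function together with the derivatives that occur in the energy identity. -/
structure Jet (α : Type*) where
  /-- the function -/
  f : α → ℝ
  /-- `∂ₓ` -/
  x1 : α → ℝ
  /-- `∂ₓ²` -/
  x2 : α → ℝ
  /-- `∂ₓ³` -/
  x3 : α → ℝ
  /-- `∂ₓ⁴` -/
  x4 : α → ℝ
  /-- `∂ₓ⁵` -/
  x5 : α → ℝ
  /-- `∂ᵧ` -/
  y : α → ℝ
  /-- `∂ₓ∂ᵧ` -/
  xy : α → ℝ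
  /-- `∂ₓ∂ᵧ²` -/
  xyy : α → ℝ

/-- The restriction of a space-time jet to a time. -/
def Jet.slice (J : Jet ((ℝ × ℝ) × ℝ)) (t : ℝ) : Jet (ℝ × ℝ) where
  f z := J.f (z, t)
  x1 z := J.x1 (z, t)
  x2 z := J.x2 (z, t)
  x3 z := J.x3 (z, t)
  x4 z := J.x4 (z, t)
  x5 z := J.x5 (z, t)
  y z := J.y (z, t)
  xy z := J.xy (z, t)
  xyy z := J.xyy (z, t)

/-- The difference of two jets. -/
def Jet.sub {α : Type*} (J K : Jet α) : Jet α where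
  f z := J.f z - K.f z
  x1 z := J.x1 z - K.x1 z
  x2 z := J.x2 z - K.x2 z
  x3 z := J.x3 z - K.x3 z
  x4 z := J.x4 z - K.x4 z
  x5 z := J.x5 z - K.x5 z
  y z := J.y z - K.y z
  xy z := J.xy z - K.xy z
  xyy z := J.xyy z - K.xyy z

/-- Square integrability on the strip with the weight `e^{2bx}`. -/
def WMemLp (b B : ℝ) (f : ℝ × ℝ → ℝ) : Prop :=
  MemLp (fun z => Real.exp (b * z.1) * f z) 2 (stripMeasure B)

/-- The regularity of a solution at a fixed time. -/
structure SliceRegular (b B : ℝ) (J : Jet (ℝ × ℝ)) : Prop where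
  memLp_f : MemLp J.f 2 (stripMeasure B)
  memLp_x1 : MemLp J.x1 2 (stripMeasure B)
  wf : WMemLp b B J.f
  wx1 : WMemLp b B J.x1
  wx2 : WMemLp b B J.x2
  wx3 : WMemLp b B J.x3
  wx4 : WMemLp b B J.x4
  wx5 : WMemLp b B J.x5
  wy : WMemLp b B J.y
  wxy : WMemLp b B J.xy
  wxyy : WMemLp b B J.xyy
  ac0 : ∀ᵐ y ∂(volume.restrict (Ioo 0 B)), HasACDeriv univ (fun x => J.f (x, y)) fun x => J.x1 (x, y)
  ac1 : ∀ᵐ y ∂(volume.restrict (Ioo 0 B)), HasACDeriv univ (fun x => J.x1 (x, y)) fun x => J.x2 (x, y)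
  ac2 : ∀ᵐ y ∂(volume.restrict (Ioo 0 B)), HasACDeriv univ (fun x => J.x2 (x, y)) fun x => J.x3 (x, y)
  ac3 : ∀ᵐ y ∂(volume.restrict (Ioo 0 B)), HasACDeriv univ (fun x => J.x3 (x, y)) fun x => J.x4 (x, y)
  ac4 : ∀ᵐ y ∂(volume.restrict (Ioo 0 B)), HasACDeriv univ (fun x => J.x4 (x, y)) fun x => J.x5 (x, y)
  acy : ∀ᵐ y ∂(volume.restrict (Ioo 0 B)), HasACDeriv univ (fun x => J.y (x, y)) fun x => J.xy (x, y)
  acf_y : ∀ᵐ x : ℝ, HasACDeriv (Ioo 0 B) (fun y => J.f (x, y)) fun y => J.y (x, y)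
  acxy_y : ∀ᵐ x : ℝ, HasACDeriv (Ioo 0 B) (fun y => J.xy (x, y)) fun y => J.xyy (x, y)
  ends : ∀ᵐ x : ℝ, VanishesAtEnds B fun y => J.f (x, y)

/-- The regularity of a solution in space-time. -/
structure CylRegular (b B T : ℝ) (J : Jet ((ℝ × ℝ) × ℝ)) (ut : (ℝ × ℝ) × ℝ → ℝ) : Prop where
  memLp_f : MemLp J.f 2 (cylMeasure B T)
  memLp_x1 : MemLp J.x1 2 (cylMeasure B T)
  wf : MemLp (weighted b J.f) 2 (cylMeasure B T)
  wx1 : MemLp (weighted b J.x1) 2 (cylMeasure B T)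
  wx2 : MemLp (weighted b J.x2) 2 (cylMeasure B T)
  wx3 : MemLp (weighted b J.x3) 2 (cylMeasure B T)
  wx4 : MemLp (weighted b J.x4) 2 (cylMeasure B T)
  wx5 : MemLp (weighted b J.x5) 2 (cylMeasure B T)
  wy : MemLp (weighted b J.y) 2 (cylMeasure B T)
  wxy : MemLp (weighted b J.xy) 2 (cylMeasure B T)
  wxyy : MemLp (weighted b J.xyy) 2 (cylMeasure B T)
  wt : MemLp (weighted b ut) 2 (cylMeasure B T)
  d0 : HasWeakDeriv (cylinder B T) [ex] J.f J.x1
  d1 : HasWeakDeriv (cylinder B T) [ex] J.x1 J.x2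
  d2 : HasWeakDeriv (cylinder B T) [ex] J.x2 J.x3
  d3 : HasWeakDeriv (cylinder B T) [ex] J.x3 J.x4
  d4 : HasWeakDeriv (cylinder B T) [ex] J.x4 J.x5
  dy : HasWeakDeriv (cylinder B T) [ex] J.y J.xy
  df_y : HasWeakDeriv (cylinder B T) [ey] J.f J.y
  dxy_y : HasWeakDeriv (cylinder B T) [ey] J.xy J.xyy
  dt : HasWeakDeriv (cylinder B T) [et] J.f ut
  boundary : ∀ᵐ t ∂(volume.restrict (Ioo 0 T)), VanishesOnBoundary B fun z => J.f (z, t)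

/-! ### From the cylinder to almost every time -/

theorem VanishesOnBoundary.ends {f : ℝ × ℝ → ℝ} (h : VanishesOnBoundary B f) :
    ∀ᵐ x : ℝ, VanishesAtEnds B fun y => f (x, y) := by
  obtain ⟨v, hvc, hvf, hv0⟩ := h
  change v =ᵐ[stripMeasure B] f at hvf
  rw [stripMeasure_eq] at hvf
  filter_upwards [Measure.ae_ae_of_ae_prod hvf] with x hx
  refine ⟨fun y => v (x, y), ?_, hx, (hv0 x).1, (hv0 x).2⟩
  exact hvc.comp (by fun_prop) fun y hy => ⟨mem_univ _, hy⟩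

/-- On bounded `x`-intervals the weight `e^{bx}` is bounded away from zero, so weighted square
integrability gives the integrability of `g` along lines that absolute continuity requires. -/
theorem ae_hasACDeriv_x (b : ℝ) {f g : (ℝ × ℝ) × ℝ → ℝ} (h : HasWeakDeriv (cylinder B T) [ex] f g)
    (hg : MemLp (weighted b g) 2 (cylMeasure B T)) :
    ∀ᵐ t ∂(volume.restrict (Ioo 0 T)), ∀ᵐ y ∂(volume.restrict (Ioo 0 B)),
      HasACDeriv univ (fun x => f ((x, y), t)) fun x => g ((x, y), t) := by
  have h1 := memLp_two_prod_left_ae (hg.comp_measurePreserving (measurePreserving_ofX_cyl B T))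
  have h2 := h.ae_hasACDeriv (isOpen_cylinder B T) (convex_cylinder B T) measurePreserving_ofX
    (by intro x z a; simp [ofX, ex]) (I := univ) (S := Ioo 0 B ×ˢ Ioo 0 T) MeasurableSet.univ
    ordConnected_univ (by simp) (measurableSet_Ioo.prod measurableSet_Ioo)
    (by ext q; simp [ofX, cylinder, strip]) (by
      rw [Measure.volume_eq_prod, ← Measure.prod_restrict]
      filter_upwards [h1] with z hz c _ d _
      have h3 : LocallyIntegrable (fun x => weighted b g (ofX (x, z))) :=
        hz.locallyIntegrable (by norm_num)
      have h4 : IntervalIntegrable (fun x => weighted b g (ofX (x, z))) volume c d :=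
        (h3.integrableOn_isCompact isCompact_uIcc).intervalIntegrable
      have h5 := h4.continuousOn_mul (g := fun x => Real.exp (-(b * x))) (by fun_prop)
      refine h5.congr (fun x _ => ?_)
      simp only [weighted, ofX]
      rw [← mul_assoc, ← Real.exp_add]; simp)
  rw [Measure.volume_eq_prod, ← Measure.prod_restrict] at h2
  exact Measure.ae_ae_of_ae_prod (Measure.measurePreserving_swap.quasiMeasurePreserving.ae h2)

theorem ae_hasACDeriv_y (b : ℝ) (hB : 0 < B) {f g : (ℝ × ℝ) × ℝ → ℝ}
    (h : HasWeakDeriv (cylinder B T) [ey] f g)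
    (hg : MemLp (weighted b g) 2 (cylMeasure B T)) :
    ∀ᵐ t ∂(volume.restrict (Ioo 0 T)), ∀ᵐ x : ℝ,
      HasACDeriv (Ioo 0 B) (fun y => f ((x, y), t)) fun y => g ((x, y), t) := by
  have h1 := memLp_two_prod_left_ae (hg.comp_measurePreserving (measurePreserving_ofY_cyl B T))
  have h2 := h.ae_hasACDeriv (isOpen_cylinder B T) (convex_cylinder B T) measurePreserving_ofY
    (by intro x z a; simp [ofY, ey]) (I := Ioo 0 B) (S := univ ×ˢ Ioo 0 T) measurableSet_Ioo
    ordConnected_Ioo (by simpa using hB) (MeasurableSet.univ.prod measurableSet_Ioo)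
    (by ext q; simp [ofY, cylinder, strip]) (by
      rw [Measure.volume_eq_prod, ← Measure.prod_restrict, Measure.restrict_univ]
      filter_upwards [h1] with z hz c hc d hd
      have h3 : IntegrableOn (fun y => weighted b g (ofY (y, z))) (Ioo 0 B) :=
        hz.integrable (by norm_num)
      have h4 : IntegrableOn (fun y => g (ofY (y, z))) (Ioo 0 B) := by
        refine (h3.const_mul (Real.exp (-(b * z.1)))).congr (ae_of_all _ fun y => ?_)
        simp only [weighted, ofY]
        rw [← mul_assoc, ← Real.exp_add]; simp
      exact (h4.mono_set (ordConnected_Ioo.uIcc_subset hc hd)).intervalIntegrable)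
  rw [Measure.volume_eq_prod, ← Measure.prod_restrict, Measure.restrict_univ] at h2
  exact Measure.ae_ae_of_ae_prod (Measure.measurePreserving_swap.quasiMeasurePreserving.ae h2)

theorem ae_wMemLp_slice {f : (ℝ × ℝ) × ℝ → ℝ} (hf : MemLp (weighted b f) 2 (cylMeasure B T)) :
    ∀ᵐ t ∂(volume.restrict (Ioo 0 T)), WMemLp b B fun z => f (z, t) := by
  rw [cylMeasure_eq] at hf
  exact memLp_two_prod_left_ae hf

theorem CylRegular.ae_slice {J : Jet ((ℝ × ℝ) × ℝ)} {ut : (ℝ × ℝ) × ℝ → ℝ} (hB : 0 < B)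
    (h : CylRegular b B T J ut) :
    ∀ᵐ t ∂(volume.restrict (Ioo 0 T)), SliceRegular b B (J.slice t) := by
  have hf := h.memLp_f
  have hx := h.memLp_x1
  rw [cylMeasure_eq] at hf hx
  filter_upwards [memLp_two_prod_left_ae hf, memLp_two_prod_left_ae hx, ae_wMemLp_slice h.wf,
    ae_wMemLp_slice h.wx1, ae_wMemLp_slice h.wx2, ae_wMemLp_slice h.wx3, ae_wMemLp_slice h.wx4,
    ae_wMemLp_slice h.wx5, ae_wMemLp_slice h.wy, ae_wMemLp_slice h.wxy, ae_wMemLp_slice h.wxyy,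
    ae_hasACDeriv_x b h.d0 h.wx1, ae_hasACDeriv_x b h.d1 h.wx2, ae_hasACDeriv_x b h.d2 h.wx3,
    ae_hasACDeriv_x b h.d3 h.wx4, ae_hasACDeriv_x b h.d4 h.wx5, ae_hasACDeriv_x b h.dy h.wxy,
    ae_hasACDeriv_y b hB h.df_y h.wy, ae_hasACDeriv_y b hB h.dxy_y h.wxyy, h.boundary]
    with t a1 a2 a3 a4 a5 a6 a7 a8 a9 a10 a11 a12 a13 a14 a15 a16 a17 a18 a19 a20
  exact ⟨a1, a2, a3, a4, a5, a6, a7, a8, a9, a10, a11, a12, a13, a14, a15, a16, a17, a18, a19,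
    a20.ends⟩

theorem VanishesOnBoundary.sub {f g : ℝ × ℝ → ℝ} (hf : VanishesOnBoundary B f)
    (hg : VanishesOnBoundary B g) : VanishesOnBoundary B fun z => f z - g z := by
  obtain ⟨v, hv1, hv2, hv3⟩ := hf
  obtain ⟨w, hw1, hw2, hw3⟩ := hg
  refine ⟨fun z => v z - w z, hv1.sub hw1, ?_, fun x => ?_⟩
  · filter_upwards [hv2, hw2] with z h1 h2; rw [h1, h2]
  · simp [hv3 x, hw3 x]

theorem memLp_weighted_sub {f g : (ℝ × ℝ) × ℝ → ℝ}
    (hf : MemLp (weighted b f) 2 (cylMeasure B T)) (hg : MemLp (weighted b g) 2 (cylMeasure B T)) :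
    MemLp (weighted b fun p => f p - g p) 2 (cylMeasure B T) := by
  have : weighted b (fun p => f p - g p) = weighted b f - weighted b g := by
    ext p; simp [weighted, mul_sub]
  rw [this]; exact hf.sub hg

theorem CylRegular.sub {J K : Jet ((ℝ × ℝ) × ℝ)} {ut vt : (ℝ × ℝ) × ℝ → ℝ}
    (h : CylRegular b B T J ut) (k : CylRegular b B T K vt) :
    CylRegular b B T (J.sub K) (fun p => ut p - vt p) where
  memLp_f := h.memLp_f.sub k.memLp_f
  memLp_x1 := h.memLp_x1.sub k.memLp_x1
  wf := memLp_weighted_sub h.wf k.wf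
  wx1 := memLp_weighted_sub h.wx1 k.wx1
  wx2 := memLp_weighted_sub h.wx2 k.wx2
  wx3 := memLp_weighted_sub h.wx3 k.wx3
  wx4 := memLp_weighted_sub h.wx4 k.wx4
  wx5 := memLp_weighted_sub h.wx5 k.wx5
  wy := memLp_weighted_sub h.wy k.wy
  wxy := memLp_weighted_sub h.wxy k.wxy
  wxyy := memLp_weighted_sub h.wxyy k.wxyy
  wt := memLp_weighted_sub h.wt k.wt
  d0 := h.d0.sub k.d0
  d1 := h.d1.sub k.d1
  d2 := h.d2.sub k.d2
  d3 := h.d3.sub k.d3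
  d4 := h.d4.sub k.d4
  dy := h.dy.sub k.dy
  df_y := h.df_y.sub k.df_y
  dxy_y := h.dxy_y.sub k.dxy_y
  dt := h.dt.sub k.dt
  boundary := by filter_upwards [h.boundary, k.boundary] with t h1 h2 using h1.sub h2

end KawaharaBurgers

namespace KawaharaBurgers

/-! ## Regularity of solutions -/

variable {b B T : ℝ}

theorem exp_neg_mul_weighted (b : ℝ) (f : (ℝ × ℝ) × ℝ → ℝ) (p : (ℝ × ℝ) × ℝ) :
    Real.exp (-b * p.1.1) * weighted b f p = f p := by
  rw [weighted, ← mul_assoc, ← Real.exp_add]; simp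

theorem weighted_exp_neg_mul (b : ℝ) (f : (ℝ × ℝ) × ℝ → ℝ) :
    weighted b (fun p => Real.exp (-b * p.1.1) * f p) = f := by
  ext p; rw [weighted, ← mul_assoc, ← Real.exp_add]; simp

theorem contDiff_exp_neg (b : ℝ) : ContDiff ℝ ∞ fun p : (ℝ × ℝ) × ℝ => Real.exp (-b * p.1.1) :=
  Real.contDiff_exp.comp (contDiff_const.mul (contDiff_fst.comp contDiff_fst))

theorem fderiv_exp_neg (b : ℝ) (p v : (ℝ × ℝ) × ℝ) :
    fderiv ℝ (fun p : (ℝ × ℝ) × ℝ => Real.exp (-b * p.1.1)) p v =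
      -b * v.1.1 * Real.exp (-b * p.1.1) := by
  have h1 : HasFDerivAt (fun p : (ℝ × ℝ) × ℝ => p.1.1)
      ((ContinuousLinearMap.fst ℝ ℝ ℝ).comp (ContinuousLinearMap.fst ℝ (ℝ × ℝ) ℝ)) p :=
    (hasFDerivAt_fst (p := p.1)).comp p hasFDerivAt_fst
  rw [((h1.const_mul (-b)).exp).fderiv]
  simp
  ring

theorem HasWeakDeriv.exp_neg_x {f g : (ℝ × ℝ) × ℝ → ℝ} (b : ℝ)
    (h : HasWeakDeriv (cylinder B T) [ex] f g) :
    HasWeakDeriv (cylinder B T) [ex] (fun p => Real.exp (-b * p.1.1) * f p)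
      (fun p => Real.exp (-b * p.1.1) * (g p - b * f p)) := by
  have := h.mul_smooth (isOpen_cylinder B T) (contDiff_exp_neg b)
  simp only [fderiv_exp_neg, ex, mul_one] at this
  convert! this using 2 with p
  ring

theorem HasWeakDeriv.exp_neg_y {f g : (ℝ × ℝ) × ℝ → ℝ} (b : ℝ)
    (h : HasWeakDeriv (cylinder B T) [ey] f g) :
    HasWeakDeriv (cylinder B T) [ey] (fun p => Real.exp (-b * p.1.1) * f p)
      (fun p => Real.exp (-b * p.1.1) * g p) := by
  have := h.mul_smooth (isOpen_cylinder B T) (contDiff_exp_neg b)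
  simp only [fderiv_exp_neg, ey, mul_zero, zero_mul, add_zero] at this
  exact this

theorem memLp_weighted_congr {f g : (ℝ × ℝ) × ℝ → ℝ} {k : (ℝ × ℝ) × ℝ → ℝ}
    (h : g =ᵐ[cylMeasure B T] f) (hf : weighted b f = k) (hk : MemLp k 2 (cylMeasure B T)) :
    MemLp (weighted b g) 2 (cylMeasure B T) := by
  refine (memLp_congr_ae ?_).1 hk
  filter_upwards [h] with p hp
  rw [← hf, weighted, weighted, hp]

/-- The regularity class controls derivatives of the products `e^{bx}u` and `e^{bx}uₓ`, while the
energy identity needs `e^{bx}` times derivatives of `u`. The product rule gives `e^{bx}∂ₓ = (∂ₓ -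
b)e^{bx}`, and uniqueness of weak derivatives identifies the result with the given ones. -/
theorem exists_cylRegular_jet {u ut ux uxx uxxx uxyy ux5 : (ℝ × ℝ) × ℝ → ℝ}
    (ht : HasWeakDeriv (cylinder B T) [et] u ut) (hx : HasWeakDeriv (cylinder B T) [ex] u ux)
    (hxx : HasWeakDeriv (cylinder B T) [ex, ex] u uxx)
    (hxxx : HasWeakDeriv (cylinder B T) [ex, ex, ex] u uxxx)
    (hxyy : HasWeakDeriv (cylinder B T) [ex, ey, ey] u uxyy)
    (hx5 : HasWeakDeriv (cylinder B T) [ex, ex, ex, ex, ex] u ux5)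
    (mu : MemLpL2 B T ∞ u) (mux : MemLpL2 B T 2 ux)
    (mwu : MemLpH B T ∞ 2 (weighted b u)) (mwux : MemLpH B T 2 3 (weighted b ux))
    (mwt : MemLpL2 B T ∞ (weighted b ut)) (mwx5 : MemLpH B T 2 1 (weighted b ux5))
    (hbd : ∀ᵐ t ∂(volume.restrict (Ioo 0 T)), VanishesOnBoundary B fun z => u (z, t)) :
    ∃ J : Jet ((ℝ × ℝ) × ℝ), CylRegular b B T J ut ∧
      J.f = u ∧ J.x1 = ux ∧ J.x2 = uxx ∧ J.x3 = uxxx ∧ J.xyy = uxyy ∧ J.x5 = ux5 := by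
  have hΩ := isOpen_cylinder B T
  obtain ⟨r1, hr1, mr1⟩ := mwu.2 0 1 (by norm_num)
  obtain ⟨p1, hp1, mp1⟩ := mwux.2 1 0 (by norm_num)
  obtain ⟨p2, hp2, mp2⟩ := mwux.2 2 0 (by norm_num)
  obtain ⟨p3, hp3, mp3⟩ := mwux.2 3 0 (by norm_num)
  obtain ⟨q1, hq1, mq1⟩ := mwux.2 0 1 (by norm_num)
  obtain ⟨q2, hq2, mq2⟩ := mwux.2 0 2 (by norm_num)
  have m0 := mwux.1.memLp_two
  have m1 := mp1.memLp_two
  have m2 := mp2.memLp_two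
  have m3 := mp3.memLp_two
  simp only [List.replicate, List.nil_append, List.append_nil] at hr1 hp1 hp2 hp3 hq1 hq2
  have d01 : HasWeakDeriv (cylinder B T) [ex] (weighted b ux) p1 := hp1
  have d12 : HasWeakDeriv (cylinder B T) [ex] p1 p2 := HasWeakDeriv.of_append (L := [ex]) hp1 hp2
  have d23 : HasWeakDeriv (cylinder B T) [ex] p2 p3 :=
    HasWeakDeriv.of_append (L := [ex, ex]) hp2 hp3
  have dq : HasWeakDeriv (cylinder B T) [ey] q1 q2 := HasWeakDeriv.of_append (L := [ey]) hq1 hq2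
  -- the derivatives without the weight
  have e0 : (fun p => Real.exp (-b * p.1.1) * weighted b ux p) = ux :=
    funext (exp_neg_mul_weighted b ux)
  have e0' : (fun p => Real.exp (-b * p.1.1) * weighted b u p) = u :=
    funext (exp_neg_mul_weighted b u)
  have f1 := d01.exp_neg_x b
  rw [e0] at f1
  have g1 : HasWeakDeriv (cylinder B T) [ex] ux uxx := HasWeakDeriv.of_append (L := [ex]) hx hxx
  have g2 : HasWeakDeriv (cylinder B T) [ex] uxx uxxx :=
    HasWeakDeriv.of_append (L := [ex, ex]) hxx hxxx
  have ae2 := g1.unique hΩ f1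
  have c1 : HasWeakDeriv (cylinder B T) [ex] (fun p => p1 p - b * weighted b ux p)
      (fun p => p2 p - b * p1 p) := d12.sub (d01.const_mul b)
  have c2 : HasWeakDeriv (cylinder B T) [ex] (fun p => p2 p - b * p1 p)
      (fun p => p3 p - b * p2 p) := d23.sub (d12.const_mul b)
  have c12 : HasWeakDeriv (cylinder B T) [ex]
      (fun p => p2 p - b * p1 p - b * (p1 p - b * weighted b ux p))
      (fun p => p3 p - b * p2 p - b * (p2 p - b * p1 p)) := c2.sub (c1.const_mul b)
  have f2 := c1.exp_neg_x b
  have ae3 := g2.unique hΩ (f2.congr ae2.symm (ae_eq_refl _))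
  have f3 := c12.exp_neg_x b
  have g3 := f3.congr ae3.symm (ae_eq_refl _)
  -- The fourth derivative is not among the given functions; it is built as `e^{-bx}(∂ₓ -
  -- b)³(e^{bx}uₓ)`.
  set x4 : (ℝ × ℝ) × ℝ → ℝ := fun p => Real.exp (-b * p.1.1) *
    (p3 p - b * p2 p - b * (p2 p - b * p1 p)
      - b * (p2 p - b * p1 p - b * (p1 p - b * weighted b ux p))) with hx4
  have g4 : HasWeakDeriv (cylinder B T) [ex] x4 ux5 :=
    HasWeakDeriv.of_append (L := [ex, ex, ex, ex])
      (HasWeakDeriv.append (L := [ex, ex, ex]) hxxx g3) hx5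
  have fy := hr1.exp_neg_y b
  rw [e0'] at fy
  have fxy := hq1.exp_neg_y b
  rw [e0] at fxy
  have fxyy := dq.exp_neg_y b
  have gxyy := HasWeakDeriv.of_append (L := [ex, ey]) (HasWeakDeriv.append (L := [ex]) hx fxy) hxyy
  have aexyy := gxyy.unique hΩ fxyy
  refine ⟨⟨u, ux, uxx, uxxx, x4, ux5, fun p => Real.exp (-b * p.1.1) * r1 p,
    fun p => Real.exp (-b * p.1.1) * q1 p, uxyy⟩, ?_, rfl, rfl, rfl, rfl, rfl, rfl⟩
  refine
  { memLp_f := mu.memLp_two_of_top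
    memLp_x1 := mux.memLp_two
    wf := mwu.1.memLp_two_of_top
    wx1 := m0
    wx2 := memLp_weighted_congr ae2 (weighted_exp_neg_mul b _) (m1.sub (m0.const_mul b))
    wx3 := memLp_weighted_congr ae3 (weighted_exp_neg_mul b _)
      ((m2.sub (m1.const_mul b)).sub ((m1.sub (m0.const_mul b)).const_mul b))
    wx4 := memLp_weighted_congr (ae_eq_refl _) (weighted_exp_neg_mul b _)
      (((m3.sub (m2.const_mul b)).sub ((m2.sub (m1.const_mul b)).const_mul b)).sub
        (((m2.sub (m1.const_mul b)).sub ((m1.sub (m0.const_mul b)).const_mul b)).const_mul b))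
    wx5 := mwx5.1.memLp_two
    wy := memLp_weighted_congr (ae_eq_refl _) (weighted_exp_neg_mul b _) mr1.memLp_two_of_top
    wxy := memLp_weighted_congr (ae_eq_refl _) (weighted_exp_neg_mul b _) mq1.memLp_two
    wxyy := memLp_weighted_congr aexyy (weighted_exp_neg_mul b _) mq2.memLp_two
    wt := mwt.memLp_two_of_top
    d0 := hx
    d1 := g1
    d2 := g2
    d3 := g3
    d4 := g4
    dy := hx.swap fy fxy
    df_y := fy
    dxy_y := gxyy
    dt := ht
    boundary := hbd }

theorem exp_mul_locallyIntegrableOn {f : ℝ × ℝ → ℝ} (hf : WMemLp b B f) :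
    LocallyIntegrableOn (fun z => Real.exp (b * z.1) * f z) (strip B) :=
  locallyIntegrableOn_of_locallyIntegrable_restrict (MemLp.locallyIntegrable hf (by norm_num))

/-- After multiplication by `e^{bx}` the nonlinear term is a product of the `L²` functions `u` and
`e^{bx}uₓ`, so the whole expression is locally integrable and smooth compactly supported test
functions suffice. -/
theorem ae_eq_zero_of_weak_equation {J : Jet (ℝ × ℝ)} {ut : ℝ × ℝ → ℝ}
    (hJ : SliceRegular b B J) (hut : WMemLp b B ut)
    (h : ∀ φ : ℝ × ℝ → ℝ, MemLp φ 2 (volume.restrict (strip B)) →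
      ∫ z in strip B, Real.exp (b * z.1) *
        (ut z - J.x2 z + J.x3 z + J.f z * J.x1 z + J.xyy z - J.x5 z) * φ z = 0) :
    ∀ᵐ z ∂(stripMeasure B), ut z - J.x2 z + J.x3 z + J.f z * J.x1 z + J.xyy z - J.x5 z = 0 := by
  have hΩ := isOpen_strip B
  have hloc : LocallyIntegrableOn (fun z => Real.exp (b * z.1) *
      (ut z - J.x2 z + J.x3 z + J.f z * J.x1 z + J.xyy z - J.x5 z)) (strip B) := by
    have h1 : LocallyIntegrableOn (fun z => J.f z * (Real.exp (b * z.1) * J.x1 z)) (strip B) :=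
      IntegrableOn.locallyIntegrableOn (MemLp.integrable_mul hJ.memLp_f hJ.wx1)
    have := (((((exp_mul_locallyIntegrableOn hut).sub (exp_mul_locallyIntegrableOn hJ.wx2)).add
      (exp_mul_locallyIntegrableOn hJ.wx3)).add h1).add (exp_mul_locallyIntegrableOn hJ.wxyy)).sub
      (exp_mul_locallyIntegrableOn hJ.wx5)
    refine this.congr (ae_of_all _ fun z => ?_)
    simp only [Pi.add_apply, Pi.sub_apply]
    ring
  have := hΩ.ae_eq_zero_of_integral_contDiff_smul_eq_zero hloc (fun φ hφ hc hs => by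
    have h1 := h φ (hφ.continuous.memLp_of_hasCompactSupport hc)
    rw [← setIntegral_eq_integral_of_forall_compl_eq_zero (s := strip B), ← h1]
    · simp only [smul_eq_mul, mul_comm (φ _)]
    · intro p hp
      rw [image_eq_zero_of_notMem_tsupport (fun h => hp (hs h)), zero_smul])
  rw [ae_restrict_iff' hΩ.measurableSet]
  filter_upwards [this] with z hz hzs
  exact (mul_eq_zero.1 (hz hzs)).resolve_left (Real.exp_ne_zero _)

theorem IsRegularSolution.exists_jet (hB : 0 < B) {u₀ : ℝ × ℝ → ℝ} {u : (ℝ × ℝ) × ℝ → ℝ}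
    (h : IsRegularSolution b B T u₀ u) :
    ∃ (J : Jet ((ℝ × ℝ) × ℝ)) (ut : (ℝ × ℝ) × ℝ → ℝ), CylRegular b B T J ut ∧ J.f = u ∧
      (∀ᵐ t ∂(volume.restrict (Ioo 0 T)), ∀ᵐ z ∂(stripMeasure B),
        ut (z, t) = J.x2 (z, t) - J.x3 (z, t) - J.f (z, t) * J.x1 (z, t) - J.xyy (z, t)
          + J.x5 (z, t)) := by
  obtain ⟨ut, ux, uxx, uxxx, uxyy, ux5, uxxt, ht, hx, hxx, hxxx, hxyy, hx5, -, mu, mux, mwu, -, -,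
    mwux, mwt, -, -, mwx5, heq, hbd, -⟩ := h
  obtain ⟨J, hJ, rfl, rfl, rfl, rfl, rfl, rfl⟩ :=
    exists_cylRegular_jet ht hx hxx hxxx hxyy hx5 mu mux mwu mwux mwt mwx5 hbd
  refine ⟨J, ut, hJ, rfl, ?_⟩
  filter_upwards [heq, hJ.ae_slice hB, ae_wMemLp_slice hJ.wt] with t h1 h2 h3
  filter_upwards [ae_eq_zero_of_weak_equation h2 h3 h1] with z hz
  simp only [Jet.slice] at hz
  linarith

end KawaharaBurgers

namespace KawaharaBurgers

/-! ## Integration by parts on the strip -/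

variable {b B : ℝ}

theorem integral_dx_eq_zero {Φ Φ' : ℝ × ℝ → ℝ} (h : Integrable Φ (stripMeasure B))
    (h' : Integrable Φ' (stripMeasure B))
    (hac : ∀ᵐ y ∂(volume.restrict (Ioo 0 B)),
      HasACDeriv univ (fun x => Φ (x, y)) fun x => Φ' (x, y)) :
    ∫ z, Φ' z ∂(stripMeasure B) = 0 := by
  rw [stripMeasure_eq] at h h' ⊢
  rw [integral_prod_symm _ h']
  refine integral_eq_zero_of_ae ?_
  filter_upwards [hac, h.prod_left_ae, h'.prod_left_ae] with y h1 h2 h3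
  exact h1.integral_eq_zero h2 h3

theorem WMemLp.aestronglyMeasurable {f : ℝ × ℝ → ℝ} (hf : WMemLp b B f) :
    AEStronglyMeasurable f (stripMeasure B) := by
  have h1 : AEStronglyMeasurable (fun z : ℝ × ℝ => Real.exp (-(b * z.1))) (stripMeasure B) :=
    Continuous.aestronglyMeasurable (by fun_prop)
  refine (h1.mul hf.1).congr (ae_of_all _ fun z => ?_)
  simp only [Pi.mul_apply]
  rw [← mul_assoc, ← Real.exp_add]; simp

theorem WMemLp.integrable_mul {f g : ℝ × ℝ → ℝ} (hf : WMemLp b B f) (hg : WMemLp b B g)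
    {r : ℝ → ℝ} (hr : Continuous r) {C : ℝ} (hC : ∀ x, |r x| ≤ C * Real.exp (2 * b * x)) :
    Integrable (fun z => r z.1 * (f z * g z)) (stripMeasure B) := by
  have h1 : Integrable (fun z : ℝ × ℝ => (Real.exp (b * z.1) * f z) * (Real.exp (b * z.1) * g z))
    (stripMeasure B) := MemLp.integrable_mul hf hg
  have hcont : Continuous fun z : ℝ × ℝ => r z.1 := by fun_prop
  refine (h1.norm.const_mul C).mono' (hcont.aestronglyMeasurable.mul
    (hf.aestronglyMeasurable.mul hg.aestronglyMeasurable)) (ae_of_all _ fun z => ?_)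
  have h2 : Real.exp (2 * b * z.1) = Real.exp (b * z.1) * Real.exp (b * z.1) := by
    rw [← Real.exp_add]; ring_nf
  rw [norm_mul, Real.norm_eq_abs, norm_mul, norm_mul, norm_mul, norm_mul,
    Real.norm_of_nonneg (Real.exp_pos _).le]
  calc |r z.1| * (‖f z‖ * ‖g z‖) ≤ (C * Real.exp (2 * b * z.1)) * (‖f z‖ * ‖g z‖) := by
        gcongr; exact hC _
    _ = _ := by rw [h2]; ring

/-- A weight with its derivatives, dominated by `e^{2bx}`. -/
structure IsEnergyWeight (b : ℝ) (ρ : ℕ → ℝ → ℝ) : Prop where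
  hasDerivAt : ∀ k x, k < 5 → HasDerivAt (ρ k) (ρ (k + 1) x) x
  continuous : ∀ k, Continuous (ρ k)
  bound : ∃ C, ∀ k x, k ≤ 5 → |ρ k x| ≤ C * Real.exp (2 * b * x)

/-- The weighted inner product. -/
noncomputable def winner (B : ℝ) (r : ℝ → ℝ) (f g : ℝ × ℝ → ℝ) : ℝ :=
  ∫ z, r z.1 * (f z * g z) ∂(stripMeasure B)

section Weight

variable {ρ : ℕ → ℝ → ℝ}

theorem IsEnergyWeight.integrable (hρ : IsEnergyWeight b ρ) {k : ℕ} (hk : k ≤ 5) {f g : ℝ × ℝ → ℝ}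
    (hf : WMemLp b B f) (hg : WMemLp b B g) :
    Integrable (fun z => ρ k z.1 * (f z * g z)) (stripMeasure B) := by
  obtain ⟨C, hC⟩ := hρ.bound
  exact hf.integrable_mul hg (hρ.continuous k) (hC k · hk)

theorem IsEnergyWeight.ibp (hρ : IsEnergyWeight b ρ) (k : ℕ) (hk : k < 5) {f f' g g' : ℝ × ℝ → ℝ}
    (hf : WMemLp b B f) (hf' : WMemLp b B f') (hg : WMemLp b B g) (hg' : WMemLp b B g')
    (hff' : ∀ᵐ y ∂(volume.restrict (Ioo 0 B)),
      HasACDeriv univ (fun x => f (x, y)) fun x => f' (x, y))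
    (hgg' : ∀ᵐ y ∂(volume.restrict (Ioo 0 B)),
      HasACDeriv univ (fun x => g (x, y)) fun x => g' (x, y)) :
    winner B (ρ (k + 1)) f g + winner B (ρ k) f' g + winner B (ρ k) f g' = 0 := by
  have i1 := hρ.integrable (Nat.succ_le_of_lt hk) hf hg
  have i2 := hρ.integrable hk.le hf' hg
  have i3 := hρ.integrable hk.le hf hg'
  have key := integral_dx_eq_zero (hρ.integrable hk.le hf hg) ((i1.add i2).add i3) (by
    filter_upwards [hff', hgg'] with y h1 h2
    refine ((HasACDeriv.of_hasDerivAt (hρ.hasDerivAt k · hk) (hρ.continuous (k + 1))).mul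
      ordConnected_univ (h1.mul ordConnected_univ h2)).congr ordConnected_univ (ae_eq_refl _)
      (ae_of_all _ fun x => ?_)
    simp only [Pi.add_apply]
    ring)
  rw [integral_add' (i1.add i2) i3, integral_add' i1 i2] at key
  exact key

theorem winner_comm (B : ℝ) (r : ℝ → ℝ) (f g : ℝ × ℝ → ℝ) : winner B r f g = winner B r g f := by
  simp only [winner, mul_comm (f _)]

theorem IsEnergyWeight.ibp_self (hρ : IsEnergyWeight b ρ) (k : ℕ) (hk : k < 5) {f f' : ℝ × ℝ → ℝ}
    (hf : WMemLp b B f) (hf' : WMemLp b B f')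
    (hff' : ∀ᵐ y ∂(volume.restrict (Ioo 0 B)),
      HasACDeriv univ (fun x => f (x, y)) fun x => f' (x, y)) :
    winner B (ρ (k + 1)) f f + 2 * winner B (ρ k) f f' = 0 := by
  have := hρ.ibp k hk hf hf' hf hf' hff' hff'
  rw [winner_comm B _ f' f] at this
  linarith

theorem WMemLp.ae_memLp_y {f : ℝ × ℝ → ℝ} (hf : WMemLp b B f) :
    ∀ᵐ x : ℝ, MemLp (fun y => f (x, y)) 2 (volume.restrict (Ioo 0 B)) := by
  rw [WMemLp, stripMeasure_eq] at hf
  filter_upwards [memLp_two_prod_right_ae hf] with x hx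
  refine (memLp_congr_ae (ae_of_all _ fun y => ?_)).1 (hx.const_mul (Real.exp (-(b * x))))
  rw [← mul_assoc, ← Real.exp_add]; simp

/-- The weight is constant along lines in the `y` direction, and a boundary condition on one factor
is enough. -/
theorem IsEnergyWeight.ibp_y (hB : 0 < B) (hρ : IsEnergyWeight b ρ) {f f' g g' : ℝ × ℝ → ℝ}
    (hf : WMemLp b B f) (hf' : WMemLp b B f') (hg : WMemLp b B g) (hg' : WMemLp b B g')
    (hff' : ∀ᵐ x : ℝ, HasACDeriv (Ioo 0 B) (fun y => f (x, y)) fun y => f' (x, y))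
    (hgg' : ∀ᵐ x : ℝ, HasACDeriv (Ioo 0 B) (fun y => g (x, y)) fun y => g' (x, y))
    (hends : ∀ᵐ x : ℝ, VanishesAtEnds B fun y => f (x, y)) :
    winner B (ρ 0) f' g + winner B (ρ 0) f g' = 0 := by
  have i2 := hρ.integrable (Nat.zero_le _) hf' hg
  have i3 := hρ.integrable (Nat.zero_le _) hf hg'
  rw [winner, winner, ← integral_add i2 i3]
  have i4 := i2.add i3
  rw [stripMeasure_eq] at i4 ⊢
  refine (integral_prod _ i4).trans (integral_eq_zero_of_ae ?_)
  filter_upwards [hff', hgg', hends, hf.ae_memLp_y, hf'.ae_memLp_y, hg.ae_memLp_y,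
    hg'.ae_memLp_y] with x h1 h2 h3 h4 h5 h6 h7
  have := h3.integral_eq_zero hB h1 h2 (h7.integrable (by norm_num))
    ((MemLp.integrable_mul h5 h6).add (MemLp.integrable_mul h4 h7))
  refine (integral_congr_ae (ae_of_all _ fun y => ?_)).trans
    ((integral_const_mul (ρ 0 x) _).trans (by rw [this, mul_zero]; rfl))
  simp only [Pi.add_apply]
  ring

/-- The energy identity for the linear part of the equation. -/
theorem SliceRegular.linear_energy (hB : 0 < B) (hρ : IsEnergyWeight b ρ) {J : Jet (ℝ × ℝ)}
    (hJ : SliceRegular b B J) :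
    2 * (winner B (ρ 0) J.f J.x2 - winner B (ρ 0) J.f J.x3 - winner B (ρ 0) J.f J.xyy
      + winner B (ρ 0) J.f J.x5) =
    -(2 * winner B (ρ 0) J.x1 J.x1 + 3 * winner B (ρ 1) J.x1 J.x1 - 5 * winner B (ρ 3) J.x1 J.x1)
      - 5 * winner B (ρ 1) J.x2 J.x2 - winner B (ρ 1) J.y J.y
      - (-winner B (ρ 2) J.f J.f - winner B (ρ 3) J.f J.f + winner B (ρ 5) J.f J.f) := by
  have a1 := hρ.ibp 0 (by norm_num) hJ.wf hJ.wx1 hJ.wx4 hJ.wx5 hJ.ac0 hJ.ac4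
  have a2 := hρ.ibp 0 (by norm_num) hJ.wx1 hJ.wx2 hJ.wx3 hJ.wx4 hJ.ac1 hJ.ac3
  have a3 := hρ.ibp_self 0 (by norm_num) hJ.wx2 hJ.wx3 hJ.ac2
  have a4 := hρ.ibp 1 (by norm_num) hJ.wf hJ.wx1 hJ.wx3 hJ.wx4 hJ.ac0 hJ.ac3
  have a5 := hρ.ibp 1 (by norm_num) hJ.wx1 hJ.wx2 hJ.wx2 hJ.wx3 hJ.ac1 hJ.ac2
  have a6 := hρ.ibp 2 (by norm_num) hJ.wf hJ.wx1 hJ.wx2 hJ.wx3 hJ.ac0 hJ.ac2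
  have a7 := hρ.ibp_self 2 (by norm_num) hJ.wx1 hJ.wx2 hJ.ac1
  have a8 := hρ.ibp 3 (by norm_num) hJ.wf hJ.wx1 hJ.wx1 hJ.wx2 hJ.ac0 hJ.ac1
  have a9 := hρ.ibp_self 4 (by norm_num) hJ.wf hJ.wx1 hJ.ac0
  have c1 := hρ.ibp 0 (by norm_num) hJ.wf hJ.wx1 hJ.wx2 hJ.wx3 hJ.ac0 hJ.ac2
  have c2 := hρ.ibp_self 0 (by norm_num) hJ.wx1 hJ.wx2 hJ.ac1
  have c3 := hρ.ibp 1 (by norm_num) hJ.wf hJ.wx1 hJ.wx1 hJ.wx2 hJ.ac0 hJ.ac1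
  have c4 := hρ.ibp_self 2 (by norm_num) hJ.wf hJ.wx1 hJ.ac0
  have d1 := hρ.ibp 0 (by norm_num) hJ.wf hJ.wx1 hJ.wx1 hJ.wx2 hJ.ac0 hJ.ac1
  have d2 := hρ.ibp_self 1 (by norm_num) hJ.wf hJ.wx1 hJ.ac0
  have e1 := hρ.ibp_y hB hJ.wf hJ.wy hJ.wxy hJ.wxyy hJ.acf_y hJ.acxy_y hJ.ends
  have e2 := hρ.ibp_self 0 (by norm_num) hJ.wy hJ.wxy hJ.acy
  simp only [Nat.reduceAdd] at *
  linarith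

end Weight

/-! ## The trilinear estimate -/

theorem lintegral_mul_le_sqrt {α : Type*} [MeasurableSpace α] {μ : Measure α} {f g : α → ℝ≥0∞}
    (hf : AEMeasurable f μ) (hg : AEMeasurable g μ) :
    ∫⁻ x, f x * g x ∂μ ≤
      (∫⁻ x, f x ^ 2 ∂μ) ^ (1 / 2 : ℝ) * (∫⁻ x, g x ^ 2 ∂μ) ^ (1 / 2 : ℝ) := by
  simpa using ENNReal.lintegral_mul_le_Lp_mul_Lq μ Real.HolderConjugate.two_two hf hg

theorem lintegral_enorm_mul_le {α : Type*} [MeasurableSpace α] {μ : Measure α} {f g : α → ℝ}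
    (hf : AEStronglyMeasurable f μ) (hg : AEStronglyMeasurable g μ) :
    ∫⁻ x, ‖f x‖ₑ * ‖g x‖ₑ ∂μ ≤ eLpNorm f 2 μ * eLpNorm g 2 μ := by
  refine (lintegral_mul_le_sqrt hf.enorm hg.enorm).trans_eq ?_
  rw [eLpNorm_eq_lintegral_rpow_enorm_toReal (by simp) (by simp),
    eLpNorm_eq_lintegral_rpow_enorm_toReal (by simp) (by simp)]
  simp

/-- An anisotropic estimate for a product of three functions on the strip. -/
theorem lintegral_trilinear_le (hB : 0 < B) {s v v' w w' : ℝ × ℝ → ℝ}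
    (hs : MemLp s 2 (stripMeasure B)) (hv : MemLp v 2 (stripMeasure B))
    (hv' : MemLp v' 2 (stripMeasure B)) (hw : MemLp w 2 (stripMeasure B))
    (hw' : MemLp w' 2 (stripMeasure B))
    (hvv' : ∀ᵐ x : ℝ, HasACDeriv (Ioo 0 B) (fun y => v (x, y)) fun y => v' (x, y))
    (hends : ∀ᵐ x : ℝ, VanishesAtEnds B fun y => v (x, y))
    (hww' : ∀ᵐ y ∂(volume.restrict (Ioo 0 B)),
      HasACDeriv univ (fun x => w (x, y)) fun x => w' (x, y)) :
    (∫⁻ z, ‖s z‖ₑ * ‖v z‖ₑ * ‖w z‖ₑ ∂(stripMeasure B)) ^ 2 ≤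
      eLpNorm s 2 (stripMeasure B) ^ 2 *
      ((2 * (eLpNorm v 2 (stripMeasure B) * eLpNorm v' 2 (stripMeasure B))) *
        (2 * (eLpNorm w 2 (stripMeasure B) * eLpNorm w' 2 (stripMeasure B)))) := by
  rw [stripMeasure_eq] at *
  set ν := volume.restrict (Ioo 0 B) with hν
  -- By the one-dimensional Agmon inequalities `v²` is at most `α(x)` and `w²` at most `γ(y)`. The
  -- variables separate, so `∫∫ α γ` factorizes.
  set α : ℝ → ℝ≥0∞ := fun x => 2 * ∫⁻ y, ‖v (x, y)‖ₑ * ‖v' (x, y)‖ₑ ∂ν with hα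
  set γ : ℝ → ℝ≥0∞ := fun y => 2 * ∫⁻ x, ‖w (x, y)‖ₑ * ‖w' (x, y)‖ₑ with hγ
  have hαm : AEMeasurable α volume :=
    ((hv.1.enorm.fun_mul hv'.1.enorm).lintegral_prod_right').const_mul _
  have hγm : AEMeasurable γ ν :=
    ((hw.1.enorm.fun_mul hw'.1.enorm).lintegral_prod_left').const_mul _
  have hsqrt : ∀ {a c : ℝ≥0∞}, a ^ 2 ≤ c → a ≤ c ^ (1 / 2 : ℝ) := fun {a c} h => by
    have := ENNReal.rpow_le_rpow h (by norm_num : (0 : ℝ) ≤ 1 / 2)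
    rw [← ENNReal.rpow_natCast, ← ENNReal.rpow_mul] at this
    simpa using this
  have h1 : ∀ᵐ x : ℝ, ∀ᵐ y ∂ν, ‖v (x, y)‖ₑ ≤ α x ^ (1 / 2 : ℝ) := by
    filter_upwards [hvv', hends] with x hx hx'
    filter_upwards [hx'.enorm_sq_le hB hx] with y hy using hsqrt hy
  have h2 : ∀ᵐ y ∂ν, ∀ᵐ x : ℝ, ‖w (x, y)‖ₑ ≤ γ y ^ (1 / 2 : ℝ) := by
    filter_upwards [hww', memLp_two_prod_left_ae hw] with y hy hy'
    filter_upwards [hy.enorm_sq_le hy'] with x hx using hsqrt hx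
  have mα : AEMeasurable (fun z : ℝ × ℝ => α z.1 ^ (1 / 2 : ℝ)) (volume.prod ν) :=
    (hαm.comp_quasiMeasurePreserving Measure.quasiMeasurePreserving_fst).pow_const _
  have mγ : AEMeasurable (fun z : ℝ × ℝ => γ z.2 ^ (1 / 2 : ℝ)) (volume.prod ν) :=
    (hγm.comp_quasiMeasurePreserving Measure.quasiMeasurePreserving_snd).pow_const _
  -- The two sup bounds are iterated almost everywhere statements in opposite orders. They are
  -- inserted one at a time, each with its own order of integration.
  have s1 : ∫⁻ z, ‖s z‖ₑ * ‖v z‖ₑ * ‖w z‖ₑ ∂(volume.prod ν) ≤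
      ∫⁻ z, ‖s z‖ₑ * α z.1 ^ (1 / 2 : ℝ) * ‖w z‖ₑ ∂(volume.prod ν) := by
    rw [lintegral_prod _ ((hs.1.enorm.fun_mul hv.1.enorm).fun_mul hw.1.enorm),
      lintegral_prod _ ((hs.1.enorm.fun_mul mα).fun_mul hw.1.enorm)]
    refine lintegral_mono_ae ?_
    filter_upwards [h1] with x hx
    refine lintegral_mono_ae ?_
    filter_upwards [hx] with y hy
    gcongr
  have s2 : ∫⁻ z, ‖s z‖ₑ * α z.1 ^ (1 / 2 : ℝ) * ‖w z‖ₑ ∂(volume.prod ν) ≤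
      ∫⁻ z, ‖s z‖ₑ * (α z.1 ^ (1 / 2 : ℝ) * γ z.2 ^ (1 / 2 : ℝ)) ∂(volume.prod ν) := by
    rw [lintegral_prod_symm _ ((hs.1.enorm.fun_mul mα).fun_mul hw.1.enorm),
      lintegral_prod_symm _ (hs.1.enorm.fun_mul (mα.fun_mul mγ))]
    refine lintegral_mono_ae ?_
    filter_upwards [h2] with y hy
    refine lintegral_mono_ae ?_
    filter_upwards [hy] with x hx
    rw [mul_assoc]
    gcongr
  have s3 := lintegral_mul_le_sqrt hs.1.enorm (mα.fun_mul mγ)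
  have hsq : ∀ c : ℝ≥0∞, (c ^ (1 / 2 : ℝ)) ^ 2 = c := fun c => by
    rw [← ENNReal.rpow_natCast, ← ENNReal.rpow_mul]; simp
  have s4 : ∫⁻ z : ℝ × ℝ, (α z.1 ^ (1 / 2 : ℝ) * γ z.2 ^ (1 / 2 : ℝ)) ^ 2 ∂(volume.prod ν) =
      (∫⁻ x, α x) * ∫⁻ y, γ y ∂ν := by
    simp only [mul_pow, hsq]
    exact lintegral_prod_mul hαm hγm
  have s5 : ∫⁻ x, α x ≤ 2 * (eLpNorm v 2 (volume.prod ν) * eLpNorm v' 2 (volume.prod ν)) := by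
    rw [hα, lintegral_const_mul' _ _ (by simp), ← lintegral_prod _ (hv.1.enorm.fun_mul hv'.1.enorm)]
    gcongr
    exact lintegral_enorm_mul_le hv.1 hv'.1
  have s6 : ∫⁻ y, γ y ∂ν ≤ 2 * (eLpNorm w 2 (volume.prod ν) * eLpNorm w' 2 (volume.prod ν)) := by
    rw [hγ, lintegral_const_mul' _ _ (by simp),
      ← lintegral_prod_symm _ (hw.1.enorm.fun_mul hw'.1.enorm)]
    gcongr
    exact lintegral_enorm_mul_le hw.1 hw'.1
  calc _ ≤ ((∫⁻ z, ‖s z‖ₑ ^ 2 ∂(volume.prod ν)) ^ (1 / 2 : ℝ) *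
        ((∫⁻ x, α x) * ∫⁻ y, γ y ∂ν) ^ (1 / 2 : ℝ)) ^ 2 := by
        gcongr
        rw [← s4]
        exact (s1.trans s2).trans s3
    _ = eLpNorm s 2 (volume.prod ν) ^ 2 * ((∫⁻ x, α x) * ∫⁻ y, γ y ∂ν) := by
        rw [mul_pow, hsq, hsq, eLpNorm_two_sq]
    _ ≤ _ := by gcongr

end KawaharaBurgers

namespace KawaharaBurgers

/-! ## The weights -/

variable {b : ℝ}

/-- The derivatives of `e^{2bx}`. -/
noncomputable def expWeight (b : ℝ) (k : ℕ) (x : ℝ) : ℝ := (2 * b) ^ k * Real.exp (2 * b * x)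

theorem isEnergyWeight_expWeight (b : ℝ) : IsEnergyWeight b (expWeight b) where
  hasDerivAt k x _ := by
    have h1 : HasDerivAt (fun x => Real.exp (2 * b * x)) (Real.exp (2 * b * x) * (2 * b)) x := by
      simpa using ((hasDerivAt_id x).const_mul (2 * b)).exp
    have := h1.const_mul ((2 * b) ^ k)
    convert! this using 1
    rw [expWeight]; ring
  continuous k := by unfold expWeight; fun_prop
  bound := by
    refine ⟨(1 + |2 * b|) ^ 5, fun k x hk => ?_⟩
    rw [expWeight, abs_mul, abs_pow, Real.abs_exp]
    gcongr
    calc |2 * b| ^ k ≤ (1 + |2 * b|) ^ k := by gcongr; linarith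
      _ ≤ (1 + |2 * b|) ^ 5 := by
        refine pow_le_pow_right₀ ?_ hk
        linarith [abs_nonneg (2 * b)]

/-- The derivatives of the logistic function as polynomials in its values. -/
noncomputable def logisticPoly : ℕ → ℝ → ℝ
  | 0, s => s
  | 1, s => s * (1 - s)
  | 2, s => s * (1 - s) * (1 - 2 * s)
  | 3, s => s * (1 - s) * (1 - 6 * s + 6 * s ^ 2)
  | 4, s => s * (1 - s) * ((1 - 2 * s) * (1 - 12 * s + 12 * s ^ 2))
  | 5, s => s * (1 - s) * (1 - 30 * s + 150 * s ^ 2 - 240 * s ^ 3 + 120 * s ^ 4)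
  | _, _ => 0

/-- The logistic function with slope `2b`, shifted to the left by `n`. -/
noncomputable def logistic (b : ℝ) (n : ℕ) (x : ℝ) : ℝ := Real.sigmoid (2 * b * (x + n))

/-- The derivatives of the logistic weight. -/
noncomputable def logisticWeight (b : ℝ) (n k : ℕ) (x : ℝ) : ℝ :=
  (2 * b) ^ k * logisticPoly k (logistic b n x)

theorem hasDerivAt_logistic (b : ℝ) (n : ℕ) (x : ℝ) :
    HasDerivAt (logistic b n) (2 * b * (logistic b n x * (1 - logistic b n x))) x := by
  have h1 : HasDerivAt (fun x : ℝ => 2 * b * (x + n)) (2 * b) x := by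
    simpa using ((hasDerivAt_id x).add_const (n : ℝ)).const_mul (2 * b)
  have := (Real.hasDerivAt_sigmoid (2 * b * (x + n))).comp x h1
  exact this.congr_deriv (mul_comm _ _)

theorem continuous_logistic (b : ℝ) (n : ℕ) : Continuous (logistic b n) :=
  continuous_iff_continuousAt.2 fun x => (hasDerivAt_logistic b n x).continuousAt

theorem logistic_pos (b : ℝ) (n : ℕ) (x : ℝ) : 0 < logistic b n x := Real.sigmoid_pos _

theorem logistic_lt_one (b : ℝ) (n : ℕ) (x : ℝ) : logistic b n x < 1 := Real.sigmoid_lt_one _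

/-- From `1 / (1 + e^{-z}) ≤ e^z`. The slope `2b` makes the logistic weight admissible for functions
that are square integrable against `e^{2bx}`; the factor depending on `n` enters no final bound. -/
theorem logistic_le (b : ℝ) (n : ℕ) (x : ℝ) :
    logistic b n x ≤ Real.exp (2 * b * n) * Real.exp (2 * b * x) := by
  rw [logistic, Real.sigmoid_def, ← Real.exp_add,
    inv_le_comm₀ (by positivity) (by positivity), ← Real.exp_neg]
  have : -(2 * b * n + 2 * b * x) = -(2 * b * (x + n)) := by ring
  rw [this]
  linarith

theorem continuous_logisticPoly (k : ℕ) : Continuous (logisticPoly k) := by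
  match k with
  | 0 | 1 | 2 | 3 | 4 | 5 => unfold logisticPoly; fun_prop
  | _ + 6 => unfold logisticPoly; fun_prop

/-- Since `σ' = σ(1-σ)`, differentiating a polynomial in `σ` multiplies its derivative by `σ(1-σ)`.
-/
theorem hasDerivAt_logisticPoly (k : ℕ) (hk : k < 5) (s : ℝ) :
    ∃ d, HasDerivAt (logisticPoly k) d s ∧ d * (s * (1 - s)) = logisticPoly (k + 1) s := by
  interval_cases k
  · exact ⟨1, hasDerivAt_id s, by simp [logisticPoly]⟩
  · refine ⟨1 - 2 * s, ?_, by simp only [logisticPoly]; ring⟩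
    convert! (hasDerivAt_id s).sub (hasDerivAt_pow 2 s) using 1
    · ext s; simp only [logisticPoly, id, Pi.sub_apply]; ring
    · simp
  · refine ⟨1 - 6 * s + 6 * s ^ 2, ?_, by simp only [logisticPoly]; ring⟩
    convert! ((hasDerivAt_id s).sub ((hasDerivAt_pow 2 s).const_mul 3)).add
      ((hasDerivAt_pow 3 s).const_mul 2) using 1
    · ext s; simp only [logisticPoly, id, Pi.sub_apply, Pi.add_apply]; ring
    · simp; ring
  · refine ⟨(1 - 2 * s) * (1 - 12 * s + 12 * s ^ 2), ?_, by simp only [logisticPoly]; ring⟩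
    convert! (((hasDerivAt_id s).sub ((hasDerivAt_pow 2 s).const_mul 7)).add
      ((hasDerivAt_pow 3 s).const_mul 12)).sub ((hasDerivAt_pow 4 s).const_mul 6) using 1
    · ext s; simp only [logisticPoly, id, Pi.sub_apply, Pi.add_apply]; ring
    · simp; ring
  · refine ⟨1 - 30 * s + 150 * s ^ 2 - 240 * s ^ 3 + 120 * s ^ 4, ?_, by
      simp only [logisticPoly]; ring⟩
    convert! ((((hasDerivAt_id s).sub ((hasDerivAt_pow 2 s).const_mul 15)).add
      ((hasDerivAt_pow 3 s).const_mul 50)).sub ((hasDerivAt_pow 4 s).const_mul 60)).add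
      ((hasDerivAt_pow 5 s).const_mul 24) using 1
    · ext s; simp only [logisticPoly, id, Pi.sub_apply, Pi.add_apply]; ring
    · simp; ring

/-- Every derivative carries the factor `s(1-s)`. The constant is `1 + 30 + 150 + 240 + 120`, the
sum of the absolute coefficients of the cofactor for `k = 5`, the largest case. -/
theorem abs_logisticPoly_le {s : ℝ} (h0 : 0 < s) (h1 : s < 1) {k : ℕ} (hk : 1 ≤ k) (hk5 : k ≤ 5) :
    |logisticPoly k s| ≤ 541 * (s * (1 - s)) := by
  have h2 : 0 ≤ s * (1 - s) := mul_nonneg h0.le (by linarith)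
  have p2 : s ^ 2 ≤ 1 := pow_le_one₀ h0.le h1.le
  have p3 : s ^ 3 ≤ 1 := pow_le_one₀ h0.le h1.le
  have p4 : s ^ 4 ≤ 1 := pow_le_one₀ h0.le h1.le
  have q2 : 0 ≤ s ^ 2 := by positivity
  have q3 : 0 ≤ s ^ 3 := by positivity
  have q4 : 0 ≤ s ^ 4 := by positivity
  have key : ∀ q : ℝ, |q| ≤ 541 → |s * (1 - s) * q| ≤ 541 * (s * (1 - s)) := fun q hq => by
    rw [abs_mul, abs_of_nonneg h2, mul_comm]
    gcongr
  interval_cases k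
  · simpa [logisticPoly] using key 1 (by norm_num)
  · exact key _ (abs_le.2 ⟨by linarith, by linarith⟩)
  · exact key _ (abs_le.2 ⟨by linarith, by linarith⟩)
  · refine key _ ?_
    have : (1 - 2 * s) * (1 - 12 * s + 12 * s ^ 2) = 1 - 14 * s + 36 * s ^ 2 - 24 * s ^ 3 := by ring
    rw [this]
    exact abs_le.2 ⟨by linarith, by linarith⟩
  · exact key _ (abs_le.2 ⟨by linarith, by linarith⟩)

theorem isEnergyWeight_logisticWeight (hb : 0 < b) (n : ℕ) :
    IsEnergyWeight b (logisticWeight b n) where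
  hasDerivAt k x hk := by
    obtain ⟨d, hd, hd'⟩ := hasDerivAt_logisticPoly k hk (logistic b n x)
    have := (hd.comp x (hasDerivAt_logistic b n x)).const_mul ((2 * b) ^ k)
    convert! this using 1
    rw [logisticWeight, ← hd']; ring
  continuous k := continuous_const.mul ((continuous_logisticPoly k).comp (continuous_logistic b n))
  bound := by
    refine ⟨(1 + 2 * b) ^ 5 * (541 * Real.exp (2 * b * n)), fun k x hk => ?_⟩
    have h0 := logistic_pos b n x
    have h1 := logistic_lt_one b n x
    have h2 : |logisticPoly k (logistic b n x)| ≤ 541 * logistic b n x := by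
      rcases Nat.eq_zero_or_pos k with rfl | hk1
      · rw [logisticPoly, abs_of_pos h0]; linarith
      · refine (abs_logisticPoly_le h0 h1 hk1 hk).trans ?_
        gcongr
        exact mul_le_of_le_one_right h0.le (by linarith)
    have h3 : (2 * b) ^ k ≤ (1 + 2 * b) ^ 5 :=
      calc (2 * b) ^ k ≤ (1 + 2 * b) ^ k := by gcongr; linarith
        _ ≤ (1 + 2 * b) ^ 5 := pow_le_pow_right₀ (by linarith) hk
    rw [logisticWeight, abs_mul, abs_of_nonneg (by positivity : 0 ≤ (2 * b) ^ k)]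
    calc (2 * b) ^ k * |logisticPoly k (logistic b n x)|
        ≤ (1 + 2 * b) ^ 5 * (541 * (Real.exp (2 * b * n) * Real.exp (2 * b * x))) := by
          gcongr
          exact h2.trans (by gcongr; exact logistic_le b n x)
      _ = _ := by ring

/-- The square root of the derivative of the logistic function. -/
noncomputable def bump (b : ℝ) (n : ℕ) (x : ℝ) : ℝ :=
  Real.sqrt (logistic b n x * (1 - logistic b n x))

theorem bump_sq (b : ℝ) (n : ℕ) (x : ℝ) :
    bump b n x ^ 2 = logistic b n x * (1 - logistic b n x) :=
  Real.sq_sqrt (mul_nonneg (logistic_pos b n x).le (by linarith [logistic_lt_one b n x]))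

theorem bump_pos (b : ℝ) (n : ℕ) (x : ℝ) : 0 < bump b n x :=
  Real.sqrt_pos.2 (mul_pos (logistic_pos b n x) (by linarith [logistic_lt_one b n x]))

theorem continuous_bump (b : ℝ) (n : ℕ) : Continuous (bump b n) :=
  Real.continuous_sqrt.comp ((continuous_logistic b n).mul
    (continuous_const.sub (continuous_logistic b n)))

theorem bump_le (b : ℝ) (n : ℕ) (x : ℝ) : bump b n x ≤ Real.exp (b * n) * Real.exp (b * x) := by
  rw [bump, ← Real.exp_add]
  refine Real.sqrt_le_iff.2 ⟨(Real.exp_pos _).le, ?_⟩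
  have h0 := logistic_pos b n x
  calc logistic b n x * (1 - logistic b n x) ≤ logistic b n x :=
        mul_le_of_le_one_right h0.le (by linarith)
    _ ≤ _ := logistic_le b n x
    _ = _ := by rw [← Real.exp_add, ← Real.exp_nat_mul]; ring_nf

/-- The logarithmic derivative `b(1-2σ)` is at most `b` in absolute value, just as for `e^{bx}`.
This makes `bump` an admissible multiplier in the trilinear estimate. -/
theorem hasDerivAt_bump (b : ℝ) (n : ℕ) (x : ℝ) :
    HasDerivAt (bump b n) (b * (1 - 2 * logistic b n x) * bump b n x) x := by
  have hpos := bump_pos b n x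
  have h1 := hasDerivAt_logistic b n x
  have h2 := (h1.mul (h1.const_sub 1)).sqrt (by
    have := bump_sq b n x
    simp only [Pi.mul_apply]
    rw [← this]; positivity)
  convert! h2 using 1
  have h3 := bump_sq b n x
  simp only [Pi.mul_apply]
  change _ = _ / (2 * bump b n x)
  rw [eq_div_iff (by positivity)]
  linear_combination (2 * b * (1 - 2 * logistic b n x)) * h3

theorem logisticWeight_one (b : ℝ) (n : ℕ) (x : ℝ) :
    logisticWeight b n 1 x = 2 * b * bump b n x ^ 2 := by
  rw [logisticWeight, bump_sq, logisticPoly, pow_one]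

/-- Through this the dissipation `2∫ρ uₓ²` controls the `uₓ` terms weighted with `bump²` that come
from the cubic integral. -/
theorem bump_sq_le (b : ℝ) (n : ℕ) (x : ℝ) : bump b n x ^ 2 ≤ logisticWeight b n 0 x := by
  rw [logisticWeight, bump_sq, logisticPoly, pow_zero, one_mul]
  exact mul_le_of_le_one_right (logistic_pos b n x).le (by linarith [logistic_pos b n x])

/-! ### Sign, size and limits of the logistic weight The combination equals `s(1-s)(6b - 40b³(1 - 6s
+ 6s²))` and `1 - 6s + 6s² ≤ 1` on `(0,1)`, so the condition for the exponential weight is again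
sufficient. -/

theorem logisticWeight_dissipative (hb : 0 < b) (hb' : 0 ≤ 6 * b - 40 * b ^ 3) (n : ℕ) (x : ℝ) :
    0 ≤ 3 * logisticWeight b n 1 x - 5 * logisticWeight b n 3 x := by
  have h0 := logistic_pos b n x
  have h1 := logistic_lt_one b n x
  simp only [logisticWeight, logisticPoly]
  set s := logistic b n x
  have h2 : 0 ≤ s * (1 - s) := mul_nonneg h0.le (by linarith)
  have h3 : 0 ≤ 6 * b - 40 * b ^ 3 * (1 - 6 * s + 6 * s ^ 2) := by
    have : 0 ≤ 40 * b ^ 3 * (6 * (s * (1 - s))) := by positivity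
    linarith
  have := mul_nonneg h2 h3
  linarith

/-- No zeroth-order term carries the weight itself, only its derivatives. Hence the whole error is
of size `bump²` and disappears as `n → ∞`. -/
theorem logisticWeight_lower_order (hb : 0 < b) (n : ℕ) (x : ℝ) :
    |-logisticWeight b n 2 x - logisticWeight b n 3 x + logisticWeight b n 5 x| ≤
      541 * ((2 * b) ^ 2 + (2 * b) ^ 3 + (2 * b) ^ 5) * bump b n x ^ 2 := by
  have h0 := logistic_pos b n x
  have h1 := logistic_lt_one b n x
  have key : ∀ k, 1 ≤ k → k ≤ 5 → |logisticWeight b n k x| ≤ (2 * b) ^ k * (541 * bump b n x ^ 2) := by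
    intro k hk hk5
    rw [logisticWeight, abs_mul, abs_of_nonneg (by positivity : 0 ≤ (2 * b) ^ k), bump_sq]
    gcongr
    exact abs_logisticPoly_le h0 h1 hk hk5
  have a2 := abs_le.1 (key 2 (by norm_num) (by norm_num))
  have a3 := abs_le.1 (key 3 (by norm_num) (by norm_num))
  have a5 := abs_le.1 (key 5 (by norm_num) (by norm_num))
  exact abs_le.2 ⟨by linarith, by linarith⟩

theorem tendsto_logistic (hb : 0 < b) (x : ℝ) :
    Tendsto (fun n : ℕ => logistic b n x) atTop (𝓝 1) := by
  refine Real.tendsto_sigmoid_atTop.comp ?_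
  exact (tendsto_atTop_add_const_left _ x tendsto_natCast_atTop_atTop).const_mul_atTop (by positivity)

theorem tendsto_bump_sq (hb : 0 < b) (x : ℝ) :
    Tendsto (fun n : ℕ => bump b n x ^ 2) atTop (𝓝 0) := by
  simp only [bump_sq]
  have := (tendsto_logistic hb x).mul ((tendsto_logistic hb x).const_sub 1)
  simpa using this

end KawaharaBurgers

namespace KawaharaBurgers

/-! ## Energy estimates at a fixed time -/

variable {b B : ℝ}

/-- The norm of `L²` of the strip, as a real number. -/
noncomputable def l2 (B : ℝ) (f : ℝ × ℝ → ℝ) : ℝ := (eLpNorm f 2 (stripMeasure B)).toReal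

theorem l2_nonneg (B : ℝ) (f : ℝ × ℝ → ℝ) : 0 ≤ l2 B f := ENNReal.toReal_nonneg

theorem l2_sq {f : ℝ × ℝ → ℝ} (hf : MemLp f 2 (stripMeasure B)) :
    l2 B f ^ 2 = ∫ z, f z ^ 2 ∂(stripMeasure B) := by
  rw [l2, ← ENNReal.toReal_pow, eLpNorm_two_sq,
    integral_eq_lintegral_of_nonneg_ae (ae_of_all _ fun z => sq_nonneg _) hf.integrable_sq.1]
  congr 2; ext z
  rw [← enorm_pow, Real.enorm_of_nonneg (sq_nonneg _)]

/-! ### Cubic integrals with a multiplier in `x` -/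

section Multiplier

variable {κ κ' : ℝ → ℝ} {C : ℝ}

theorem WMemLp.memLp_mul {f : ℝ × ℝ → ℝ} (hf : WMemLp b B f) (hκ : Continuous κ)
    (hC : ∀ x, |κ x| ≤ C * Real.exp (b * x)) : MemLp (fun z => κ z.1 * f z) 2 (stripMeasure B) := by
  have hc : Continuous fun z : ℝ × ℝ => κ z.1 := by fun_prop
  refine MemLp.of_le_mul (c := C) hf (hc.aestronglyMeasurable.mul hf.aestronglyMeasurable)
    (ae_of_all _ fun z => ?_)
  rw [norm_mul, norm_mul, Real.norm_of_nonneg (Real.exp_pos _).le, ← mul_assoc]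
  gcongr
  exact hC _

/-- The trilinear estimate with a multiplier `κ(x)`. -/
theorem SliceRegular.trilinear (hB : 0 < B) (hb : 0 < b) (hκ : ∀ x, HasDerivAt κ (κ' x) x)
    (hκ' : Continuous κ') (hκ0 : ∀ x, 0 ≤ κ x) (hκb : ∀ x, |κ' x| ≤ b * κ x)
    (hC : ∀ x, κ x ≤ C * Real.exp (b * x)) {J : Jet (ℝ × ℝ)} (hJ : SliceRegular b B J)
    {s f f' : ℝ × ℝ → ℝ} (hs : MemLp s 2 (stripMeasure B)) (hf : WMemLp b B f)
    (hf' : WMemLp b B f') (hff' : ∀ᵐ y ∂(volume.restrict (Ioo 0 B)),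
      HasACDeriv univ (fun x => f (x, y)) fun x => f' (x, y)) :
    Integrable (fun z => s z * (κ z.1 ^ 2 * (J.f z * f z))) (stripMeasure B) ∧
    (∫ z, |s z * (κ z.1 ^ 2 * (J.f z * f z))| ∂(stripMeasure B)) ^ 2 ≤
      4 * l2 B s ^ 2 * (l2 B (fun z => κ z.1 * J.f z) * l2 B (fun z => κ z.1 * J.y z) *
        (l2 B (fun z => κ z.1 * f z) *
          (l2 B (fun z => κ z.1 * f' z) + b * l2 B (fun z => κ z.1 * f z)))) := by
  have hκc : Continuous κ := continuous_iff_continuousAt.2 fun x => (hκ x).continuousAt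
  have hCa : ∀ x, |κ x| ≤ C * Real.exp (b * x) := fun x => by
    rw [abs_of_nonneg (hκ0 x)]; exact hC x
  have hCa' : ∀ x, |κ' x| ≤ (b * C) * Real.exp (b * x) := fun x =>
    (hκb x).trans (by rw [mul_assoc]; gcongr; exact hC x)
  have mv := hJ.wf.memLp_mul hκc hCa
  have mv' := hJ.wy.memLp_mul hκc hCa
  have mw := hf.memLp_mul hκc hCa
  have mw1 := hf.memLp_mul hκ' hCa'
  have mw2 := hf'.memLp_mul hκc hCa
  have mw' : MemLp (fun z => κ' z.1 * f z + κ z.1 * f' z) 2 (stripMeasure B) := mw1.add mw2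
  have key := lintegral_trilinear_le hB hs mv mv' mw mw'
    (by filter_upwards [hJ.acf_y] with x hx using hx.const_mul (κ x))
    (by
      filter_upwards [hJ.ends] with x hx
      obtain ⟨v, h1, h2, h3, h4⟩ := hx
      refine ⟨fun y => κ x * v y, h1.const_mul _, ?_, by simp [h3], by simp [h4]⟩
      filter_upwards [h2] with y hy; rw [hy])
    (by
      filter_upwards [hff'] with y hy
      exact (HasACDeriv.of_hasDerivAt hκ hκ').mul ordConnected_univ hy)
  -- The bound in `x` is applied to `κ f`; the condition `|κ'| ≤ b κ` returns the extra product-rule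
  -- term to the norm of `κ f`.
  have hw'le : eLpNorm (fun z => κ' z.1 * f z + κ z.1 * f' z) 2 (stripMeasure B) ≤
      eLpNorm (fun z => κ z.1 * f' z) 2 (stripMeasure B) +
        ENNReal.ofReal b * eLpNorm (fun z => κ z.1 * f z) 2 (stripMeasure B) := by
    rw [add_comm]
    refine (eLpNorm_add_le mw1.1 mw2.1 (by norm_num)).trans ?_
    gcongr
    refine eLpNorm_le_mul_eLpNorm_of_ae_le_mul (ae_of_all _ fun z => ?_) 2
    rw [norm_mul, norm_mul, Real.norm_of_nonneg (hκ0 _), ← mul_assoc]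
    gcongr
    exact hκb _
  have e1 : ∀ z, ‖s z‖ₑ * ‖κ z.1 * J.f z‖ₑ * ‖κ z.1 * f z‖ₑ =
      ‖s z * (κ z.1 ^ 2 * (J.f z * f z))‖ₑ := fun z => by
    rw [← enorm_mul, ← enorm_mul]; congr 1; ring
  simp only [e1] at key
  have key2 := key.trans (mul_le_mul_right (mul_le_mul_right (mul_le_mul_right
    (mul_le_mul_right hw'le _) _) _) _)
  have hfin : eLpNorm s 2 (stripMeasure B) ^ 2 *
      (2 * (eLpNorm (fun z => κ z.1 * J.f z) 2 (stripMeasure B) *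
        eLpNorm (fun z => κ z.1 * J.y z) 2 (stripMeasure B)) *
      (2 * (eLpNorm (fun z => κ z.1 * f z) 2 (stripMeasure B) *
        (eLpNorm (fun z => κ z.1 * f' z) 2 (stripMeasure B) +
        ENNReal.ofReal b * eLpNorm (fun z => κ z.1 * f z) 2 (stripMeasure B))))) ≠ ⊤ := by
    have := hs.eLpNorm_ne_top
    have := mv.eLpNorm_ne_top
    have := mv'.eLpNorm_ne_top
    have := mw.eLpNorm_ne_top
    have := mw2.eLpNorm_ne_top
    finiteness
  have hlfin : ∫⁻ z, ‖s z * (κ z.1 ^ 2 * (J.f z * f z))‖ₑ ∂(stripMeasure B) ≠ ⊤ := fun h => by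
    rw [h] at key2
    exact hfin (top_le_iff.1 (by simpa using key2))
  have hmeas : AEStronglyMeasurable (fun z => s z * (κ z.1 ^ 2 * (J.f z * f z)))
      (stripMeasure B) := by
    have hc : Continuous fun z : ℝ × ℝ => κ z.1 ^ 2 := by fun_prop
    exact hs.1.mul (hc.aestronglyMeasurable.mul
      (hJ.wf.aestronglyMeasurable.mul hf.aestronglyMeasurable))
  refine ⟨⟨hmeas, lt_top_iff_ne_top.2 hlfin⟩, ?_⟩
  have e2 : ∫ z, |s z * (κ z.1 ^ 2 * (J.f z * f z))| ∂(stripMeasure B) =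
      (∫⁻ z, ‖s z * (κ z.1 ^ 2 * (J.f z * f z))‖ₑ ∂(stripMeasure B)).toReal := by
    rw [← integral_norm_eq_lintegral_enorm hmeas]; rfl
  rw [e2, ← ENNReal.toReal_pow]
  have := ENNReal.toReal_mono hfin key2
  refine this.trans_eq ?_
  have f1 := mw2.eLpNorm_ne_top
  have f2 : ENNReal.ofReal b * eLpNorm (fun z => κ z.1 * f z) 2 (stripMeasure B) ≠ ⊤ :=
    ENNReal.mul_ne_top ENNReal.ofReal_ne_top mw.eLpNorm_ne_top
  simp only [ENNReal.toReal_mul, ENNReal.toReal_pow, ENNReal.toReal_add f1 f2,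
    ENNReal.toReal_ofReal hb.le, ENNReal.toReal_ofNat, l2]
  ring

end Multiplier

theorem SliceRegular.trilinear_exp (hB : 0 < B) (hb : 0 < b) {J : Jet (ℝ × ℝ)}
    (hJ : SliceRegular b B J) {s f f' : ℝ × ℝ → ℝ} (hs : MemLp s 2 (stripMeasure B))
    (hf : WMemLp b B f) (hf' : WMemLp b B f') (hff' : ∀ᵐ y ∂(volume.restrict (Ioo 0 B)),
      HasACDeriv univ (fun x => f (x, y)) fun x => f' (x, y)) :
    Integrable (fun z => s z * (Real.exp (b * z.1) ^ 2 * (J.f z * f z))) (stripMeasure B) ∧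
    (∫ z, |s z * (Real.exp (b * z.1) ^ 2 * (J.f z * f z))| ∂(stripMeasure B)) ^ 2 ≤
      4 * l2 B s ^ 2 * (l2 B (fun z => Real.exp (b * z.1) * J.f z) *
        l2 B (fun z => Real.exp (b * z.1) * J.y z) * (l2 B (fun z => Real.exp (b * z.1) * f z) *
          (l2 B (fun z => Real.exp (b * z.1) * f' z)
            + b * l2 B (fun z => Real.exp (b * z.1) * f z)))) :=
  SliceRegular.trilinear (κ := fun x => Real.exp (b * x)) (κ' := fun x => b * Real.exp (b * x))
    (C := 1) hB hb (fun x => by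
      have := ((hasDerivAt_id x).const_mul b).exp
      simpa [mul_comm] using this) (by fun_prop) (fun x => (Real.exp_pos _).le)
    (fun x => by rw [abs_of_nonneg (by positivity)]) (fun x => by simp) hJ hs hf hf' hff'

section Weight

variable {ρ : ℕ → ℝ → ℝ}

theorem IsEnergyWeight.integrable_triple (hρ : IsEnergyWeight b ρ) (hB : 0 < B) (hb : 0 < b)
    {J : Jet (ℝ × ℝ)} (hJ : SliceRegular b B J) {s f f' : ℝ × ℝ → ℝ}
    (hs : MemLp s 2 (stripMeasure B)) (hf : WMemLp b B f) (hf' : WMemLp b B f')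
    (hff' : ∀ᵐ y ∂(volume.restrict (Ioo 0 B)),
      HasACDeriv univ (fun x => f (x, y)) fun x => f' (x, y)) {k : ℕ} (hk : k ≤ 5) :
    Integrable (fun z => ρ k z.1 * (s z * (J.f z * f z))) (stripMeasure B) := by
  obtain ⟨C, hC⟩ := hρ.bound
  have h1 := (hJ.trilinear_exp hB hb hs hf hf' hff').1
  have hc : Continuous fun z : ℝ × ℝ => ρ k z.1 := (hρ.continuous k).comp continuous_fst
  refine (h1.norm.const_mul C).mono' (hc.aestronglyMeasurable.mul (hs.1.mul
    (hJ.wf.aestronglyMeasurable.mul hf.aestronglyMeasurable))) (ae_of_all _ fun z => ?_)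
  have h2 : Real.exp (b * z.1) ^ 2 = Real.exp (2 * b * z.1) := by
    rw [← Real.exp_nat_mul]; ring_nf
  rw [h2, norm_mul, norm_mul, norm_mul (s z), norm_mul (Real.exp _),
    Real.norm_of_nonneg (Real.exp_pos _).le]
  calc ‖ρ k z.1‖ * (‖s z‖ * ‖J.f z * f z‖)
      ≤ (C * Real.exp (2 * b * z.1)) * (‖s z‖ * ‖J.f z * f z‖) := by gcongr; exact hC k _ hk
    _ = _ := by ring

/-- Integration by parts in the nonlinear term. -/
theorem IsEnergyWeight.ibp_triple (hρ : IsEnergyWeight b ρ) (hB : 0 < B) (hb : 0 < b)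
    {J : Jet (ℝ × ℝ)} (hJ : SliceRegular b B J) {s s' : ℝ × ℝ → ℝ}
    (hs : MemLp s 2 (stripMeasure B)) (hs' : MemLp s' 2 (stripMeasure B))
    (hss' : ∀ᵐ y ∂(volume.restrict (Ioo 0 B)),
      HasACDeriv univ (fun x => s (x, y)) fun x => s' (x, y)) :
    ∫ z, ρ 1 z.1 * (s z * (J.f z * J.f z)) ∂(stripMeasure B) +
      ∫ z, ρ 0 z.1 * (s' z * (J.f z * J.f z)) ∂(stripMeasure B) +
      2 * ∫ z, ρ 0 z.1 * (s z * (J.f z * J.x1 z)) ∂(stripMeasure B) = 0 := by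
  have i0 := hρ.integrable_triple hB hb hJ hs hJ.wf hJ.wx1 hJ.ac0 (k := 0) (by norm_num)
  have i1 := hρ.integrable_triple hB hb hJ hs hJ.wf hJ.wx1 hJ.ac0 (k := 1) (by norm_num)
  have i2 := hρ.integrable_triple hB hb hJ hs' hJ.wf hJ.wx1 hJ.ac0 (k := 0) (by norm_num)
  have i3 := (hρ.integrable_triple hB hb hJ hs hJ.wx1 hJ.wx2 hJ.ac1 (k := 0)
    (by norm_num)).const_mul 2
  have key := integral_dx_eq_zero i0 ((i1.add i2).add i3) (by
    filter_upwards [hss', hJ.ac0] with y h1 h2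
    refine ((HasACDeriv.of_hasDerivAt (hρ.hasDerivAt 0 · (by norm_num)) (hρ.continuous 1)).mul
      ordConnected_univ (h1.mul ordConnected_univ (h2.mul ordConnected_univ h2))).congr
      ordConnected_univ (ae_eq_refl _) (ae_of_all _ fun x => ?_)
    simp only [Pi.add_apply]
    ring)
  rw [integral_add' (i1.add i2) i3, integral_add' i1 i2, integral_const_mul] at key
  exact key

end Weight

/-! ### Absorption inequalities -/

theorem two_mul_le_of_sq_le_mul {X p q θ : ℝ} (hθ : 0 < θ) (hp : 0 ≤ p) (hq : 0 ≤ q)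
    (h : X ^ 2 ≤ p * q) : 2 * X ≤ θ * p + q / θ := by
  refine le_of_abs_le (abs_le_of_sq_le_sq ?_ (by positivity))
  have h2 : (θ * p + q / θ) ^ 2 = (θ * p - q / θ) ^ 2 + 4 * (p * q) := by
    field_simp; ring
  rw [h2]
  nlinarith [sq_nonneg (θ * p - q / θ)]

/-- Here `A` bounds the `L²` norm of the coefficient, and `a`, `β`, `δ` stand for the weighted norms
of the function, its `x`-derivative and its `y`-derivative. The Young parameter `1 + b` works
because `b / (1 + b)` is at most both `1` and `b`. -/
theorem absorb_cubic {b A X a β δ : ℝ} (hb : 0 < b) (hβ : 0 ≤ β) (ha : 0 ≤ a) (hδ : 0 ≤ δ)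
    (h : X ^ 2 ≤ 4 * A ^ 2 * (a * δ * (a * (β + b * a)))) :
    2 * b * X ≤ β ^ 2 + b * δ ^ 2 + (4 * A ^ 2 * b * (1 + b) + b ^ 3) * a ^ 2 := by
  have h1 := two_mul_le_of_sq_le_mul (θ := 1 + b) (p := 4 * A ^ 2 * a ^ 2) (q := δ * (β + b * a))
    (by positivity) (by positivity) (by positivity) (h.trans_eq (by ring))
  have h2 : δ * (β + b * a) ≤ δ ^ 2 + β ^ 2 + b ^ 2 * a ^ 2 := by
    nlinarith [sq_nonneg (δ - (β + b * a)), sq_nonneg (β - b * a), sq_nonneg δ]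
  have h3 : b * (δ * (β + b * a) / (1 + b)) ≤ β ^ 2 + b * δ ^ 2 + b ^ 3 * a ^ 2 := by
    rw [← mul_div_assoc, div_le_iff₀ (by positivity)]
    calc b * (δ * (β + b * a)) ≤ b * (δ ^ 2 + β ^ 2 + b ^ 2 * a ^ 2) := by gcongr
      _ ≤ _ := by
        have : 0 ≤ β ^ 2 + b ^ 2 * δ ^ 2 + b ^ 4 * a ^ 2 := by positivity
        nlinarith
  calc 2 * b * X = b * (2 * X) := by ring
    _ ≤ b * ((1 + b) * (4 * A ^ 2 * a ^ 2) + δ * (β + b * a) / (1 + b)) := by gcongr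
    _ ≤ _ := by linarith

/-- The letters are as before, with `γ` for the second `x`-derivative. The parameter `θ` is at least
`1 + b`, to absorb `bβ²`, and satisfies `bθ ≥ 1`, to absorb `βγ` into `β²` and `bγ²`; a second Young
inequality separates `a` from `δ`. -/
theorem absorb_transport {b A Y a β γ δ : ℝ} (hb : 0 < b) (hβ : 0 ≤ β) (hγ : 0 ≤ γ) (ha : 0 ≤ a)
    (hδ : 0 ≤ δ) (h : Y ^ 2 ≤ 4 * A ^ 2 * (a * δ * (β * (γ + b * β)))) :
    Y ≤ β ^ 2 + 10 * b * γ ^ 2 + b * δ ^ 2 + (1 + b + 1 / b) ^ 2 * A ^ 4 / b * a ^ 2 := by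
  set θ := 1 + b + 1 / b with hθ
  have hθ0 : 0 < θ := by positivity
  have h1 := two_mul_le_of_sq_le_mul (θ := θ) (p := 4 * A ^ 2 * (a * δ)) (q := β * (γ + b * β))
    hθ0 (by positivity) (by positivity) (h.trans_eq (by ring))
  have h2 : β * (γ + b * β) / θ ≤ 2 * β ^ 2 + 20 * b * γ ^ 2 := by
    rw [div_le_iff₀ hθ0]
    have e1 : b * θ = b + b ^ 2 + 1 := by rw [hθ]; field_simp
    have e2 : 1 + b ≤ θ := by rw [hθ]; linarith [show 0 < 1 / b by positivity]
    have e3 : (2 * β ^ 2 + 20 * b * γ ^ 2) * θ = 2 * β ^ 2 * θ + 20 * γ ^ 2 * (b * θ) := by ring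
    have e4 : 2 * β ^ 2 * (1 + b) ≤ 2 * β ^ 2 * θ := by gcongr
    rw [e3, e1]
    have e5 : 0 ≤ γ ^ 2 * (b + b ^ 2) := by positivity
    have e6 : 0 ≤ b * β ^ 2 := by positivity
    nlinarith [sq_nonneg (β - γ), sq_nonneg γ]
  have h3 : 2 * (θ * A ^ 2 * a) * δ ≤ b * δ ^ 2 + θ ^ 2 * A ^ 4 / b * a ^ 2 := by
    have : b * δ ^ 2 + θ ^ 2 * A ^ 4 / b * a ^ 2 - 2 * (θ * A ^ 2 * a) * δ =
      (b * δ - θ * A ^ 2 * a) ^ 2 / b := by field_simp; ring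
    have h4 : 0 ≤ (b * δ - θ * A ^ 2 * a) ^ 2 / b := by positivity
    linarith
  linarith

end KawaharaBurgers

namespace KawaharaBurgers

/-! ## The differential inequalities at a fixed time -/

variable {b B : ℝ}

/-- The time derivative prescribed by the equation. -/
def Jet.rhs {α : Type*} (J : Jet α) (p : α) : ℝ :=
  J.x2 p - J.x3 p - J.f p * J.x1 p - J.xyy p + J.x5 p

/-- The exponential growth rate of weighted energies for coefficients bounded by `A`. -/
noncomputable def growthRate (b A : ℝ) : ℝ :=
  (4 * A ^ 2 * b * (1 + b) + b ^ 3) + (1 + b + 1 / b) ^ 2 * A ^ 4 / b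
    + 541 * ((2 * b) ^ 2 + (2 * b) ^ 3 + (2 * b) ^ 5)

theorem growthRate_nonneg (hb : 0 < b) (A : ℝ) : 0 ≤ growthRate b A := by
  unfold growthRate; positivity

/-- The nonlinearity `n` is left free, so that the identity serves both a single solution and a
difference of two. -/
theorem SliceRegular.energy {ρ : ℕ → ℝ → ℝ} (hB : 0 < B) (hρ : IsEnergyWeight b ρ)
    {J : Jet (ℝ × ℝ)} (hJ : SliceRegular b B J) {n : ℝ × ℝ → ℝ}
    (hn : Integrable (fun z => ρ 0 z.1 * (J.f z * n z)) (stripMeasure B)) :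
    2 * ∫ z, ρ 0 z.1 * (J.f z * (J.x2 z - J.x3 z - n z - J.xyy z + J.x5 z)) ∂(stripMeasure B) =
    -(2 * winner B (ρ 0) J.x1 J.x1 + 3 * winner B (ρ 1) J.x1 J.x1 - 5 * winner B (ρ 3) J.x1 J.x1)
      - 5 * winner B (ρ 1) J.x2 J.x2 - winner B (ρ 1) J.y J.y
      - (-winner B (ρ 2) J.f J.f - winner B (ρ 3) J.f J.f + winner B (ρ 5) J.f J.f)
      - 2 * ∫ z, ρ 0 z.1 * (J.f z * n z) ∂(stripMeasure B) := by
  rw [← hJ.linear_energy hB hρ]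
  have i2 := hρ.integrable (Nat.zero_le _) hJ.wf hJ.wx2
  have i3 := hρ.integrable (Nat.zero_le _) hJ.wf hJ.wx3
  have i4 := hρ.integrable (Nat.zero_le _) hJ.wf hJ.wxyy
  have i5 := hρ.integrable (Nat.zero_le _) hJ.wf hJ.wx5
  have e : ∫ z, ρ 0 z.1 * (J.f z * (J.x2 z - J.x3 z - n z - J.xyy z + J.x5 z)) ∂(stripMeasure B) =
      winner B (ρ 0) J.f J.x2 - winner B (ρ 0) J.f J.x3 - ∫ z, ρ 0 z.1 * (J.f z * n z)
        ∂(stripMeasure B) - winner B (ρ 0) J.f J.xyy + winner B (ρ 0) J.f J.x5 := by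
    unfold winner
    rw [← integral_sub' i2 i3, ← integral_sub' (i2.sub i3) hn,
      ← integral_sub' ((i2.sub i3).sub hn) i4, ← integral_add' (((i2.sub i3).sub hn).sub i4) i5]
    refine integral_congr_ae (ae_of_all _ fun z => ?_)
    simp only [Pi.sub_apply, Pi.add_apply]
    ring
  rw [e]; ring

theorem exp_sq (b x : ℝ) : Real.exp (b * x) ^ 2 = Real.exp (2 * b * x) := by
  rw [← Real.exp_nat_mul]; ring_nf

theorem winner_expWeight {f : ℝ × ℝ → ℝ} (hf : WMemLp b B f) (k : ℕ) :
    winner B (expWeight b k) f f =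
      (2 * b) ^ k * l2 B (fun z => Real.exp (b * z.1) * f z) ^ 2 := by
  rw [l2_sq hf, winner, ← integral_const_mul]
  refine integral_congr_ae (ae_of_all _ fun z => ?_)
  simp only [expWeight]
  rw [mul_pow (Real.exp _), exp_sq]; ring

/-- The exponential energy identity for the difference, with both cubic integrals absorbed into the
dissipation. The coefficients enter only through the `L²` norm of the sum. -/
theorem SliceRegular.difference_estimate (hB : 0 < B) (hb : 0 < b) (hb' : 0 ≤ 6 * b - 40 * b ^ 3)
    {J K : Jet (ℝ × ℝ)} (hJ : SliceRegular b B J) (hK : SliceRegular b B K)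
    (hw : SliceRegular b B (J.sub K)) {A : ℝ} (hA : l2 B (fun z => J.f z + K.f z) ≤ A) :
    2 * ∫ z, expWeight b 0 z.1 * ((J.f z - K.f z) * (J.rhs z - K.rhs z)) ∂(stripMeasure B) ≤
      growthRate b A *
        ∫ z, expWeight b 0 z.1 * ((J.f z - K.f z) * (J.f z - K.f z)) ∂(stripMeasure B) := by
  have hρ := isEnergyWeight_expWeight b
  set w := J.sub K with hwdef
  set s : ℝ × ℝ → ℝ := fun z => J.f z + K.f z
  set s' : ℝ × ℝ → ℝ := fun z => J.x1 z + K.x1 z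
  have hs : MemLp s 2 (stripMeasure B) := hJ.memLp_f.add hK.memLp_f
  have hs' : MemLp s' 2 (stripMeasure B) := hJ.memLp_x1.add hK.memLp_x1
  have hss' : ∀ᵐ y ∂(volume.restrict (Ioo 0 B)),
      HasACDeriv univ (fun x => s (x, y)) fun x => s' (x, y) := by
    filter_upwards [hJ.ac0, hK.ac0] with y h1 h2 using h1.add h2
  have i1 := hρ.integrable_triple hB hb hw hs' hw.wf hw.wx1 hw.ac0 (k := 0) (by norm_num)
  have i2 := hρ.integrable_triple hB hb hw hs hw.wx1 hw.wx2 hw.ac1 (k := 0) (by norm_num)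
  have i3 := hρ.integrable_triple hB hb hw hs hw.wf hw.wx1 hw.ac0 (k := 1) (by norm_num)
  -- The difference of the terms `u uₓ` is half of `(s w)ₓ`, since `u² - v² = (u + v)(u - v)`.
  set n : ℝ × ℝ → ℝ := fun z => (s' z * w.f z + s z * w.x1 z) / 2 with hn
  have e1 : (fun z => expWeight b 0 z.1 * (w.f z * n z)) = fun z =>
      (1 / 2) * (expWeight b 0 z.1 * (s' z * (w.f z * w.f z)) +
        expWeight b 0 z.1 * (s z * (w.f z * w.x1 z))) := by
    ext z; simp only [hn]; ring
  have hni : Integrable (fun z => expWeight b 0 z.1 * (w.f z * n z)) (stripMeasure B) := by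
    rw [e1]; exact (i1.add i2).const_mul _
  have e2 : 2 * ∫ z, expWeight b 0 z.1 * (w.f z * n z) ∂(stripMeasure B) =
      ∫ z, expWeight b 0 z.1 * (s' z * (w.f z * w.f z)) ∂(stripMeasure B) +
        ∫ z, expWeight b 0 z.1 * (s z * (w.f z * w.x1 z)) ∂(stripMeasure B) := by
    rw [e1, integral_const_mul, integral_add i1 i2]; ring
  -- This removes `s'`, which has no uniform bound; what remains are the integrals of `ρ' s w²` and
  -- `ρ s w wₓ`.
  have e3 := hρ.ibp_triple hB hb hw hs hs' hss'
  have e4 : ∫ z, expWeight b 0 z.1 * ((J.f z - K.f z) * (J.rhs z - K.rhs z)) ∂(stripMeasure B) =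
      ∫ z, expWeight b 0 z.1 * (w.f z * (w.x2 z - w.x3 z - n z - w.xyy z + w.x5 z))
        ∂(stripMeasure B) := by
    refine integral_congr_ae (ae_of_all _ fun z => ?_)
    simp only [hn, hwdef, Jet.sub, Jet.rhs, s, s']
    ring
  have e5 := hw.energy hB hρ hni
  rw [e4, e5, e2]
  change _ ≤ growthRate b A * winner B (expWeight b 0) w.f w.f
  have t1 := hw.trilinear_exp hB hb hs hw.wf hw.wx1 hw.ac0
  have t2 := hw.trilinear_exp hB hb hs hw.wx1 hw.wx2 hw.ac1
  simp only [winner_expWeight hw.wf, winner_expWeight hw.wx1, winner_expWeight hw.wx2,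
    winner_expWeight hw.wy]
  set a := l2 B fun z => Real.exp (b * z.1) * w.f z with ha
  set β := l2 B fun z => Real.exp (b * z.1) * w.x1 z with hβ
  set γ := l2 B fun z => Real.exp (b * z.1) * w.x2 z with hγ
  set δ := l2 B fun z => Real.exp (b * z.1) * w.y z with hδ
  have ha0 : 0 ≤ a := l2_nonneg _ _
  have hβ0 : 0 ≤ β := l2_nonneg _ _
  have hγ0 : 0 ≤ γ := l2_nonneg _ _
  have hδ0 : 0 ≤ δ := l2_nonneg _ _
  have hs0 : 0 ≤ l2 B s := l2_nonneg _ _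
  have q1 := absorb_cubic hb hβ0 ha0 hδ0 (A := A) (t1.2.trans (by gcongr))
  have q2 := absorb_transport hb hβ0 hγ0 ha0 hδ0 (A := A) (t2.2.trans (by gcongr))
  have r1 : ∫ z, expWeight b 1 z.1 * (s z * (w.f z * w.f z)) ∂(stripMeasure B) ≤
      2 * b * ∫ z, |s z * (Real.exp (b * z.1) ^ 2 * (w.f z * w.f z))| ∂(stripMeasure B) := by
    rw [← integral_const_mul]
    refine integral_mono i3 (t1.1.abs.const_mul _) fun z => ?_
    have : expWeight b 1 z.1 * (s z * (w.f z * w.f z)) =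
      2 * b * (s z * (Real.exp (b * z.1) ^ 2 * (w.f z * w.f z))) := by
      rw [exp_sq, expWeight]; ring
    simp only [this]
    gcongr
    exact le_abs_self _
  have r2 : ∫ z, expWeight b 0 z.1 * (s z * (w.f z * w.x1 z)) ∂(stripMeasure B) ≤
      ∫ z, |s z * (Real.exp (b * z.1) ^ 2 * (w.f z * w.x1 z))| ∂(stripMeasure B) := by
    refine integral_mono i2 t2.1.abs fun z => ?_
    have : expWeight b 0 z.1 * (s z * (w.f z * w.x1 z)) =
      s z * (Real.exp (b * z.1) ^ 2 * (w.f z * w.x1 z)) := by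
      rw [exp_sq, expWeight]; ring
    simp only [this]
    exact le_abs_self _
  -- The two absorptions use exactly `2β² + 10bγ² + 2bδ²` of the dissipation; this is the remainder,
  -- nonnegative by hypothesis.
  have p1 : 0 ≤ (6 * b - 40 * b ^ 3) * β ^ 2 := by positivity
  have p2 : 0 ≤ (540 * ((2 * b) ^ 2 + (2 * b) ^ 3 + (2 * b) ^ 5) + 2 * (2 * b) ^ 5) * a ^ 2 := by
    positivity
  unfold growthRate
  linarith

/-- The right side carries `bump²` and not the weight, because the cubic term can be integrated by
parts completely and then contains only the derivative of the weight. -/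
theorem SliceRegular.logistic_estimate (hB : 0 < B) (hb : 0 < b) (hb' : 0 ≤ 6 * b - 40 * b ^ 3)
    {J : Jet (ℝ × ℝ)} (hJ : SliceRegular b B J) {A : ℝ} (hA : l2 B J.f ≤ A) (n : ℕ) :
    2 * ∫ z, logisticWeight b n 0 z.1 * (J.f z * J.rhs z) ∂(stripMeasure B) ≤
      growthRate b A * ∫ z, bump b n z.1 ^ 2 * (J.f z * J.f z) ∂(stripMeasure B) := by
  have hρ := isEnergyWeight_logisticWeight hb n
  set ρ := logisticWeight b n with hρdef
  set κ := bump b n with hκ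
  have i0 := hρ.integrable_triple hB hb hJ hJ.memLp_f hJ.wx1 hJ.wx2 hJ.ac1 (k := 0) (by norm_num)
  have i1 := hρ.integrable_triple hB hb hJ hJ.memLp_f hJ.wf hJ.wx1 hJ.ac0 (k := 1) (by norm_num)
  have hcomm : ∀ z, ρ 0 z.1 * (J.f z * (J.f z * J.x1 z)) = ρ 0 z.1 * (J.x1 z * (J.f z * J.f z)) :=
    fun z => by ring
  -- With coefficient `u` itself this says `3∫ρ u² uₓ = -∫ρ' u³`, so no transport term remains.
  have e3 := hρ.ibp_triple hB hb hJ hJ.memLp_f hJ.memLp_x1 hJ.ac0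
  have e5 := hJ.energy hB hρ (n := fun z => J.f z * J.x1 z) i0
  have e6 : ∫ z, ρ 0 z.1 * (J.f z * J.rhs z) ∂(stripMeasure B) = ∫ z, ρ 0 z.1 *
      (J.f z * (J.x2 z - J.x3 z - J.f z * J.x1 z - J.xyy z + J.x5 z)) ∂(stripMeasure B) := rfl
  rw [e6, e5]
  simp only [hcomm] at e3 ⊢
  have hC : ∀ x, |κ x| ≤ Real.exp (b * n) * Real.exp (b * x) := fun x => by
    rw [abs_of_pos (bump_pos b n x)]; exact bump_le b n x
  have hκc := continuous_bump b n
  have t1 := SliceRegular.trilinear (κ := κ) hB hb (hasDerivAt_bump b n)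
    (by have := continuous_logistic b n; fun_prop) (fun x => (bump_pos b n x).le)
    (fun x => by
      rw [abs_mul, abs_mul, abs_of_pos hb, abs_of_pos (bump_pos b n x), mul_assoc]
      have h0 := logistic_pos b n x
      have h1 := logistic_lt_one b n x
      have : |1 - 2 * logistic b n x| ≤ 1 := by rw [abs_le]; constructor <;> linarith
      gcongr
      exact mul_le_of_le_one_left (bump_pos b n x).le this)
    (bump_le b n) hJ hJ.memLp_f hJ.wf hJ.wx1 hJ.ac0
  have bsq : ∀ {f : ℝ × ℝ → ℝ}, WMemLp b B f →
      winner B (fun x => κ x ^ 2) f f = l2 B (fun z => κ z.1 * f z) ^ 2 := fun {f} hf => by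
    rw [l2_sq (hf.memLp_mul hκc hC), winner]
    refine integral_congr_ae (ae_of_all _ fun z => ?_)
    ring
  have hκ2 : ∀ x, |κ x ^ 2| ≤ Real.exp (b * n) ^ 2 * Real.exp (2 * b * x) := fun x => by
    rw [abs_pow, ← exp_sq, ← mul_pow]
    gcongr
    exact hC x
  have bint : ∀ {f : ℝ × ℝ → ℝ}, WMemLp b B f →
      Integrable (fun z => κ z.1 ^ 2 * (f z * f z)) (stripMeasure B) := fun hf =>
    hf.integrable_mul hf (r := fun x => κ x ^ 2) (hκc.pow 2) hκ2
  have w1 : ∀ {f : ℝ × ℝ → ℝ}, WMemLp b B f → winner B (ρ 1) f f =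
      2 * b * l2 B (fun z => κ z.1 * f z) ^ 2 := fun {f} hf => by
    rw [← bsq hf, winner, winner, ← integral_const_mul]
    refine integral_congr_ae (ae_of_all _ fun z => ?_)
    simp only [hρdef, logisticWeight_one]
    ring
  have w2 : l2 B (fun z => κ z.1 * J.x1 z) ^ 2 ≤ winner B (ρ 0) J.x1 J.x1 := by
    rw [← bsq hJ.wx1]
    refine integral_mono (bint hJ.wx1) (hρ.integrable (by norm_num) hJ.wx1 hJ.wx1) fun z => ?_
    have := mul_self_nonneg (J.x1 z)
    simp only
    gcongr
    exact bump_sq_le b n z.1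
  have w3 : 0 ≤ 3 * winner B (ρ 1) J.x1 J.x1 - 5 * winner B (ρ 3) J.x1 J.x1 := by
    rw [winner, winner, ← integral_const_mul, ← integral_const_mul, ← integral_sub
      ((hρ.integrable (by norm_num) hJ.wx1 hJ.wx1).const_mul _)
      ((hρ.integrable (by norm_num) hJ.wx1 hJ.wx1).const_mul _)]
    refine integral_nonneg fun z => ?_
    have := mul_nonneg (logisticWeight_dissipative hb hb' n z.1) (mul_self_nonneg (J.x1 z))
    simp only [Pi.zero_apply, hρdef]
    linarith
  have w4 : -(-winner B (ρ 2) J.f J.f - winner B (ρ 3) J.f J.f + winner B (ρ 5) J.f J.f) ≤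
      541 * ((2 * b) ^ 2 + (2 * b) ^ 3 + (2 * b) ^ 5) * winner B (fun x => κ x ^ 2) J.f J.f := by
    have j2 := hρ.integrable (k := 2) (by norm_num) hJ.wf hJ.wf
    have j3 := hρ.integrable (k := 3) (by norm_num) hJ.wf hJ.wf
    have j5 := hρ.integrable (k := 5) (by norm_num) hJ.wf hJ.wf
    have : -(-winner B (ρ 2) J.f J.f - winner B (ρ 3) J.f J.f + winner B (ρ 5) J.f J.f) =
        winner B (ρ 2) J.f J.f + winner B (ρ 3) J.f J.f - winner B (ρ 5) J.f J.f := by ring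
    rw [this, winner, winner, winner, winner, ← integral_add' j2 j3, ← integral_sub' (j2.add j3) j5,
      ← integral_const_mul]
    refine integral_mono ((j2.add j3).sub j5) ((bint hJ.wf).const_mul _) fun z => ?_
    have h1 := (neg_le_abs _).trans (logisticWeight_lower_order hb n z.1)
    have h2 := mul_le_mul_of_nonneg_right h1 (mul_self_nonneg (J.f z))
    simp only [Pi.add_apply, Pi.sub_apply, hρdef, hκ]
    linarith
  rw [bsq hJ.wf] at w4
  have hfin : ∫ z, κ z.1 ^ 2 * (J.f z * J.f z) ∂(stripMeasure B) =
    l2 B (fun z => κ z.1 * J.f z) ^ 2 := bsq hJ.wf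
  rw [hfin]
  have r1 : ∫ z, ρ 1 z.1 * (J.f z * (J.f z * J.f z)) ∂(stripMeasure B) ≤
      2 * b * ∫ z, |J.f z * (κ z.1 ^ 2 * (J.f z * J.f z))| ∂(stripMeasure B) := by
    rw [← integral_const_mul]
    refine integral_mono i1 (t1.1.abs.const_mul _) fun z => ?_
    have : ρ 1 z.1 * (J.f z * (J.f z * J.f z)) =
      2 * b * (J.f z * (κ z.1 ^ 2 * (J.f z * J.f z))) := by
      rw [hρdef, logisticWeight_one]; ring
    simp only [this]
    gcongr
    exact le_abs_self _
  -- The cubic term occurs with factor `2/3`; nonnegativity of the majorant allows this to be raised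
  -- to `1`.
  have r0 : 0 ≤ ∫ z, |J.f z * (κ z.1 ^ 2 * (J.f z * J.f z))| ∂(stripMeasure B) :=
    integral_nonneg fun z => abs_nonneg _
  rw [w1 hJ.wx2, w1 hJ.wy]
  set X := ∫ z, |J.f z * (κ z.1 ^ 2 * (J.f z * J.f z))| ∂(stripMeasure B)
  set a := l2 B fun z => κ z.1 * J.f z with ha
  set β := l2 B fun z => κ z.1 * J.x1 z with hβ
  set γ := l2 B fun z => κ z.1 * J.x2 z with hγ
  set δ := l2 B fun z => κ z.1 * J.y z with hδ
  have ha0 : 0 ≤ a := l2_nonneg _ _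
  have hβ0 : 0 ≤ β := l2_nonneg _ _
  have hδ0 : 0 ≤ δ := l2_nonneg _ _
  have hs0 : 0 ≤ l2 B J.f := l2_nonneg _ _
  have q1 := absorb_cubic hb hβ0 ha0 hδ0 (A := A) (t1.2.trans (by gcongr))
  have p1 : 0 ≤ 2 * b * X := by positivity
  have p2 : 0 ≤ b * γ ^ 2 := by positivity
  have p3 : 0 ≤ b * δ ^ 2 := by positivity
  have p4 : 0 ≤ β ^ 2 := by positivity
  have p5 : 0 ≤ (1 + b + 1 / b) ^ 2 * A ^ 4 / b * a ^ 2 := by positivity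
  unfold growthRate
  linarith

end KawaharaBurgers

namespace KawaharaBurgers

/-! ## Dependence on time -/

variable {b B T : ℝ}

theorem restrict_Icc_eq (T : ℝ) :
    (volume : Measure ℝ).restrict (Icc 0 T) = volume.restrict (Ioo 0 T) :=
  (Measure.restrict_congr_set Ioo_ae_eq_Icc).symm

/-- Fubini for `g` transfers the primitive property from points to the space integral. Integrability
at a single time spreads to all times, since increments in time are integrals of `g`. -/
theorem isPrimitiveOn_integral {α : Type*} [MeasurableSpace α] {μ : Measure α} [SFinite μ]
    {F : ℝ → α → ℝ} {g : α × ℝ → ℝ} (hg : Integrable g (μ.prod (volume.restrict (Ioo 0 T))))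
    (hF : ∀ᵐ z ∂μ, IsPrimitiveOn (Icc 0 T) (fun t => F t z) fun t => g (z, t))
    {t₀ : ℝ} (ht₀ : t₀ ∈ Icc 0 T) (h0 : Integrable (F t₀) μ) :
    (∀ t ∈ Icc 0 T, Integrable (F t) μ) ∧
      IsPrimitiveOn (Icc 0 T) (fun t => ∫ z, F t z ∂μ) fun t => ∫ z, g (z, t) ∂μ := by
  have hg' : ∀ c ∈ Icc 0 T, ∀ d ∈ Icc 0 T, Integrable g (μ.prod (volume.restrict (uIoc c d))) := by
    intro c hc d hd
    have e : ∀ s : Set ℝ, μ.prod ((volume : Measure ℝ).restrict s) =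
        (μ.prod volume).restrict (univ ×ˢ s) := fun s => by
      rw [← Measure.prod_restrict, Measure.restrict_univ]
    rw [← restrict_Icc_eq, e] at hg
    rw [e]
    refine hg.mono_measure (Measure.restrict_mono (prod_mono_right ?_) le_rfl)
    exact uIoc_subset_uIcc.trans (ordConnected_Icc.uIcc_subset hc hd)
  have hdiff : ∀ c ∈ Icc 0 T, ∀ d ∈ Icc 0 T,
      (fun z => F d z - F c z) =ᵐ[μ] fun z => ∫ s in c..d, g (z, s) := fun c hc d hd => by
    filter_upwards [hF] with z hz using (hz c hc d hd).2
  have hint : ∀ c ∈ Icc 0 T, ∀ d ∈ Icc 0 T, Integrable (fun z => ∫ s in c..d, g (z, s)) μ := by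
    intro c hc d hd
    simp only [intervalIntegral.intervalIntegral_eq_integral_uIoc, smul_eq_mul]
    exact (hg' c hc d hd).integral_prod_left.const_mul _
  have hall : ∀ t ∈ Icc 0 T, Integrable (F t) μ := by
    intro t ht
    refine (h0.add (hint t₀ ht₀ t ht)).congr ?_
    filter_upwards [hdiff t₀ ht₀ t ht] with z hz
    simp only [Pi.add_apply, ← hz]; ring
  refine ⟨hall, fun c hc d hd => ⟨?_, ?_⟩⟩
  · rw [intervalIntegrable_iff]
    exact (hg' c hc d hd).integral_prod_right
  · rw [← integral_sub (hall d hd) (hall c hc), integral_congr_ae (hdiff c hc d hd)]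
    simp only [intervalIntegral.intervalIntegral_eq_integral_uIoc]
    rw [integral_smul]
    congr 1
    exact integral_integral_swap (f := fun z s => g (z, s)) (hg' c hc d hd)

theorem IsPrimitiveOn.le_add_integral {E D G : ℝ → ℝ} (hE : IsPrimitiveOn (Icc 0 T) E D)
    (hG : IntegrableOn G (Ioo 0 T)) (hG0 : ∀ t, 0 ≤ G t)
    (hD : ∀ᵐ t ∂(volume.restrict (Ioo 0 T)), D t ≤ G t) {t : ℝ} (ht : t ∈ Icc 0 T) :
    E t ≤ E 0 + ∫ s in Ioo 0 T, G s := by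
  have h0 : (0 : ℝ) ∈ Icc 0 T := ⟨le_rfl, ht.1.trans ht.2⟩
  have h1 := hE.eq_add h0 ht
  rw [← restrict_Icc_eq] at hD
  rw [IntegrableOn, ← restrict_Icc_eq] at hG
  have h2 := ae_uIoc_of_ae_restrict ordConnected_Icc hD h0 ht
  rw [uIoc_of_le ht.1] at h2
  have hsub : Ioc 0 t ⊆ Icc 0 T := fun s hs => ⟨hs.1.le, hs.2.trans ht.2⟩
  rw [h1, intervalIntegral.integral_of_le ht.1, ← restrict_Icc_eq]
  have h3 : ∫ s in Ioc 0 t, D s ≤ ∫ s in Ioc 0 t, G s :=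
    setIntegral_mono_ae_restrict
      ((intervalIntegrable_iff_integrableOn_Ioc_of_le ht.1).1 (hE 0 h0 t ht).1)
      (IntegrableOn.mono_set hG hsub) ((ae_restrict_iff' measurableSet_Ioc).2 h2)
  have h4 : ∫ s in Ioc 0 t, G s ≤ ∫ s in Icc 0 T, G s :=
    setIntegral_mono_set hG (ae_of_all _ hG0) hsub.eventuallyLE
  linarith

/-- The product `e^{-Kt}E` is a primitive of an almost everywhere nonpositive function. -/
theorem IsPrimitiveOn.gronwall {E D : ℝ → ℝ} {K : ℝ} (hE : IsPrimitiveOn (Icc 0 T) E D)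
    (hD : ∀ᵐ t ∂(volume.restrict (Ioo 0 T)), D t ≤ K * E t) {t : ℝ} (ht : t ∈ Icc 0 T) :
    E t ≤ Real.exp (K * t) * E 0 := by
  have h1 : IsPrimitiveOn (Icc 0 T) (fun t => Real.exp (-K * t))
      (fun t => Real.exp (-K * t) * -K) := by
    refine IsPrimitiveOn.of_hasDerivAt (fun t => ?_) (by fun_prop)
    simpa using ((hasDerivAt_id t).const_mul (-K)).exp
  have h2 := h1.mul ordConnected_Icc hE
  have h3 := h2.le_add_integral (G := fun _ => 0) (by simp) (fun _ => le_rfl) (by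
    filter_upwards [hD] with s hs
    have := mul_le_mul_of_nonneg_left hs (Real.exp_pos (-K * s)).le
    linarith) ht
  simp only [mul_zero, Real.exp_zero, one_mul, integral_zero, add_zero] at h3
  have h4 := mul_le_mul_of_nonneg_left h3 (Real.exp_pos (K * t)).le
  rwa [← mul_assoc, ← Real.exp_add, show K * t + -K * t = 0 by ring, Real.exp_zero, one_mul] at h4

/-- `W` is a version of `f` that is a primitive in time of `ft` for almost every point. -/
def IsTimePrimitive (B T : ℝ) (f ft : (ℝ × ℝ) × ℝ → ℝ) (W : ℝ → ℝ × ℝ → ℝ) : Prop :=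
  (∀ᵐ z ∂(stripMeasure B), IsPrimitiveOn (Icc 0 T) (fun t => W t z) fun t => ft (z, t)) ∧
    ∀ᵐ p ∂(cylMeasure B T), W p.2 p.1 = f p

theorem ae_cyl_slice_x {P : (ℝ × ℝ) × ℝ → Prop} (h : ∀ᵐ p ∂(cylMeasure B T), P p) :
    ∀ᵐ z ∂(stripMeasure B), ∀ᵐ t ∂(volume.restrict (Ioo 0 T)), P (z, t) := by
  rw [cylMeasure_eq] at h
  exact Measure.ae_ae_of_ae_prod h

theorem ae_cyl_slice_t {P : (ℝ × ℝ) × ℝ → Prop} (h : ∀ᵐ p ∂(cylMeasure B T), P p) :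
    ∀ᵐ t ∂(volume.restrict (Ioo 0 T)), ∀ᵐ z ∂(stripMeasure B), P (z, t) := by
  rw [cylMeasure_eq] at h
  exact Measure.ae_ae_of_ae_prod (Measure.measurePreserving_swap.quasiMeasurePreserving.ae h)

theorem IsTimePrimitive.sub {f g ft gt : (ℝ × ℝ) × ℝ → ℝ} {V W : ℝ → ℝ × ℝ → ℝ}
    (hV : IsTimePrimitive B T f ft V) (hW : IsTimePrimitive B T g gt W) :
    IsTimePrimitive B T (fun p => f p - g p) (fun p => ft p - gt p) (fun t z => V t z - W t z) := by
  constructor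
  · filter_upwards [hV.1, hW.1] with z h1 h2
    simpa [sub_eq_add_neg] using h1.add (h2.const_mul (-1))
  · filter_upwards [hV.2, hW.2] with p h1 h2
    rw [h1, h2]

/-- For almost every point of the strip the time derivative is integrable up to both ends of `(0,
T)`. The primitive therefore extends to the closed interval and has a value at time zero. -/
theorem exists_isTimePrimitive (hT : 0 < T) {f ft : (ℝ × ℝ) × ℝ → ℝ}
    (h : HasWeakDeriv (cylinder B T) [et] f ft) (hft : MemLp (weighted b ft) 2 (cylMeasure B T)) :
    ∃ W, IsTimePrimitive B T f ft W := by
  have hme : MeasurePreserving (Prod.swap : ℝ × (ℝ × ℝ) → (ℝ × ℝ) × ℝ) :=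
    measurePreserving_swap_time
  obtain ⟨x₀, hx₀, c, -, hc⟩ := h.exists_ae_eq_add_integral (isOpen_cylinder B T)
    (convex_cylinder B T) hme
    (by intro x z a; simp [et]) (I := Ioo 0 T) (S := strip B) measurableSet_Ioo ordConnected_Ioo
    (by simpa using hT) (isOpen_strip B).measurableSet
    (by ext q; simp [cylinder, and_comm])
  refine ⟨fun t z => c z + ∫ s in x₀..t, ft (z, s), ?_, ?_⟩
  · rw [cylMeasure_eq] at hft
    filter_upwards [memLp_two_prod_right_ae hft] with z hz
    have h1 : IntegrableOn (fun t => ft (z, t)) (Icc 0 T) := by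
      rw [IntegrableOn, restrict_Icc_eq]
      refine ((hz.integrable (by norm_num)).const_mul (Real.exp (-(b * z.1)))).congr
        (ae_of_all _ fun t => ?_)
      simp only [weighted]
      rw [← mul_assoc, ← Real.exp_add]; simp
    have h2 : ∀ a ∈ Icc 0 T, ∀ d ∈ Icc 0 T,
        IntervalIntegrable (fun t => ft (z, t)) volume a d := fun a ha d hd =>
      (h1.mono_set (ordConnected_Icc.uIcc_subset ha hd)).intervalIntegrable
    have hx₀' : x₀ ∈ Icc 0 T := Ioo_subset_Icc_self hx₀
    intro a ha d hd
    refine ⟨h2 a ha d hd, ?_⟩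
    have := intervalIntegral.integral_interval_sub_left (h2 x₀ hx₀' d hd) (h2 x₀ hx₀' a ha)
    linarith
  · rw [cylMeasure_eq]
    have := Measure.measurePreserving_swap.quasiMeasurePreserving.ae
      (μa := (stripMeasure B).prod (volume.restrict (Ioo 0 T))) hc
    filter_upwards [this] with p hp using hp.symm

theorem neBot_ae_restrict_Ioo (hT : 0 < T) : (ae ((volume : Measure ℝ).restrict (Ioo 0 T))).NeBot := by
  rw [ae_neBot, Ne, Measure.restrict_eq_zero]
  simpa using hT

theorem integrable_cyl_mul {f g : (ℝ × ℝ) × ℝ → ℝ} (hf : MemLp (weighted b f) 2 (cylMeasure B T))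
    (hg : MemLp (weighted b g) 2 (cylMeasure B T)) {r : ℝ → ℝ} (hr : Continuous r) {C : ℝ}
    (hC : ∀ x, |r x| ≤ C * Real.exp (2 * b * x)) :
    Integrable (fun p => r p.1.1 * (f p * g p)) (cylMeasure B T) := by
  have hm : Continuous fun p : (ℝ × ℝ) × ℝ => r p.1.1 * (Real.exp (-b * p.1.1) ^ 2) := by fun_prop
  have h1 := MemLp.integrable_mul hf hg
  have e : (fun p : (ℝ × ℝ) × ℝ => r p.1.1 * (f p * g p)) = fun p =>
      (r p.1.1 * (Real.exp (-b * p.1.1) ^ 2)) * (weighted b f * weighted b g) p := by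
    ext p
    conv_lhs => rw [← exp_neg_mul_weighted b f, ← exp_neg_mul_weighted b g]
    simp only [Pi.mul_apply]; ring
  rw [e]
  refine h1.bdd_mul (c := C) hm.aestronglyMeasurable (ae_of_all _ fun p => ?_)
  rw [norm_mul, Real.norm_eq_abs, Real.norm_of_nonneg (by positivity), exp_sq]
  calc |r p.1.1| * Real.exp (2 * -b * p.1.1)
      ≤ (C * Real.exp (2 * b * p.1.1)) * Real.exp (2 * -b * p.1.1) := by gcongr; exact hC _
    _ = C := by rw [mul_assoc, ← Real.exp_add]; ring_nf; simp

theorem IsTimePrimitive.energy (hT : 0 < T) {f ft : (ℝ × ℝ) × ℝ → ℝ} {W : ℝ → ℝ × ℝ → ℝ}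
    (hW : IsTimePrimitive B T f ft W) (hf : MemLp (weighted b f) 2 (cylMeasure B T))
    (hft : MemLp (weighted b ft) 2 (cylMeasure B T)) {r : ℝ → ℝ} (hr : Continuous r) {C : ℝ}
    (hC : ∀ x, |r x| ≤ C * Real.exp (2 * b * x)) :
    (∀ t ∈ Icc 0 T, Integrable (fun z => r z.1 * (W t z * W t z)) (stripMeasure B)) ∧
    IsPrimitiveOn (Icc 0 T) (fun t => ∫ z, r z.1 * (W t z * W t z) ∂(stripMeasure B))
      fun t => 2 * ∫ z, r z.1 * (f (z, t) * ft (z, t)) ∂(stripMeasure B) := by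
  have hg := (integrable_cyl_mul hf hft hr hC).const_mul 2
  rw [cylMeasure_eq] at hg
  have := neBot_ae_restrict_Ioo hT
  -- One time at which the energy is known to be finite is enough to start.
  obtain ⟨t₀, h1, h2, h3⟩ := ((ae_restrict_mem measurableSet_Ioo).and
    ((ae_cyl_slice_t hW.2).and (ae_wMemLp_slice hf))).exists
  have h0 : Integrable (fun z => r z.1 * (W t₀ z * W t₀ z)) (stripMeasure B) := by
    refine (h3.integrable_mul h3 hr hC).congr ?_
    filter_upwards [h2] with z hz
    rw [hz]
  have key := isPrimitiveOn_integral (F := fun t z => r z.1 * (W t z * W t z)) hg (by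
    filter_upwards [hW.1, ae_cyl_slice_x hW.2] with z hz hz'
    refine ((hz.mul ordConnected_Icc hz).const_mul (r z.1)).congr_ae ordConnected_Icc ?_
    rw [restrict_Icc_eq]
    filter_upwards [hz'] with t ht
    rw [ht]; ring) (Ioo_subset_Icc_self h1) h0
  simp only [integral_const_mul] at key
  exact key

theorem IsPrimitiveOn.tendsto_of_seq {F f : ℝ → ℝ} (hF : IsPrimitiveOn (Icc 0 T) F f) {t : ℝ}
    (ht : t ∈ Icc 0 T) {r : ℕ → ℝ} (hr : ∀ n, r n ∈ Icc 0 T) (hrt : Tendsto r atTop (𝓝 t)) :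
    Tendsto (fun n => F (r n)) atTop (𝓝 (F t)) := by
  have hT : 0 ≤ T := ht.1.trans ht.2
  have h1 := hF.continuousOn_uIcc ordConnected_Icc (left_mem_Icc.2 hT) (right_mem_Icc.2 hT)
  rw [uIcc_of_le hT] at h1
  exact (h1 t ht).tendsto.comp (tendsto_nhdsWithin_iff.2 ⟨hrt, Eventually.of_forall hr⟩)

/-- The versions agree at almost every time, so at times `r n` tending to `t`. Along a subsequence
`U (r n)` converges almost everywhere to `U t`, by weighted `L²` continuity, and `W (r n)` converges
pointwise to `W t`, by continuity of primitives. -/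
theorem IsTimeContinuousVersion.ae_eq (hT : 0 < T) {u ut : (ℝ × ℝ) × ℝ → ℝ}
    {U W : ℝ → ℝ × ℝ → ℝ} (hU : IsTimeContinuousVersion b B T u U)
    (hW : IsTimePrimitive B T u ut W) {t : ℝ} (ht : t ∈ Icc 0 T) :
    U t =ᵐ[stripMeasure B] W t := by
  obtain ⟨hU1, hU2, hU3⟩ := hU
  have hgood : ∀ᵐ r : ℝ, r ∈ Ioo 0 T → U r =ᵐ[stripMeasure B] W r := by
    rw [← ae_restrict_iff' measurableSet_Ioo]
    filter_upwards [hU3, ae_cyl_slice_t hW.2] with r h1 h2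
    filter_upwards [h1, h2] with z h3 h4
    rw [h3, h4]
  have hcl : t ∈ closure (Ioo 0 T ∩ {r | r ∈ Ioo 0 T → U r =ᵐ[stripMeasure B] W r}) := by
    have h1 := (Measure.dense_of_ae hgood).open_subset_closure_inter (isOpen_Ioo (a := 0) (b := T))
    rw [← closure_Ioo hT.ne] at ht
    exact closure_minimal h1 isClosed_closure ht
  obtain ⟨r, hr, hrt⟩ := mem_closure_iff_seq_limit.1 hcl
  have hrI : ∀ n, r n ∈ Icc 0 T := fun n => Ioo_subset_Icc_self (hr n).1
  have hlim := (hU2 t ht).comp (tendsto_nhdsWithin_iff.2 ⟨hrt, Eventually.of_forall hrI⟩)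
  have hmeas : TendstoInMeasure (stripMeasure B) (fun n z => Real.exp (b * z.1) * U (r n) z) atTop
      (fun z => Real.exp (b * z.1) * U t z) := by
    refine tendstoInMeasure_of_tendsto_eLpNorm two_ne_zero (fun n => (hU1 _ (hrI n)).1)
      (hU1 t ht).1 ?_
    refine hlim.congr fun n => ?_
    simp only [Function.comp, mul_sub]
    rfl
  obtain ⟨φ, hφ, hφt⟩ := hmeas.exists_seq_tendsto_ae
  have hall : ∀ᵐ z ∂(stripMeasure B), ∀ n, U (r n) z = W (r n) z :=
    ae_all_iff.2 fun n => (hr n).2 (hr n).1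
  filter_upwards [hφt, hall, hW.1] with z h1 h2 h3
  simp only [h2] at h1
  have h4 := (h3.tendsto_of_seq ht (fun n => hrI (φ n)) (hrt.comp hφ.tendsto_atTop)).const_mul
    (Real.exp (b * z.1))
  exact mul_left_cancel₀ (Real.exp_ne_zero _) (tendsto_nhds_unique h1 h4)

end KawaharaBurgers

namespace KawaharaBurgers

/-! ## Estimates for regular solutions -/

variable {b B T : ℝ}

/-- A solution with its derivatives and its primitive version in time. -/
structure IsSolutionJet (b B T : ℝ) (u₀ : ℝ × ℝ → ℝ) (J : Jet ((ℝ × ℝ) × ℝ))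
    (ut : (ℝ × ℝ) × ℝ → ℝ) (W : ℝ → ℝ × ℝ → ℝ) : Prop where
  regular : CylRegular b B T J ut
  equation : ∀ᵐ t ∂(volume.restrict (Ioo 0 T)), ∀ᵐ z ∂(stripMeasure B),
    ut (z, t) = (J.slice t).rhs z
  primitive : IsTimePrimitive B T J.f ut W
  initial : W 0 =ᵐ[stripMeasure B] u₀
  bounded : ∃ A : ℝ, ∀ᵐ t ∂(volume.restrict (Ioo 0 T)), l2 B (J.slice t).f ≤ A

theorem IsRegularSolution.exists_isSolutionJet (hB : 0 < B) (hT : 0 < T) {u₀ : ℝ × ℝ → ℝ}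
    {u : (ℝ × ℝ) × ℝ → ℝ} (h : IsRegularSolution b B T u₀ u) :
    ∃ J ut W, IsSolutionJet b B T u₀ J ut W ∧ J.f = u := by
  obtain ⟨J, ut, hJ, rfl, heq⟩ := h.exists_jet hB
  obtain ⟨W, hW⟩ := exists_isTimePrimitive hT hJ.dt hJ.wt
  obtain ⟨-, -, -, -, -, -, -, -, -, -, -, -, -, -, mu, -, -, -, -, -, -, -, -, -, -, -, U, hU,
    hU0⟩ := h
  obtain ⟨A, hA, hA'⟩ := mu.exists_bound
  refine ⟨J, ut, W, ⟨hJ, heq, hW, ?_, A, ?_⟩, rfl⟩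
  · exact (hU.ae_eq hT hW (left_mem_Icc.2 hT.le)).symm.trans hU0
  · filter_upwards [hA'] with t ht
    exact (ENNReal.toReal_mono ENNReal.ofReal_ne_top ht).trans_eq (ENNReal.toReal_ofReal hA)

theorem logistic_mul_sq_tendsto (hb : 0 < b) {f : ℝ × ℝ → ℝ} (hf : MemLp f 2 (stripMeasure B)) :
    Tendsto (fun n => ∫ z, logisticWeight b n 0 z.1 * (f z * f z) ∂(stripMeasure B)) atTop
      (𝓝 (l2 B f ^ 2)) := by
  rw [l2_sq hf]
  have hw : ∀ n x, logisticWeight b n 0 x = logistic b n x := fun n x => by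
    simp [logisticWeight, logisticPoly]
  simp only [hw]
  refine tendsto_integral_of_dominated_convergence (fun z => f z ^ 2) (fun n => ?_)
    hf.integrable_sq (fun n => ae_of_all _ fun z => ?_) (ae_of_all _ fun z => ?_)
  · exact ((continuous_logistic b n).comp continuous_fst).aestronglyMeasurable.mul
      (hf.1.mul hf.1)
  · rw [norm_mul, norm_mul, Real.norm_of_nonneg (logistic_pos b n z.1).le, ← sq,
      Real.norm_eq_abs, sq_abs]
    exact mul_le_of_le_one_left (sq_nonneg _) (logistic_lt_one b n z.1).le
  · have := (tendsto_logistic hb z.1).mul_const (f z * f z)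
    simpa only [one_mul, sq] using this

theorem logistic_mul_sq_le {f : ℝ × ℝ → ℝ} (hf : MemLp f 2 (stripMeasure B)) (n : ℕ) :
    ∫ z, logisticWeight b n 0 z.1 * (f z * f z) ∂(stripMeasure B) ≤ l2 B f ^ 2 := by
  rw [l2_sq hf]
  refine integral_mono_of_nonneg (ae_of_all _ fun z => ?_) hf.integrable_sq
    (ae_of_all _ fun z => ?_)
  · have := (logistic_pos b n z.1).le
    have := mul_self_nonneg (f z)
    simp only [logisticWeight, logisticPoly, Pi.zero_apply]
    positivity
  · simp only [logisticWeight, logisticPoly, pow_zero, one_mul, ← sq]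
    exact mul_le_of_le_one_left (sq_nonneg _) (logistic_lt_one b n z.1).le

theorem bump_sq_le_one (b : ℝ) (n : ℕ) (x : ℝ) : bump b n x ^ 2 ≤ 1 := by
  rw [bump_sq]
  nlinarith [logistic_pos b n x, logistic_lt_one b n x]

theorem integrable_bump_mul_sq {f : (ℝ × ℝ) × ℝ → ℝ} (hf : MemLp f 2 (cylMeasure B T)) (n : ℕ) :
    Integrable (fun p => bump b n p.1.1 ^ 2 * (f p * f p)) (cylMeasure B T) := by
  have hc := continuous_bump b n
  refine Integrable.bdd_mul (c := 1) (MemLp.integrable_mul hf hf)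
    (Continuous.aestronglyMeasurable (by fun_prop)) (ae_of_all _ fun p => ?_)
  rw [Real.norm_of_nonneg (sq_nonneg _)]
  exact bump_sq_le_one b n _

theorem bump_mul_sq_tendsto (hb : 0 < b) {f : (ℝ × ℝ) × ℝ → ℝ} (hf : MemLp f 2 (cylMeasure B T)) :
    Tendsto (fun n => ∫ p, bump b n p.1.1 ^ 2 * (f p * f p) ∂(cylMeasure B T)) atTop (𝓝 0) := by
  have h0 : ∫ p : (ℝ × ℝ) × ℝ, 0 * (f p * f p) ∂(cylMeasure B T) = 0 := by simp
  rw [← h0]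
  refine tendsto_integral_of_dominated_convergence (fun p => f p ^ 2)
    (fun n => (integrable_bump_mul_sq hf n).1) hf.integrable_sq
    (fun n => ae_of_all _ fun p => ?_)
    (ae_of_all _ fun p => (tendsto_bump_sq hb p.1.1).mul_const _)
  rw [norm_mul, norm_mul, Real.norm_of_nonneg (sq_nonneg (bump b n p.1.1)), ← sq,
    Real.norm_eq_abs, sq_abs]
  exact mul_le_of_le_one_left (sq_nonneg _) (bump_sq_le_one b n _)

/-- The norm of a solution is bounded by the norm of its initial datum. -/
theorem IsSolutionJet.l2_le (hB : 0 < B) (hb : 0 < b) (hb' : 0 ≤ 6 * b - 40 * b ^ 3) (hT : 0 < T)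
    {u₀ : ℝ × ℝ → ℝ} {J : Jet ((ℝ × ℝ) × ℝ)} {ut : (ℝ × ℝ) × ℝ → ℝ} {W : ℝ → ℝ × ℝ → ℝ}
    (h : IsSolutionJet b B T u₀ J ut W) (hu₀ : MemLp u₀ 2 (stripMeasure B)) :
    ∀ᵐ t ∂(volume.restrict (Ioo 0 T)), l2 B (J.slice t).f ≤ l2 B u₀ := by
  -- This bound is purely qualitative: it multiplies only the error term, and so does not survive
  -- the limit.
  obtain ⟨A, hA⟩ := h.bounded
  have hR := growthRate_nonneg hb A
  have hreg := h.regular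
  have key : ∀ n : ℕ, ∀ t ∈ Icc 0 T,
      ∫ z, logisticWeight b n 0 z.1 * (W t z * W t z) ∂(stripMeasure B) ≤ l2 B u₀ ^ 2 +
        growthRate b A * ∫ p, bump b n p.1.1 ^ 2 * (J.f p * J.f p) ∂(cylMeasure B T) := by
    intro n t ht
    have hρ := isEnergyWeight_logisticWeight hb n
    obtain ⟨C, hC⟩ := hρ.bound
    have hE := (h.primitive.energy hT hreg.wf hreg.wt (hρ.continuous 0)
      (fun x => hC 0 x (by norm_num))).2
    have hbi := integrable_bump_mul_sq (b := b) hreg.memLp_f n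
    rw [cylMeasure_eq] at hbi
    have hG := hbi.integral_prod_right.const_mul (growthRate b A)
    have h1 := hE.le_add_integral hG
      (fun t => mul_nonneg hR (integral_nonneg fun z =>
        mul_nonneg (sq_nonneg _) (mul_self_nonneg _))) (by
        filter_upwards [hreg.ae_slice hB, hA, h.equation] with s h2 h3 h4
        refine le_trans (le_of_eq ?_) (h2.logistic_estimate hB hb hb' h3 n)
        congr 1
        refine integral_congr_ae ?_
        filter_upwards [h4] with z hz
        rw [hz]; rfl) ht
    have h2 : ∫ z, logisticWeight b n 0 z.1 * (W 0 z * W 0 z) ∂(stripMeasure B) ≤ l2 B u₀ ^ 2 := by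
      refine le_trans (le_of_eq (integral_congr_ae ?_)) (logistic_mul_sq_le (b := b) hu₀ n)
      filter_upwards [h.initial] with z hz
      rw [hz]
    rw [integral_const_mul, ← integral_prod_symm _ hbi, ← cylMeasure_eq] at h1
    linarith
  filter_upwards [ae_restrict_mem measurableSet_Ioo, hreg.ae_slice hB,
    ae_cyl_slice_t h.primitive.2] with t h1 h2 h3
  -- As `n → ∞` the logistic weight increases its reach to the whole line, and the error vanishes by
  -- dominated convergence, since `bump²` is at most `1` and tends to zero pointwise.
  have hlim : Tendsto (fun n => l2 B u₀ ^ 2 +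
      growthRate b A * ∫ p, bump b n p.1.1 ^ 2 * (J.f p * J.f p) ∂(cylMeasure B T)) atTop
      (𝓝 (l2 B u₀ ^ 2 + growthRate b A * 0)) :=
    ((bump_mul_sq_tendsto hb hreg.memLp_f).const_mul _).const_add _
  have h4 := le_of_tendsto_of_tendsto' (logistic_mul_sq_tendsto hb h2.memLp_f) hlim (fun n => by
    refine le_trans (le_of_eq (integral_congr_ae ?_)) (key n t (Ioo_subset_Icc_self h1))
    filter_upwards [h3] with z hz
    rw [hz]; rfl)
  rw [mul_zero, add_zero] at h4
  exact le_of_abs_le (abs_le_of_sq_le_sq h4 (l2_nonneg _ _))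

theorem l2_add_le {f g : ℝ × ℝ → ℝ} (hf : MemLp f 2 (stripMeasure B))
    (hg : MemLp g 2 (stripMeasure B)) : l2 B (fun z => f z + g z) ≤ l2 B f + l2 B g := by
  rw [l2, l2, l2, ← ENNReal.toReal_add hf.eLpNorm_ne_top hg.eLpNorm_ne_top]
  exact ENNReal.toReal_mono (ENNReal.add_ne_top.2 ⟨hf.eLpNorm_ne_top, hg.eLpNorm_ne_top⟩)
    (eLpNorm_add_le hf.1 hg.1 (by norm_num))

theorem abs_expWeight_zero_le (b x : ℝ) : |expWeight b 0 x| ≤ 1 * Real.exp (2 * b * x) := by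
  simp [expWeight]

/-- The square of the weighted distance of two functions. -/
noncomputable def weightedDist (b B : ℝ) (f g : ℝ × ℝ → ℝ) : ℝ :=
  ∫ z, expWeight b 0 z.1 * ((f z - g z) * (f z - g z)) ∂(stripMeasure B)

theorem weightedDist_nonneg (b B : ℝ) (f g : ℝ × ℝ → ℝ) : 0 ≤ weightedDist b B f g :=
  integral_nonneg fun z => mul_nonneg (by rw [expWeight]; positivity) (mul_self_nonneg _)

theorem IsSolutionJet.integrable_weightedDist (hT : 0 < T) {u₀ v₀ : ℝ × ℝ → ℝ}
    {J K : Jet ((ℝ × ℝ) × ℝ)} {ut vt : (ℝ × ℝ) × ℝ → ℝ} {V W : ℝ → ℝ × ℝ → ℝ}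
    (h : IsSolutionJet b B T u₀ J ut V) (k : IsSolutionJet b B T v₀ K vt W) {t : ℝ}
    (ht : t ∈ Icc 0 T) : Integrable (fun z => expWeight b 0 z.1 * ((V t z - W t z) *
      (V t z - W t z))) (stripMeasure B) := by
  have hreg := h.regular.sub k.regular
  exact ((h.primitive.sub k.primitive).energy hT hreg.wf hreg.wt
    ((isEnergyWeight_expWeight b).continuous 0) (abs_expWeight_zero_le b)).1 t ht

theorem IsSolutionJet.weightedDist_le (hB : 0 < B) (hb : 0 < b) (hb' : 0 ≤ 6 * b - 40 * b ^ 3)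
    (hT : 0 < T) {u₀ v₀ : ℝ × ℝ → ℝ} {J K : Jet ((ℝ × ℝ) × ℝ)} {ut vt : (ℝ × ℝ) × ℝ → ℝ}
    {V W : ℝ → ℝ × ℝ → ℝ} (h : IsSolutionJet b B T u₀ J ut V)
    (k : IsSolutionJet b B T v₀ K vt W) (hu₀ : MemLp u₀ 2 (stripMeasure B))
    (hv₀ : MemLp v₀ 2 (stripMeasure B)) {M : ℝ} (hu : l2 B u₀ ≤ M) (hv : l2 B v₀ ≤ M) {t : ℝ}
    (ht : t ∈ Icc 0 T) :
    weightedDist b B (V t) (W t) ≤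
      Real.exp (growthRate b (2 * M) * T) * weightedDist b B u₀ v₀ := by
  have hreg := h.regular.sub k.regular
  have hE := ((h.primitive.sub k.primitive).energy hT hreg.wf hreg.wt
    ((isEnergyWeight_expWeight b).continuous 0) (abs_expWeight_zero_le b)).2
  have h1 := hE.gronwall (K := growthRate b (2 * M)) (by
    filter_upwards [h.regular.ae_slice hB, k.regular.ae_slice hB, hreg.ae_slice hB, h.equation,
      k.equation, h.l2_le hB hb hb' hT hu₀, k.l2_le hB hb hb' hT hv₀,
      ae_cyl_slice_t h.primitive.2, ae_cyl_slice_t k.primitive.2]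
      with s a1 a2 a3 a4 a5 a6 a7 a8 a9
    -- The unweighted bound for each solution makes the growth rate depend on the data through `M`
    -- only.
    have hA : l2 B (fun z => (J.slice s).f z + (K.slice s).f z) ≤ 2 * M := by
      have := l2_add_le a1.memLp_f a2.memLp_f
      linarith
    refine le_trans (le_of_eq ?_) ((a1.difference_estimate hB hb hb' a2 a3 hA).trans_eq ?_)
    · congr 1
      refine integral_congr_ae ?_
      filter_upwards [a4, a5] with z h4 h5
      rw [h4, h5]; rfl
    · congr 1
      refine integral_congr_ae ?_
      filter_upwards [a8, a9] with z h8 h9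
      simp only [Jet.slice, ← h8, ← h9]) ht
  have h2 : weightedDist b B (V 0) (W 0) = weightedDist b B u₀ v₀ := by
    refine integral_congr_ae ?_
    filter_upwards [h.initial, k.initial] with z h1 h2
    rw [h1, h2]
  change weightedDist b B (V t) (W t) ≤ _ * weightedDist b B (V 0) (W 0) at h1
  rw [h2] at h1
  refine h1.trans ?_
  have := growthRate_nonneg hb (2 * M)
  have := weightedDist_nonneg b B u₀ v₀
  gcongr
  exact ht.2

/-! ### From real integrals to the quantities of the statement -/

theorem weightedSq_sub_eq {f g : ℝ × ℝ → ℝ} (h : Integrable (fun z => expWeight b 0 z.1 *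
    ((f z - g z) * (f z - g z))) (stripMeasure B)) :
    weightedSq b B (fun z => f z - g z) = ENNReal.ofReal (weightedDist b B f g) := by
  rw [weightedDist, ofReal_integral_eq_lintegral_ofReal h
    (ae_of_all _ fun z => mul_nonneg (by rw [expWeight]; positivity) (mul_self_nonneg _)),
    weightedSq]
  refine lintegral_congr fun z => ?_
  rw [expWeight, pow_zero, one_mul, sq]

theorem weightedSq_congr {f g : ℝ × ℝ → ℝ} (h : f =ᵐ[stripMeasure B] g) :
    weightedSq b B f = weightedSq b B g := by
  refine lintegral_congr_ae ?_
  filter_upwards [h] with z hz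
  rw [hz]

theorem IsInitialDatum.aestronglyMeasurable {u₀ : ℝ × ℝ → ℝ} (h : IsInitialDatum b B u₀) :
    AEStronglyMeasurable u₀ (stripMeasure B) := by
  obtain ⟨-, dx, -, -, -, -, -, -, hdx, -⟩ := h
  exact hdx.1.aestronglyMeasurable

theorem IsInitialDatum.memLp {u₀ : ℝ × ℝ → ℝ} (h : IsInitialDatum b B u₀) :
    MemLp u₀ 2 (stripMeasure B) := by
  refine ⟨h.aestronglyMeasurable, ?_⟩
  obtain ⟨-, dx, dy, dxx, dxy, dxxx, dxyy, dx5, -, -, -, -, -, -, -, hfin⟩ := h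
  have h1 : eLpNorm u₀ 2 (stripMeasure B) ^ 2 < ⊤ := by
    rw [eLpNorm_two_sq]
    refine lt_of_le_of_lt (lintegral_mono fun z => ?_) hfin
    rw [← enorm_pow, Real.enorm_of_nonneg (sq_nonneg _)]
    refine ENNReal.ofReal_le_ofReal (le_add_of_nonneg_right ?_)
    positivity
  exact (ENNReal.pow_lt_top_iff.1 h1).resolve_right two_ne_zero

/-- For equal data the weighted distance vanishes at almost every time. Its time integral is then
zero, and the weight is positive. -/
theorem IsRegularSolution.ae_eq (hB : 0 < B) (hb : 0 < b) (hb' : 0 ≤ 6 * b - 40 * b ^ 3)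
    (hT : 0 < T) {u₀ : ℝ × ℝ → ℝ} (hu₀ : MemLp u₀ 2 (stripMeasure B)) {u v : (ℝ × ℝ) × ℝ → ℝ}
    (hu : IsRegularSolution b B T u₀ u) (hv : IsRegularSolution b B T u₀ v) :
    u =ᵐ[cylMeasure B T] v := by
  obtain ⟨J, ut, V, h, rfl⟩ := hu.exists_isSolutionJet hB hT
  obtain ⟨K, vt, W, k, rfl⟩ := hv.exists_isSolutionJet hB hT
  have hreg := h.regular.sub k.regular
  have hint := integrable_cyl_mul hreg.wf hreg.wf ((isEnergyWeight_expWeight b).continuous 0)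
    (abs_expWeight_zero_le b)
  have hzero : ∫ p, expWeight b 0 p.1.1 * ((J.sub K).f p * (J.sub K).f p) ∂(cylMeasure B T) = 0 := by
    rw [cylMeasure_eq] at hint ⊢
    rw [integral_prod_symm _ hint]
    refine integral_eq_zero_of_ae ?_
    filter_upwards [ae_restrict_mem measurableSet_Ioo, ae_cyl_slice_t h.primitive.2,
      ae_cyl_slice_t k.primitive.2] with t ht h1 h2
    have h3 := h.weightedDist_le hB hb hb' hT k hu₀ hu₀ le_rfl le_rfl (Ioo_subset_Icc_self ht)
    have h4 : weightedDist b B u₀ u₀ = 0 := by simp [weightedDist]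
    rw [h4, mul_zero] at h3
    refine Eq.trans (integral_congr_ae ?_) (le_antisymm h3 (weightedDist_nonneg _ _ _ _))
    filter_upwards [h1, h2] with z h1 h2
    simp only [Jet.sub, ← h1, ← h2]
  rw [integral_eq_zero_iff_of_nonneg (fun p => mul_nonneg (by rw [expWeight]; positivity)
    (mul_self_nonneg _)) hint] at hzero
  filter_upwards [hzero] with p hp
  have h1 : expWeight b 0 p.1.1 ≠ 0 := by rw [expWeight]; positivity
  exact sub_eq_zero.1 (mul_self_eq_zero.1 ((mul_eq_zero.1 hp).resolve_left h1))

theorem IsRegularSolution.weightedSq_le (hB : 0 < B) (hb : 0 < b) (hb' : 0 ≤ 6 * b - 40 * b ^ 3)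
    (hT : 0 < T) {u₀ v₀ : ℝ × ℝ → ℝ} (hu₀ : MemLp u₀ 2 (stripMeasure B))
    (hv₀ : MemLp v₀ 2 (stripMeasure B)) {M : ℝ} (huM : l2 B u₀ ≤ M) (hvM : l2 B v₀ ≤ M)
    {u v : (ℝ × ℝ) × ℝ → ℝ} (hu : IsRegularSolution b B T u₀ u)
    (hv : IsRegularSolution b B T v₀ v) {U V : ℝ → ℝ × ℝ → ℝ}
    (hU : IsTimeContinuousVersion b B T u U) (hV : IsTimeContinuousVersion b B T v V) {t : ℝ}
    (ht : t ∈ Icc 0 T) :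
    weightedSq b B (fun z => U t z - V t z) ≤
      ENNReal.ofReal (Real.exp (growthRate b (2 * M) * T)) *
        weightedSq b B (fun z => u₀ z - v₀ z) := by
  obtain ⟨J, ut, U', h, rfl⟩ := hu.exists_isSolutionJet hB hT
  obtain ⟨K, vt, V', k, rfl⟩ := hv.exists_isSolutionJet hB hT
  have e1 : weightedSq b B (fun z => U t z - V t z) =
      weightedSq b B (fun z => U' t z - V' t z) := by
    refine weightedSq_congr ?_
    filter_upwards [hU.ae_eq hT h.primitive ht, hV.ae_eq hT k.primitive ht] with z h1 h2
    rw [h1, h2]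
  -- Finiteness of the initial distance is read off from the primitive versions at time zero, so no
  -- weighted bound on the data has to be supplied.
  have hi := h.integrable_weightedDist hT k (left_mem_Icc.2 hT.le)
  have hi₀ : Integrable (fun z => expWeight b 0 z.1 * ((u₀ z - v₀ z) * (u₀ z - v₀ z)))
      (stripMeasure B) := by
    refine hi.congr ?_
    filter_upwards [h.initial, k.initial] with z h1 h2
    rw [h1, h2]
  rw [e1, weightedSq_sub_eq (h.integrable_weightedDist hT k ht), weightedSq_sub_eq hi₀,
    ← ENNReal.ofReal_mul (Real.exp_pos _).le]
  exact ENNReal.ofReal_le_ofReal (h.weightedDist_le hB hb hb' hT k hu₀ hv₀ huM hvM ht)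

end KawaharaBurgers

theorem theorem3p5 (b : ℝ) (hb : 0 < b) (hb' : 0 ≤ 6 * b - 40 * b ^ 3) (T : ℝ) (hT : 0 < T) :
    -- uniqueness
    (∀ B : ℝ, 0 < B → ∀ u₀ : ℝ × ℝ → ℝ, KawaharaBurgers.IsInitialDatum b B u₀ →
      ∀ u₁ u₂ : (ℝ × ℝ) × ℝ → ℝ,
        KawaharaBurgers.IsRegularSolution b B T u₀ u₁ →
        KawaharaBurgers.IsRegularSolution b B T u₀ u₂ →
        u₁ =ᵐ[volume.restrict (KawaharaBurgers.cylinder B T)] u₂) ∧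
    -- continuous dependence on the initial data, with a constant `C = C(b, T, M)`
    (∀ M : ℝ, ∃ C : ℝ≥0, ∀ B : ℝ, 0 < B → ∀ u₀₁ u₀₂ : ℝ × ℝ → ℝ,
      KawaharaBurgers.IsInitialDatum b B u₀₁ → KawaharaBurgers.IsInitialDatum b B u₀₂ →
      eLpNorm u₀₁ 2 (volume.restrict (KawaharaBurgers.strip B)) ≤ ENNReal.ofReal M →
      eLpNorm u₀₂ 2 (volume.restrict (KawaharaBurgers.strip B)) ≤ ENNReal.ofReal M →
      ∀ u₁ u₂ : (ℝ × ℝ) × ℝ → ℝ,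
        KawaharaBurgers.IsRegularSolution b B T u₀₁ u₁ →
        KawaharaBurgers.IsRegularSolution b B T u₀₂ u₂ →
        ∀ U₁ U₂ : ℝ → ℝ × ℝ → ℝ,
          KawaharaBurgers.IsTimeContinuousVersion b B T u₁ U₁ →
          KawaharaBurgers.IsTimeContinuousVersion b B T u₂ U₂ →
          ∀ t ∈ Ioo 0 T,
            KawaharaBurgers.weightedSq b B (fun z => U₁ t z - U₂ t z) ≤
              (C : ℝ≥0∞) * KawaharaBurgers.weightedSq b B (fun z => u₀₁ z - u₀₂ z)) := by
  refine ⟨fun B hB u₀ hu₀ u₁ u₂ h₁ h₂ => h₁.ae_eq hB hb hb' hT hu₀.memLp h₂, fun M =>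
    -- Since `M` is an arbitrary real here, its truncation `max M 0` is used in the rate.
    ⟨(Real.exp (KawaharaBurgers.growthRate b (2 * (ENNReal.ofReal M).toReal) * T)).toNNReal,
      fun B hB u₀₁ u₀₂ h₀₁ h₀₂ hM₁ hM₂ u₁ u₂ h₁ h₂ U₁ U₂ hU₁ hU₂ t ht => ?_⟩⟩
  exact h₁.weightedSq_le hB hb hb' hT h₀₁.memLp h₀₂.memLp
    (ENNReal.toReal_mono ENNReal.ofReal_ne_top hM₁)
    (ENNReal.toReal_mono ENNReal.ofReal_ne_top hM₂) h₂ hU₁ hU₂ (Ioo_subset_Icc_self ht)
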